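/- A geometric graph $G=(V,E)$ is a simple undirected graph whose vertices are distinct points of the Euclidean plane, an edge $uv$ being drawn as the straight line segment between $u$ and $v$. Two different edges $uv$ and $wx$ intersect if their segments have a common point that is not an end point of both of them. $G$ has the redundancy property if for all intersecting edges $uv$, $wx$ one of $u,v,w,x$ is connected to the other three, i.e. $uw,ux\in E$ or $vw,vx\in E$ or $wu,wv\in E$ or $xu,xv\in E$ (if the two edges share an end point, this says that their two other end points are adjacent). $G$ has the coexistence property if, whenever $uv,vw,wu\in E$ and $x\in V\setminus\{u,v,w\}$ lies in the closed, possibly degenerate, triangle with corners $u,v,w$, then $ux,vx,wx\in E$. An edge $uv$ satisfies the CP-condition if for every edge $wx\in E$ intersecting $uv$ either $uw,ux\in E$ or $vw,vx\in E$. The CP-algorithm starts with $W=E$ and $F=\emptyset$; as long as $W\neq\emptyset$, it chooses an arbitrary edge $uv\in W$ and removes it from $W$, and, if $uv$ satisfies the CP-condition, adds $uv$ to $F$ and removes all edges intersecting $uv$ from $W$. Theorem. Let $G=(V,E)$ be a finite connected geometric graph with the redundancy and the coexistence property, and let $F$ be the edge set with which some run of the CP-algorithm on $G$ terminates (for any choice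 of the edges in the iterations). Then $F\subseteq E$ and the spanning subgraph $(V,F)$ of $G$ is plane, i.e. no two of its edges intersect. If moreover no vertex lies on an edge of $F$ other than at the two ends of that edge (which holds in particular if no vertex lies in the relative interior of an edge of $G$), then $(V,F)$ is connected. -/

import Mathlib

/-- A geometric graph with vertex set `V`: a simple graph (undirected, no self-loops) whose
vertices are distinct points of the Euclidean plane; an edge `uv` is drawn as the straight line
segment between the points of `u` and `v`. -/
structure GeometricGraph (V : Type*) extends SimpleGraph V where
  /-- the point of the plane at which a vertex is located -/
  pos : V ↪ EuclideanSpace ℝ (Fin 2)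

namespace GeometricGraph

variable {V : Type*}

/-- The segments `uv` and `wx` intersect: they are different segments and have a point in common
that is not an end point of both of them. -/
def Intersect (G : GeometricGraph V) (u v w x : V) : Prop :=
  s(u, v) ≠ s(w, x) ∧
    ∃ p, p ∈ segment ℝ (G.pos u) (G.pos v) ∧ p ∈ segment ℝ (G.pos w) (G.pos x) ∧
      ¬ ((p = G.pos u ∨ p = G.pos v) ∧ (p = G.pos w ∨ p = G.pos x))

/-- A plane graph: no two edges intersect. -/
def IsPlane (G : GeometricGraph V) : Prop :=
  ∀ u v w x : V, G.Adj u v → G.Adj w x → ¬ G.Intersect u v w x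

/-- Redundancy property: for any two intersecting edges `uv` and `wx`, one of `u`, `v`, `w`, `x`
is adjacent to the other three (in addition to the edges `uv` and `wx`, which are given).
When the two edges share an end point, adjacency of that vertex to itself is false, so it is the
two other vertices that are required to be adjacent. -/
def Redundancy (G : GeometricGraph V) : Prop :=
  ∀ u v w x : V, G.Adj u v → G.Adj w x → G.Intersect u v w x →
    (G.Adj u w ∧ G.Adj u x) ∨ (G.Adj v w ∧ G.Adj v x) ∨
    (G.Adj w u ∧ G.Adj w v) ∨ (G.Adj x u ∧ G.Adj x v)

/-- Coexistence property: a vertex `x` in the closed (possibly degenerate) triangle formed by three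
edges `uv`, `vw`, `wu`, other than the corners, is adjacent to all three corners. -/
def Coexistence (G : GeometricGraph V) : Prop :=
  ∀ u v w x : V, G.Adj u v → G.Adj v w → G.Adj w u →
    G.pos x ∈ convexHull ℝ {G.pos u, G.pos v, G.pos w} → x ≠ u → x ≠ v → x ≠ w →
    G.Adj u x ∧ G.Adj v x ∧ G.Adj w x

/-- The CP-condition for the edge `uv`: for every intersecting edge `wx`, the two redundancy edges
`uw`, `ux` or the two redundancy edges `vw`, `vx` exist. -/
def CPCondition (G : GeometricGraph V) (u v : V) : Prop :=
  ∀ w x : V, G.Adj w x → G.Intersect u v w x →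
    (G.Adj u w ∧ G.Adj u x) ∨ (G.Adj v w ∧ G.Adj v x)

/-- The edges (unordered pairs of vertices) `wx` in a set `W` that do not intersect `uv`. -/
def nonIntersecting (G : GeometricGraph V) (W : Set (Sym2 V)) (u v : V) : Set (Sym2 V) :=
  {e ∈ W | ∀ w x : V, e = s(w, x) → ¬ G.Intersect u v w x}

/-- One iteration of the loop of the CP-algorithm on states `(W, F)`, with working set `W` and
result set `F`: an arbitrary edge `uv` of `W` is chosen and removed from `W`; if it satisfies the
CP-condition, it is added to `F` and all edges intersecting it are removed from `W`. -/
inductive CPStep (G : GeometricGraph V) :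
    Set (Sym2 V) × Set (Sym2 V) → Set (Sym2 V) × Set (Sym2 V) → Prop
  | accept (W F : Set (Sym2 V)) (u v : V) (huv : s(u, v) ∈ W) (h : G.CPCondition u v) :
      CPStep G (W, F) (G.nonIntersecting (W \ {s(u, v)}) u v, insert s(u, v) F)
  | reject (W F : Set (Sym2 V)) (u v : V) (huv : s(u, v) ∈ W) (h : ¬ G.CPCondition u v) :
      CPStep G (W, F) (W \ {s(u, v)}, F)

/-- `F` is the result set of some complete run of the CP-algorithm on `G`: the run starts with
`W = E`, `F = ∅` and stops when `W = ∅`. -/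
def IsCPResult (G : GeometricGraph V) (F : Set (Sym2 V)) : Prop :=
  Relation.ReflTransGen G.CPStep (G.edgeSet, ∅) (∅, F)

/-- The geometric graph `(V, F)`, with the same vertices at the same points. -/
def withEdges (G : GeometricGraph V) (F : Set (Sym2 V)) : GeometricGraph V where
  toSimpleGraph := SimpleGraph.fromEdgeSet F
  pos := G.pos

/-- No vertex is located on an edge, other than the two ends of the edge. -/
def NoVertexOnEdge (G : GeometricGraph V) : Prop :=
  ∀ u v w : V, G.Adj u v → G.pos w ∈ segment ℝ (G.pos u) (G.pos v) → w = u ∨ w = v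

end GeometricGraph

/-!
The invariants of the algorithm give that the accepted edges are pairwise non-intersecting, and that an
edge of `G` is accepted, or is crossed by an accepted edge, or violates the CP-condition. In the last
case redundancy provides an edge `wx` meeting `uv` such that `w` is adjacent to `u` and `v`, but `x` to
neither of them; we say that `wx` *kills* `uv` (`PlanarCP.Kill`), and call `w` a killer of `uv`.

For connectivity, let `H` be the graph of accepted edges and colour every vertex by its component in
`H`. It is to be shown that no edge of `G` is bichromatic (`PlanarCP.PlaneSubgraph.col_eq`). Otherwise:

* Some bichromatic edge is not crossed by `H` (`PlaneSubgraph.exists_uncrossed`). Indeed, let an edge of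
  `H` cross a bichromatic edge; the CP-condition makes one end of the crossing edge adjacent to both ends
  of the crossed one, which yields a bichromatic triangle. The vertices in the part of the triangle cut
  out by the two edges contain a bichromatic edge of their lower convex hull (`exists_hullEdge`), and
  this edge is crossed by fewer edges of `H`.
* Let `uv` be an uncrossed bichromatic edge with a minimal number of killers, and without vertices in
  its interior. It is neither accepted nor crossed, so it is killed.
* The killers of `uv` with a common far end `x` form a clique, and the killers of an edge between two of
  them are killers of `uv` (`Kill.star_kill`). If they were not of the same colour, the descent above,
  applied to them alone, would give an uncrossed bichromatic edge with fewer killers than `uv`. So they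
  have the same colour (`Kill.star_mono`).
* Among the vertices with an edge to a given `x` that kills `uv`, there is one to which the view from
  `uv`, along this edge, is not blocked by `H` (`Kill.exists_clear`).
* Such a clear killer `w` has the colour of `u` (`Kill.col_eq_of_clear`). Otherwise choose its edge `wx`
  so as to meet `uv` as close to `u` as possible, and consider a bichromatic hull edge `zz'` of the
  vertices in the triangle between `wx` and `u`. It is not crossed by `H`, since the sides of this
  triangle along `uv` and `wx` are not, and its killers are killers of `uv` (`Frame.hullEdge_kill`). By
  minimality, all killers of `uv` kill `zz'`, and so does `w`, by an edge `wb`, say. Now `wb` kills `uv`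
  closer to `u` than `wx` does, and hence so does an edge `yb` with a clear view of `y`
  (`Kill.exists_clear_closer`). As `y` has the colour of `w`, this contradicts the choice of `wx`.

By symmetry, a clear killer has also the colour of `v`, so `uv` is not bichromatic.

All of this is affinely invariant. The geometric arguments are therefore carried out in coordinates in
which the two edges in question lie on the axes (`PlanarCP.Frame`).
-/

/-! ### Segments, triangles and affine frames in the plane -/

namespace PlanarCP

theorem mem_segment_prod {A B m : ℝ × ℝ} : m ∈ segment ℝ A B ↔
    ∃ t, 0 ≤ t ∧ t ≤ 1 ∧ m.1 = (1 - t) * A.1 + t * B.1 ∧ m.2 = (1 - t) * A.2 + t * B.2 := by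
  constructor
  · rintro ⟨x, y, hx, hy, hxy, rfl⟩
    refine ⟨y, hy, by linarith, ?_, ?_⟩
    · simp [← hxy]
    · simp [← hxy]
  · rintro ⟨t, h0, h1, e1, e2⟩
    refine ⟨1 - t, t, by linarith, h0, by ring, ?_⟩
    ext
    · simp [e1]
    · simp [e2]

theorem mem_segment_of_line {a b c : ℝ} (hb : b ≠ 0) {A q B : ℝ × ℝ}
    (hA : a * A.1 + b * A.2 = c) (hq : a * q.1 + b * q.2 = c) (hB : a * B.1 + b * B.2 = c)
    (h1 : A.1 ≤ q.1) (h2 : q.1 ≤ B.1) : q ∈ segment ℝ A B := by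
  rcases eq_or_lt_of_le (h1.trans h2) with h | h
  · have e : q = A := by
      have e1 : q.1 = A.1 := by linarith
      ext
      · exact e1
      · apply mul_left_cancel₀ hb
        rw [e1] at hq
        linarith
    rw [e]
    exact left_mem_segment _ _ _
  · rw [mem_segment_prod]
    have hd : B.1 - A.1 ≠ 0 := by linarith
    have key : q.2 * (B.1 - A.1) = (B.1 - q.1) * A.2 + (q.1 - A.1) * B.2 := by
      apply mul_left_cancel₀ hb
      linear_combination (B.1 - A.1) * hq - (B.1 - q.1) * hA - (q.1 - A.1) * hB
    refine ⟨(q.1 - A.1) / (B.1 - A.1), div_nonneg (by linarith) (by linarith),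
      (div_le_one (by linarith)).2 (by linarith), by field_simp; ring, ?_⟩
    field_simp
    linear_combination key

theorem mem_segment_horizontal {s q s' y : ℝ} (h1 : s ≤ q) (h2 : q ≤ s') :
    ((q, y) : ℝ × ℝ) ∈ segment ℝ (s, y) (s', y) :=
  mem_segment_of_line (a := 0) (b := 1) (c := y) one_ne_zero (by simp) (by simp) (by simp) h1 h2

theorem mem_segment_swap {A B m : ℝ × ℝ} (h : m.swap ∈ segment ℝ A.swap B.swap) :
    m ∈ segment ℝ A B := by
  rw [mem_segment_prod] at h ⊢
  obtain ⟨t, h0, h1, e1, e2⟩ := h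
  exact ⟨t, h0, h1, e2, e1⟩

theorem mem_segment_vertical {s q s' x : ℝ} (h1 : s ≤ q) (h2 : q ≤ s') :
    ((x, q) : ℝ × ℝ) ∈ segment ℝ (x, s) (x, s') :=
  mem_segment_swap (mem_segment_horizontal h1 h2)

/-- A segment from the closed lower to the open upper half-plane crosses the first axis. -/
theorem axis_mem_segment {A B : ℝ × ℝ} (hA : A.2 ≤ 0) (hB : 0 < B.2) :
    (((A.1 * B.2 - A.2 * B.1) / (B.2 - A.2), 0) : ℝ × ℝ) ∈ segment ℝ A B := by
  have hd : 0 < B.2 - A.2 := by linarith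
  rw [mem_segment_prod]
  refine ⟨-A.2 / (B.2 - A.2), div_nonneg (by linarith) hd.le,
    (div_le_one hd).2 (by linarith), ?_, ?_⟩
  · field_simp; ring
  · field_simp; ring

/-- A segment from the closed left to the open right half-plane crosses the second axis. -/
theorem axis_mem_segment' {A B : ℝ × ℝ} (hA : A.1 ≤ 0) (hB : 0 < B.1) :
    ((0, (A.2 * B.1 - A.1 * B.2) / (B.1 - A.1)) : ℝ × ℝ) ∈ segment ℝ A B :=
  mem_segment_swap (axis_mem_segment (A := A.swap) (B := B.swap) hA hB)

theorem mem_hull3 {A B C q : ℝ × ℝ} : q ∈ convexHull ℝ {A, B, C} ↔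
    ∃ x y z : ℝ, 0 ≤ x ∧ 0 ≤ y ∧ 0 ≤ z ∧ x + y + z = 1 ∧
      q.1 = x * A.1 + y * B.1 + z * C.1 ∧ q.2 = x * A.2 + y * B.2 + z * C.2 := by
  constructor
  · intro h
    rw [convexHull_insert (by simp), convexHull_pair, mem_convexJoin] at h
    obtain ⟨a, ha, d, hd, hq⟩ := h
    rw [Set.mem_singleton_iff] at ha
    subst ha
    rw [mem_segment_prod] at hd hq
    obtain ⟨s, s0, s1, e1, e2⟩ := hd
    obtain ⟨t, t0, t1, f1, f2⟩ := hq
    refine ⟨1 - t, t * (1 - s), t * s, by linarith, mul_nonneg t0 (by linarith),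
      mul_nonneg t0 s0, by ring, ?_, ?_⟩
    · rw [f1, e1]; ring
    · rw [f2, e2]; ring
  · rintro ⟨x, y, z, hx, hy, hz, hs, e1, e2⟩
    have hA : A ∈ convexHull ℝ ({A, B, C} : Set (ℝ × ℝ)) := subset_convexHull _ _ (by simp)
    have hB : B ∈ convexHull ℝ ({A, B, C} : Set (ℝ × ℝ)) := subset_convexHull _ _ (by simp)
    have hC : C ∈ convexHull ℝ ({A, B, C} : Set (ℝ × ℝ)) := subset_convexHull _ _ (by simp)
    have := (convex_convexHull ℝ ({A, B, C} : Set (ℝ × ℝ))).sum_mem (t := Finset.univ)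
      (w := ![x, y, z]) (z := ![A, B, C])
      (by intro i _; fin_cases i <;> simpa) (by simp [Fin.sum_univ_three, hs])
      (by intro i _; fin_cases i <;> simpa)
    convert this using 1
    ext <;> simp [Fin.sum_univ_three, e1, e2]

theorem mem_hull4 {A B C D q : ℝ × ℝ} (h : q ∈ convexHull ℝ {A, B, C, D}) :
    ∃ l : Fin 4 → ℝ, (∀ i, 0 ≤ l i) ∧ l 0 + l 1 + l 2 + l 3 = 1 ∧
      q.1 = l 0 * A.1 + l 1 * B.1 + l 2 * C.1 + l 3 * D.1 ∧
      q.2 = l 0 * A.2 + l 1 * B.2 + l 2 * C.2 + l 3 * D.2 := by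
  rw [convexHull_insert (by simp), mem_convexJoin] at h
  obtain ⟨a, ha, d, hd, hq⟩ := h
  rw [Set.mem_singleton_iff] at ha
  subst ha
  rw [mem_hull3] at hd
  rw [mem_segment_prod] at hq
  obtain ⟨x, y, z, hx, hy, hz, hs, e1, e2⟩ := hd
  obtain ⟨t, t0, t1, f1, f2⟩ := hq
  refine ⟨![1 - t, t * x, t * y, t * z], ?_, ?_, ?_, ?_⟩
  · intro i
    fin_cases i
    · simpa using t1
    · exact mul_nonneg t0 hx
    · exact mul_nonneg t0 hy
    · exact mul_nonneg t0 hz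
  · simp
    linear_combination t * hs
  · simp [f1, e1]; ring
  · simp [f2, e2]; ring

/-- Every point of the hull of four points of the plane lies in a triangle that has the first
of them as a corner: an affine dependence of the four points allows to shift weight towards the
first point until the weight of another one vanishes. -/
theorem hull4_fan {B : ℝ × ℝ} {K : Fin 3 → ℝ × ℝ} {q : ℝ × ℝ}
    (h : q ∈ convexHull ℝ {B, K 0, K 1, K 2}) :
    q ∈ convexHull ℝ {B, K 0, K 1} ∨ q ∈ convexHull ℝ {B, K 0, K 2} ∨
      q ∈ convexHull ℝ {B, K 1, K 2} := by
  obtain ⟨l, hl, hs, e1, e2⟩ := mem_hull4 h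
  let f : (Fin 4 → ℝ) →ₗ[ℝ] (Fin 3 → ℝ) :=
    Matrix.mulVecLin !![1, 1, 1, 1; B.1, (K 0).1, (K 1).1, (K 2).1; B.2, (K 0).2, (K 1).2, (K 2).2]
  have hker : LinearMap.ker f ≠ ⊥ := LinearMap.ker_ne_bot_of_finrank_lt (by simp)
  obtain ⟨m', hm', hm0'⟩ := (Submodule.ne_bot_iff _).1 hker
  have key : ∃ m : Fin 4 → ℝ, f m = 0 ∧ m ≠ 0 ∧ 0 ≤ m 0 := by
    rcases le_total 0 (m' 0) with h0 | h0
    · exact ⟨m', hm', hm0', h0⟩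
    · exact ⟨-m', by rw [map_neg, LinearMap.mem_ker.1 hm', neg_zero], by simpa using hm0',
        by simpa using h0⟩
  obtain ⟨m, hm, hm0, hmB⟩ := key
  have g0 := congrFun hm 0
  have g1 := congrFun hm 1
  have g2 := congrFun hm 2
  simp [f, Matrix.mulVec, dotProduct, Fin.sum_univ_four] at g0 g1 g2
  have hneg : ∃ i : Fin 3, m i.succ < 0 := by
    by_contra hcon
    push Not at hcon
    have h1 := hcon 0
    have h2 := hcon 1
    have h3 := hcon 2
    simp at h1 h2 h3
    have h2' : 0 ≤ m 2 := h2
    have h3' : 0 ≤ m 3 := h3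
    apply hm0
    ext i
    fin_cases i <;> simp <;> linarith
  obtain ⟨i0, hi0⟩ := hneg
  obtain ⟨i, hi, hmin⟩ := Finset.exists_min_image (Finset.univ.filter fun i : Fin 3 => m i.succ < 0)
    (fun i => l i.succ / (-m i.succ)) ⟨i0, by simp [hi0]⟩
  simp only [Finset.mem_filter, Finset.mem_univ, true_and] at hi hmin
  set τ := l i.succ / (-m i.succ) with hτ
  have hτ0 : 0 ≤ τ := div_nonneg (hl _) (by linarith)
  have hzero : l i.succ + τ * m i.succ = 0 := by
    have hne : m i.succ ≠ 0 := hi.ne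
    rw [hτ]
    field_simp
    ring
  have hpos : ∀ j : Fin 3, 0 ≤ l j.succ + τ * m j.succ := by
    intro j
    rcases lt_or_ge (m j.succ) 0 with hj | hj
    · have := hmin j hj
      rw [le_div_iff₀ (by linarith)] at this
      linarith
    · exact add_nonneg (hl _) (mul_nonneg hτ0 hj)
  have hpos0 : 0 ≤ l 0 + τ * m 0 := add_nonneg (hl _) (mul_nonneg hτ0 hmB)
  have p1 : 0 ≤ l 1 + τ * m 1 := hpos 0
  have p2 : 0 ≤ l 2 + τ * m 2 := hpos 1
  have p3 : 0 ≤ l 3 + τ * m 3 := hpos 2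
  have q1 : q.1 = (l 0 + τ * m 0) * B.1 + (l 1 + τ * m 1) * (K 0).1 + (l 2 + τ * m 2) * (K 1).1
      + (l 3 + τ * m 3) * (K 2).1 := by rw [e1]; linear_combination -τ * g1
  have q2 : q.2 = (l 0 + τ * m 0) * B.2 + (l 1 + τ * m 1) * (K 0).2 + (l 2 + τ * m 2) * (K 1).2
      + (l 3 + τ * m 3) * (K 2).2 := by rw [e2]; linear_combination -τ * g2
  have qs : (l 0 + τ * m 0) + (l 1 + τ * m 1) + (l 2 + τ * m 2) + (l 3 + τ * m 3) = 1 := by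
    linear_combination hs + τ * g0
  fin_cases i
  · have z : l 1 + τ * m 1 = 0 := hzero
    rw [z] at q1 q2 qs
    exact Or.inr (Or.inr (mem_hull3.2 ⟨_, _, _, hpos0, p2, p3, by linarith, by linarith, by linarith⟩))
  · have z : l 2 + τ * m 2 = 0 := hzero
    rw [z] at q1 q2 qs
    exact Or.inr (Or.inl (mem_hull3.2 ⟨_, _, _, hpos0, p1, p3, by linarith, by linarith, by linarith⟩))
  · have z : l 3 + τ * m 3 = 0 := hzero
    rw [z] at q1 q2 qs
    exact Or.inl (mem_hull3.2 ⟨_, _, _, hpos0, p1, p2, by linarith, by linarith, by linarith⟩)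

/-- If a segment `ab` meets the side `AB` of a triangle and has both ends outside, then it leaves the
triangle through one of the other two sides. -/
theorem segment_meets_other_side {A B C a b r : ℝ × ℝ} (hrAB : r ∈ segment ℝ A B)
    (hrab : r ∈ segment ℝ a b) (ha : a ∉ convexHull ℝ {A, B, C})
    (hb : b ∉ convexHull ℝ {A, B, C}) :
    ∃ n ∈ segment ℝ a b, n ∈ segment ℝ A C ∨ n ∈ segment ℝ B C := by
  set T := convexHull ℝ ({A, B, C} : Set (ℝ × ℝ)) with hT
  have hTc : Convex ℝ T := convex_convexHull ℝ _
  have hA : A ∈ T := subset_convexHull _ _ (by simp)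
  have hB : B ∈ T := subset_convexHull _ _ (by simp)
  have hC : C ∈ T := subset_convexHull _ _ (by simp)
  have hrT : r ∈ T := hTc.segment_subset hA hB hrAB
  let o : ℝ × ℝ → ℝ := fun q => (b.1 - a.1) * (q.2 - a.2) - (b.2 - a.2) * (q.1 - a.1)
  have ho : ∀ q, o q = (b.1 - a.1) * (q.2 - a.2) - (b.2 - a.2) * (q.1 - a.1) := fun _ => rfl
  -- the point where the line `ab` crosses a segment of the triangle lies on the segment `ab`
  have main : ∀ D ∈ T, ∀ E ∈ T, o D ≤ 0 → 0 ≤ o E → ∃ n ∈ segment ℝ a b, n ∈ segment ℝ D E := by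
    intro D hD E hE h1 h2
    have hn : ∃ n ∈ segment ℝ D E, o n = 0 := by
      rcases eq_or_lt_of_le (h1.trans h2) with h | h
      · exact ⟨D, left_mem_segment _ _ _, by linarith⟩
      · have hd : 0 < o E - o D := by linarith
        refine ⟨((1 - -o D / (o E - o D)) * D.1 + -o D / (o E - o D) * E.1,
          (1 - -o D / (o E - o D)) * D.2 + -o D / (o E - o D) * E.2), ?_, ?_⟩
        · rw [mem_segment_prod]
          exact ⟨_, div_nonneg (by linarith) hd.le, (div_le_one hd).2 (by linarith), rfl, rfl⟩
        · have : ∀ t, o ((1 - t) * D.1 + t * E.1, (1 - t) * D.2 + t * E.2) =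
              (1 - t) * o D + t * o E := by
            intro t
            simp only [ho]
            ring
          rw [this]
          field_simp
          ring
    obtain ⟨n, hn, hn0⟩ := hn
    have hnT : n ∈ T := hTc.segment_subset hD hE hn
    refine ⟨n, ?_, hn⟩
    rw [mem_segment_prod] at hrab
    obtain ⟨s, s0, s1, e1, e2⟩ := hrab
    have hab : a ≠ b := by
      rintro rfl
      apply ha
      have : a = r := by ext <;> linarith
      rw [this]
      exact hrT
    have hτ : ∃ τ, n.1 = (1 - τ) * a.1 + τ * b.1 ∧ n.2 = (1 - τ) * a.2 + τ * b.2 := by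
      rw [ho] at hn0
      by_cases hx : b.1 - a.1 = 0
      · have hy : b.2 - a.2 ≠ 0 := by
          intro hy
          apply hab
          ext <;> linarith
        refine ⟨(n.2 - a.2) / (b.2 - a.2), ?_, by field_simp; ring⟩
        rw [hx] at hn0
        have : n.1 - a.1 = 0 := by
          apply mul_left_cancel₀ hy
          linarith
        have hb1 : b.1 = a.1 := by linarith
        rw [hb1]
        linarith
      · refine ⟨(n.1 - a.1) / (b.1 - a.1), by field_simp; ring, ?_⟩
        field_simp
        linarith
    obtain ⟨τ, f1, f2⟩ := hτ
    rw [mem_segment_prod]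
    refine ⟨τ, ?_, ?_, f1, f2⟩
    · by_contra hneg
      push Not at hneg
      apply ha
      apply hTc.segment_subset hnT hrT
      rw [mem_segment_prod]
      have hd : 0 < s - τ := by linarith
      refine ⟨-τ / (s - τ), div_nonneg (by linarith) hd.le, (div_le_one hd).2 (by linarith), ?_, ?_⟩
      · rw [f1, e1]; field_simp; ring
      · rw [f2, e2]; field_simp; ring
    · by_contra hneg
      push Not at hneg
      apply hb
      apply hTc.segment_subset hrT hnT
      rw [mem_segment_prod]
      have hd : 0 < τ - s := by linarith
      refine ⟨(1 - s) / (τ - s), div_nonneg (by linarith) hd.le, (div_le_one hd).2 (by linarith),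
        ?_, ?_⟩
      · rw [f1, e1]; field_simp; ring
      · rw [f2, e2]; field_simp; ring
  have hr0 : o r = 0 := by
    rw [mem_segment_prod] at hrab
    obtain ⟨s, s0, s1, e1, e2⟩ := hrab
    rw [ho, e1, e2]
    ring
  have hopp : (o A ≤ 0 ∧ 0 ≤ o B) ∨ (o B ≤ 0 ∧ 0 ≤ o A) := by
    rw [mem_segment_prod] at hrAB
    obtain ⟨t, t0, t1, e1, e2⟩ := hrAB
    have : (1 - t) * o A + t * o B = 0 := by
      rw [← hr0]
      simp only [ho, e1, e2]
      ring
    have hmix : ∀ y z : ℝ, (y < 0 ∧ z < 0) ∨ (0 < y ∧ 0 < z) → (1 - t) * y + t * z ≠ 0 := by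
      rintro y z (⟨hy, hz⟩ | ⟨hy, hz⟩) h0
      · nlinarith [mul_nonneg t0 (neg_nonneg.2 hz.le), mul_nonneg (sub_nonneg.2 t1) (neg_nonneg.2 hy.le)]
      · nlinarith [mul_nonneg t0 hz.le, mul_nonneg (sub_nonneg.2 t1) hy.le]
    rcases le_total (o A) 0 with h1 | h1 <;> rcases le_total (o B) 0 with h2 | h2
    · rcases eq_or_lt_of_le h1 with h | h
      · exact Or.inr ⟨h2, h.ge⟩
      · rcases eq_or_lt_of_le h2 with h' | h'
        · exact Or.inl ⟨h1, h'.ge⟩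
        · exact absurd this (hmix _ _ (Or.inl ⟨h, h'⟩))
    · exact Or.inl ⟨h1, h2⟩
    · exact Or.inr ⟨h2, h1⟩
    · rcases eq_or_lt_of_le h1 with h | h
      · exact Or.inl ⟨h.ge, h2⟩
      · rcases eq_or_lt_of_le h2 with h' | h'
        · exact Or.inr ⟨h'.ge, h1⟩
        · exact absurd this (hmix _ _ (Or.inr ⟨h, h'⟩))
  rcases le_total (o C) 0 with hc | hc <;> rcases hopp with ⟨h1, h2⟩ | ⟨h1, h2⟩
  · obtain ⟨n, hn, hn'⟩ := main C hC B hB hc h2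
    exact ⟨n, hn, Or.inr (by rwa [segment_symm])⟩
  · obtain ⟨n, hn, hn'⟩ := main C hC A hA hc h2
    exact ⟨n, hn, Or.inl (by rwa [segment_symm])⟩
  · obtain ⟨n, hn, hn'⟩ := main A hA C hC h1 hc
    exact ⟨n, hn, Or.inl hn'⟩
  · obtain ⟨n, hn, hn'⟩ := main B hB C hC h1 hc
    exact ⟨n, hn, Or.inr hn'⟩

theorem mem_segment_of_line' {a b c : ℝ} (ha : a ≠ 0) {A q B : ℝ × ℝ}
    (hA : a * A.1 + b * A.2 = c) (hq : a * q.1 + b * q.2 = c) (hB : a * B.1 + b * B.2 = c)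
    (h1 : A.2 ≤ q.2) (h2 : q.2 ≤ B.2) : q ∈ segment ℝ A B :=
  mem_segment_swap (mem_segment_of_line (a := b) (b := a) (c := c) ha (by simp; linarith)
    (by simp; linarith) (by simp; linarith) h1 h2)

/-- On a segment between the two sides of a line there is a point on the line. -/
theorem exists_mem_segment_zero {a b c : ℝ} {A B : ℝ × ℝ} (hA : a * A.1 + b * A.2 ≤ c)
    (hB : c < a * B.1 + b * B.2) : ∃ n ∈ segment ℝ A B, a * n.1 + b * n.2 = c := by
  have hd : 0 < (a * B.1 + b * B.2) - (a * A.1 + b * A.2) := by linarith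
  set d := (a * B.1 + b * B.2) - (a * A.1 + b * A.2) with hdd
  refine ⟨((1 - (c - (a * A.1 + b * A.2)) / d) * A.1 + (c - (a * A.1 + b * A.2)) / d * B.1,
    (1 - (c - (a * A.1 + b * A.2)) / d) * A.2 + (c - (a * A.1 + b * A.2)) / d * B.2), ?_, ?_⟩
  · rw [mem_segment_prod]
    exact ⟨_, div_nonneg (by linarith) hd.le, (div_le_one hd).2 (by linarith), rfl, rfl⟩
  · have : (c - (a * A.1 + b * A.2)) / d * d = c - (a * A.1 + b * A.2) := by field_simp
    simp only
    linear_combination this + (c - (a * A.1 + b * A.2)) / d * hdd.symm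

theorem convex_upper : Convex ℝ {q : ℝ × ℝ | 0 ≤ q.2} :=
  convex_halfSpace_ge (f := fun q : ℝ × ℝ => q.2) ⟨fun _ _ => rfl, fun _ _ => rfl⟩ 0

theorem convex_upper' : Convex ℝ {q : ℝ × ℝ | 0 < q.2} :=
  convex_halfSpace_gt (f := fun q : ℝ × ℝ => q.2) ⟨fun _ _ => rfl, fun _ _ => rfl⟩ 0

theorem convex_halfplane (a b c : ℝ) : Convex ℝ {q : ℝ × ℝ | c ≤ a * q.1 + b * q.2} :=
  convex_halfSpace_ge (f := fun q : ℝ × ℝ => a * q.1 + b * q.2)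
    ⟨fun _ _ => by simp; ring, fun _ _ => by simp; ring⟩ c

/-- Two segments with a common end that meet elsewhere overlap. -/
theorem overlap {A B Q m : ℝ × ℝ} (h1 : m ∈ segment ℝ A Q) (h2 : m ∈ segment ℝ B Q) (h3 : m ≠ Q) :
    A ∈ segment ℝ B Q ∨ B ∈ segment ℝ A Q := by
  have key : ∀ A B : ℝ × ℝ, ∀ t s : ℝ, 0 ≤ t → t ≤ 1 → s ≤ 1 → 1 - s ≤ 1 - t →
      m.1 = (1 - t) * A.1 + t * Q.1 → m.2 = (1 - t) * A.2 + t * Q.2 →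
      m.1 = (1 - s) * B.1 + s * Q.1 → m.2 = (1 - s) * B.2 + s * Q.2 → A ∈ segment ℝ B Q := by
    intro A B t s t0 t1 s1 hle e1 e2 f1 f2
    have t1' : 0 < 1 - t := by
      rcases eq_or_lt_of_le t1 with h | h
      · exact absurd (by ext <;> simp [e1, e2, h]) h3
      · linarith
    have hne : 1 - t ≠ 0 := t1'.ne'
    rw [mem_segment_prod]
    refine ⟨1 - (1 - s) / (1 - t), ?_, ?_, ?_, ?_⟩
    · rw [sub_nonneg, div_le_one t1']; exact hle
    · have := div_nonneg (by linarith : 0 ≤ 1 - s) t1'.le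
      linarith
    · field_simp
      linarith
    · field_simp
      linarith
  rw [mem_segment_prod] at h1 h2
  obtain ⟨t, t0, t1, e1, e2⟩ := h1
  obtain ⟨s, s0, s1, f1, f2⟩ := h2
  rcases le_total (1 - s) (1 - t) with h | h
  · exact Or.inl (key A B t s t0 t1 s1 h e1 e2 f1 f2)
  · exact Or.inr (key B A s t s0 s1 t1 h f1 f2 e1 e2)

theorem segment_antisymm {A B C : ℝ × ℝ} (h1 : B ∈ segment ℝ A C) (h2 : C ∈ segment ℝ A B) :
    B = C := by
  rw [mem_segment_prod] at h1 h2
  obtain ⟨t, t0, t1, e1, e2⟩ := h1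
  obtain ⟨s, s0, s1, f1, f2⟩ := h2
  have k1 : (1 - s * t) * (C.1 - A.1) = 0 := by rw [e1] at f1; linear_combination f1
  have k2 : (1 - s * t) * (C.2 - A.2) = 0 := by rw [e2] at f2; linear_combination f2
  by_cases h : 1 - s * t = 0
  · have : t = 1 := by nlinarith
    rw [this] at e1 e2
    ext <;> linarith
  · have h1 := (mul_eq_zero.1 k1).resolve_left h
    have h2 := (mul_eq_zero.1 k2).resolve_left h
    have g1 : C.1 = A.1 := by linarith
    have g2 : C.2 = A.2 := by linarith
    rw [g1] at e1
    rw [g2] at e2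
    ext <;> linarith

theorem mem_segment_of_mem {A B r m : ℝ × ℝ} (hr : r ∈ segment ℝ A B) (hm : m ∈ segment ℝ r B) :
    r ∈ segment ℝ A m := by
  rw [mem_segment_prod] at *
  obtain ⟨s, s0, s1, e1, e2⟩ := hr
  obtain ⟨t, t0, t1, f1, f2⟩ := hm
  obtain ⟨D, hD⟩ : ∃ D, D = s + t * (1 - s) := ⟨_, rfl⟩
  have hts := mul_nonneg t0 (sub_nonneg.2 s1)
  rcases eq_or_lt_of_le (by linarith : 0 ≤ D) with h | h
  · have hs : s = 0 := by linarith
    refine ⟨0, le_rfl, zero_le_one, ?_, ?_⟩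
    · rw [e1, hs]; ring
    · rw [e2, hs]; ring
  · have key : s / D * D = s := by field_simp
    refine ⟨s / D, div_nonneg s0 h.le, (div_le_one h).2 (by linarith), ?_, ?_⟩
    · linear_combination e1 - s / D * (f1 + (1 - t) * e1) - (B.1 - A.1) * key +
        s / D * (B.1 - A.1) * hD
    · linear_combination e2 - s / D * (f2 + (1 - t) * e2) - (B.2 - A.2) * key +
        s / D * (B.2 - A.2) * hD

/-- Two properly crossing segments can be moved onto the coordinate axes by an affine map. -/
theorem exists_frame {U W D X p : ℝ × ℝ} (hpU : p ≠ U) (hpV : p ≠ D) (hpW : p ≠ W) (hpX : p ≠ X)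
    (h1 : p ∈ segment ℝ U D) (h2 : p ∈ segment ℝ W X) (hU : U ∉ segment ℝ W X)
    (hV : D ∉ segment ℝ W X) (hW : W ∉ segment ℝ U D) :
    ∃ (T : ℝ × ℝ →ᵃ[ℝ] ℝ × ℝ) (ν ξ : ℝ), Function.Injective T ∧ 0 < ν ∧ 0 < ξ ∧ T p = (0, 0) ∧
      T U = (1, 0) ∧ T W = (0, 1) ∧ T D = (-ν, 0) ∧ T X = (0, -ξ) := by
  -- an end of one segment on a line through the crossing point lies on the other segment
  have hray : ∀ A B E : ℝ × ℝ, ∀ k : ℝ, p ∈ segment ℝ A B → 0 ≤ k → k ≤ 1 →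
      E.1 - p.1 = k * (A.1 - p.1) → E.2 - p.2 = k * (A.2 - p.2) → E ∈ segment ℝ A B := by
    intro A B E k hp k0 k1 e1 e2
    apply (convex_segment A B).segment_subset (left_mem_segment _ _ _) hp
    rw [mem_segment_prod]
    exact ⟨1 - k, by linarith, by linarith, by linarith, by linarith⟩
  have opp : ∀ A B : ℝ × ℝ, p ≠ A → p ≠ B → p ∈ segment ℝ A B → ∃ k, 0 < k ∧
      B.1 - p.1 = -k * (A.1 - p.1) ∧ B.2 - p.2 = -k * (A.2 - p.2) := by
    intro A B hA hB hp
    rw [mem_segment_prod] at hp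
    obtain ⟨t, t0, t1, e1, e2⟩ := hp
    have t0' : 0 < t := by
      rcases eq_or_lt_of_le t0 with h | h
      · exact absurd (by ext <;> simp [e1, e2, ← h]) hA
      · exact h
    have t1' : t < 1 := by
      rcases eq_or_lt_of_le t1 with h | h
      · exact absurd (by ext <;> simp [e1, e2, h]) hB
      · exact h
    refine ⟨(1 - t) / t, div_pos (by linarith) t0', ?_, ?_⟩
    · rw [e1]; field_simp; ring
    · rw [e2]; field_simp; ring
  obtain ⟨ν, hν, d1, d2⟩ := opp U D hpU hpV h1
  obtain ⟨ξ, hξ, x1, x2⟩ := opp W X hpW hpX h2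
  set e := U - p with he
  set f := W - p with hf
  have he1 : e.1 = U.1 - p.1 := rfl
  have he2 : e.2 = U.2 - p.2 := rfl
  have hf1 : f.1 = W.1 - p.1 := rfl
  have hf2 : f.2 = W.2 - p.2 := rfl
  have hdet : e.1 * f.2 - e.2 * f.1 ≠ 0 := by
    intro hdet
    have hne : e.1 ≠ 0 ∨ e.2 ≠ 0 := by
      by_contra hcon
      push Not at hcon
      apply hpU
      ext <;> linarith [hcon.1, hcon.2]
    have hk : ∃ k, f.1 = k * e.1 ∧ f.2 = k * e.2 := by
      rcases hne with h | h
      · exact ⟨f.1 / e.1, by field_simp, by field_simp; linarith⟩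
      · exact ⟨f.2 / e.2, by field_simp; linarith, by field_simp⟩
    obtain ⟨k, k1, k2⟩ := hk
    rcases lt_trichotomy k 0 with hk | hk | hk
    · -- `W` is on the side of `D`
      have hk0 : k ≠ 0 := hk.ne
      rcases le_total (-k) ν with hkν | hkν
      · apply hW
        rw [segment_symm]
        refine hray D U W (-k / ν) (by rwa [segment_symm]) (div_nonneg (by linarith) hν.le)
          ((div_le_one hν).2 hkν) ?_ ?_
        · rw [d1, ← hf1, k1, ← he1]; field_simp
        · rw [d2, ← hf2, k2, ← he2]; field_simp
      · apply hV
        refine hray W X D (ν / -k) h2 (div_nonneg hν.le (by linarith))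
          ((div_le_one (by linarith)).2 hkν) ?_ ?_
        · rw [d1, ← hf1, k1, ← he1]; field_simp
        · rw [d2, ← hf2, k2, ← he2]; field_simp
    · apply hpW
      rw [hk] at k1 k2
      ext <;> linarith
    · rcases le_total k 1 with hk1 | hk1
      · exact hW (hray U D W k h1 hk.le hk1 k1 k2)
      · apply hU
        refine hray W X U (1 / k) h2 (by positivity) ((div_le_one hk).2 hk1) ?_ ?_
        · rw [← hf1, k1, ← he1]; field_simp
        · rw [← hf2, k2, ← he2]; field_simp
  set Δ := e.1 * f.2 - e.2 * f.1 with hΔ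
  let L : ℝ × ℝ →ₗ[ℝ] ℝ × ℝ :=
    ((f.2 / Δ) • LinearMap.fst ℝ ℝ ℝ - (f.1 / Δ) • LinearMap.snd ℝ ℝ ℝ).prod
      ((e.1 / Δ) • LinearMap.snd ℝ ℝ ℝ - (e.2 / Δ) • LinearMap.fst ℝ ℝ ℝ)
  have hL : ∀ q, L q = (f.2 / Δ * q.1 - f.1 / Δ * q.2, e.1 / Δ * q.2 - e.2 / Δ * q.1) := by
    intro q
    simp [L]
  let T : ℝ × ℝ →ᵃ[ℝ] ℝ × ℝ := L.toAffineMap - AffineMap.const ℝ _ (L p)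
  have hT : ∀ q, T q = (f.2 / Δ * (q.1 - p.1) - f.1 / Δ * (q.2 - p.2),
      e.1 / Δ * (q.2 - p.2) - e.2 / Δ * (q.1 - p.1)) := by
    intro q
    have : T q = L q - L p := rfl
    rw [this, hL, hL]
    ext <;> simp <;> ring
  refine ⟨T, ν, ξ, ?_, hν, hξ, ?_, ?_, ?_, ?_, ?_⟩
  · intro q q' hqq
    rw [hT, hT, Prod.mk.injEq] at hqq
    obtain ⟨g1, g2⟩ := hqq
    field_simp at g1 g2
    ext
    · have : Δ * (q.1 - q'.1) = 0 := by
        rw [hΔ]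
        linear_combination e.1 * g1 + f.1 * g2
      have := (mul_eq_zero.1 this).resolve_left hdet
      linarith
    · have : Δ * (q.2 - q'.2) = 0 := by
        rw [hΔ]
        linear_combination e.2 * g1 + f.2 * g2
      have := (mul_eq_zero.1 this).resolve_left hdet
      linarith
  · rw [hT]; simp
  · rw [hT, ← he1, ← he2]
    ext
    · simp only; field_simp; rw [hΔ]; ring
    · simp only; field_simp; ring
  · rw [hT, ← hf1, ← hf2]
    ext
    · simp only; field_simp; ring
    · simp only; field_simp; rw [hΔ]
  · rw [hT, d1, d2, ← he1, ← he2]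
    ext
    · simp only; field_simp; rw [hΔ]; ring
    · simp only; field_simp; ring
  · rw [hT, x1, x2, ← hf1, ← hf2]
    ext
    · simp only; field_simp; ring
    · simp only; field_simp; rw [hΔ]; ring

end PlanarCP

/-! ### Graphs drawn in the plane -/

namespace PlanarCP

variable {V : Type*}

/-- The properties of a straight-line drawing `P` of `G` that the argument uses: redundancy,
coexistence, and the consequence of both for connected graphs that a vertex on an edge is adjacent to
the two ends of that edge. All of them are invariant under injective affine maps of the plane. -/
structure Layout (G : SimpleGraph V) (P : V → ℝ × ℝ) : Prop where
  inj : Function.Injective P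
  red : ∀ {a b c d : V}, G.Adj a b → G.Adj c d → a ≠ c → a ≠ d → b ≠ c → b ≠ d →
    ∀ {m : ℝ × ℝ}, m ∈ segment ℝ (P a) (P b) → m ∈ segment ℝ (P c) (P d) →
    (G.Adj a c ∧ G.Adj a d) ∨ (G.Adj b c ∧ G.Adj b d) ∨ (G.Adj c a ∧ G.Adj c b) ∨
      (G.Adj d a ∧ G.Adj d b)
  coex : ∀ {u v w x : V}, G.Adj u v → G.Adj v w → G.Adj w u →
    P x ∈ convexHull ℝ {P u, P v, P w} → x ≠ u → x ≠ v → x ≠ w →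
    G.Adj u x ∧ G.Adj v x ∧ G.Adj w x
  onseg : ∀ {u v x : V}, G.Adj u v → P x ∈ segment ℝ (P u) (P v) → x ≠ u → x ≠ v →
    G.Adj u x ∧ G.Adj v x

/-- `H` is a plane subgraph of `G` whose edges satisfy the CP-condition in `G`, and no vertex lies on
an edge of `H` other than at its ends. -/
structure PlaneSubgraph (G H : SimpleGraph V) (P : V → ℝ × ℝ) : Prop where
  le : H ≤ G
  noVertex : ∀ {a b t : V}, H.Adj a b → P t ∈ segment ℝ (P a) (P b) → t = a ∨ t = b
  plane : ∀ {a b c d : V}, H.Adj a b → H.Adj c d → s(a, b) ≠ s(c, d) → ∀ {m : ℝ × ℝ},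
    m ∈ segment ℝ (P a) (P b) → m ∈ segment ℝ (P c) (P d) →
    (m = P a ∨ m = P b) ∧ (m = P c ∨ m = P d)
  cp : ∀ {a b c d : V}, H.Adj a b → G.Adj c d → a ≠ c → a ≠ d → b ≠ c → b ≠ d →
    ∀ {m : ℝ × ℝ}, m ∈ segment ℝ (P a) (P b) → m ∈ segment ℝ (P c) (P d) →
    (G.Adj a c ∧ G.Adj a d) ∨ (G.Adj b c ∧ G.Adj b d)

/-- The edge `wx` shows that `uv` violates the CP-condition: it meets `uv`, and `x` is adjacent to
neither `u` nor `v` (so that, by redundancy, `w` is adjacent to both). -/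
def Kill (G : SimpleGraph V) (P : V → ℝ × ℝ) (u v w x : V) : Prop :=
  G.Adj w x ∧ ¬ G.Adj u x ∧ ¬ G.Adj v x ∧ x ≠ u ∧ x ≠ v ∧
    ∃ m, m ∈ segment ℝ (P u) (P v) ∧ m ∈ segment ℝ (P w) (P x)

/-- The segment `cd` meets the segment `zz'` at a point other than `z` and `z'`. -/
def Crosses (P : V → ℝ × ℝ) (c d z z' : V) : Prop :=
  ∃ m, m ∈ segment ℝ (P c) (P d) ∧ m ∈ segment ℝ (P z) (P z') ∧ m ≠ P z ∧ m ≠ P z'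

/-- No edge of `H` crosses the segment `zz'`. -/
def Uncrossed (H : SimpleGraph V) (P : V → ℝ × ℝ) (z z' : V) : Prop :=
  ∀ c d, H.Adj c d → ¬ Crosses P c d z z'

/-- The segment `uv` contains no vertex other than `u` and `v`. -/
def Bare (P : V → ℝ × ℝ) (u v : V) : Prop :=
  ∀ t, P t ∈ segment ℝ (P u) (P v) → t = u ∨ t = v

/-- The segment from the vertex `w` to the point `p` meets edges of `H` at most in `w`. -/
def Clear (H : SimpleGraph V) (P : V → ℝ × ℝ) (w : V) (p : ℝ × ℝ) : Prop :=
  ∀ c d, H.Adj c d → ∀ m, m ∈ segment ℝ (P c) (P d) → m ∈ segment ℝ (P w) p → m = P w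

/-- `uv` lies on the first and `wx` on the second coordinate axis, and they cross at the origin. -/
structure Frame (P : V → ℝ × ℝ) (u v w x : V) (ν ξ : ℝ) : Prop where
  pu : P u = (1, 0)
  pv : P v = (-ν, 0)
  pw : P w = (0, 1)
  px : P x = (0, -ξ)
  hν : 0 < ν
  hξ : 0 < ξ

section Transport

variable {G H : SimpleGraph V} {P : V → ℝ × ℝ} {T : ℝ × ℝ →ᵃ[ℝ] ℝ × ℝ}

theorem map_mem_segment (hT : Function.Injective T) {A B m : ℝ × ℝ} :
    T m ∈ segment ℝ (T A) (T B) ↔ m ∈ segment ℝ A B := by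
  rw [← image_segment ℝ T, hT.mem_set_image]

theorem exists_of_map_mem_segment {A B m : ℝ × ℝ} (h : m ∈ segment ℝ (T A) (T B)) :
    ∃ m', m = T m' ∧ m' ∈ segment ℝ A B := by
  rw [← image_segment ℝ T] at h
  obtain ⟨m', hm, rfl⟩ := h
  exact ⟨m', rfl, hm⟩

theorem map_mem_hull3 (hT : Function.Injective T) {A B C m : ℝ × ℝ} :
    T m ∈ convexHull ℝ {T A, T B, T C} ↔ m ∈ convexHull ℝ {A, B, C} := by
  have : ({T A, T B, T C} : Set (ℝ × ℝ)) = T '' {A, B, C} := by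
    simp [Set.image_insert_eq]
  rw [this, ← AffineMap.image_convexHull, hT.mem_set_image]

theorem Layout.map (L : Layout G P) (hT : Function.Injective T) : Layout G (T ∘ P) where
  inj := hT.comp L.inj
  red := by
    intro a b c d hab hcd h1 h2 h3 h4 m hm hm'
    obtain ⟨n, rfl, hn⟩ := exists_of_map_mem_segment hm
    exact L.red hab hcd h1 h2 h3 h4 hn ((map_mem_segment hT).1 hm')
  coex := by
    intro u v w x h1 h2 h3 h4
    exact L.coex h1 h2 h3 ((map_mem_hull3 hT).1 h4)
  onseg := by
    intro u v x h1 h2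
    exact L.onseg h1 ((map_mem_segment hT).1 h2)

theorem PlaneSubgraph.map (S : PlaneSubgraph G H P) (hT : Function.Injective T) :
    PlaneSubgraph G H (T ∘ P) where
  le := S.le
  noVertex := by
    intro a b t h1 h2
    exact S.noVertex h1 ((map_mem_segment hT).1 h2)
  plane := by
    intro a b c d hab hcd hne m hm hm'
    obtain ⟨n, rfl, hn⟩ := exists_of_map_mem_segment hm
    simpa only [Function.comp, hT.eq_iff] using S.plane hab hcd hne hn ((map_mem_segment hT).1 hm')
  cp := by
    intro a b c d hab hcd h1 h2 h3 h4 m hm hm'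
    obtain ⟨n, rfl, hn⟩ := exists_of_map_mem_segment hm
    exact S.cp hab hcd h1 h2 h3 h4 hn ((map_mem_segment hT).1 hm')

theorem kill_map (hT : Function.Injective T) {u v w x : V} :
    Kill G (T ∘ P) u v w x ↔ Kill G P u v w x := by
  constructor
  · rintro ⟨h1, h2, h3, h4, h5, m, hm, hm'⟩
    obtain ⟨n, rfl, hn⟩ := exists_of_map_mem_segment hm
    exact ⟨h1, h2, h3, h4, h5, n, hn, (map_mem_segment hT).1 hm'⟩
  · rintro ⟨h1, h2, h3, h4, h5, m, hm, hm'⟩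
    exact ⟨h1, h2, h3, h4, h5, T m, (map_mem_segment hT).2 hm, (map_mem_segment hT).2 hm'⟩

theorem crosses_map (hT : Function.Injective T) {c d z z' : V} :
    Crosses (T ∘ P) c d z z' ↔ Crosses P c d z z' := by
  constructor
  · rintro ⟨m, hm, hm', h1, h2⟩
    obtain ⟨n, rfl, hn⟩ := exists_of_map_mem_segment hm
    exact ⟨n, hn, (map_mem_segment hT).1 hm', fun h => h1 (congrArg T h), fun h => h2 (congrArg T h)⟩
  · rintro ⟨m, hm, hm', h1, h2⟩
    exact ⟨T m, (map_mem_segment hT).2 hm, (map_mem_segment hT).2 hm', fun h => h1 (hT h),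
      fun h => h2 (hT h)⟩

theorem uncrossed_map (hT : Function.Injective T) {z z' : V} :
    Uncrossed H (T ∘ P) z z' ↔ Uncrossed H P z z' := by
  simp only [Uncrossed, crosses_map hT]

theorem bare_map (hT : Function.Injective T) {u v : V} : Bare (T ∘ P) u v ↔ Bare P u v := by
  simp only [Bare, Function.comp, map_mem_segment hT]

theorem clear_map (hT : Function.Injective T) {w : V} {p : ℝ × ℝ} :
    Clear H (T ∘ P) w (T p) ↔ Clear H P w p := by
  constructor
  · intro h c d hcd m hm hm'
    exact hT (h c d hcd (T m) ((map_mem_segment hT).2 hm) ((map_mem_segment hT).2 hm'))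
  · intro h c d hcd m hm hm'
    obtain ⟨n, rfl, hn⟩ := exists_of_map_mem_segment hm
    exact congrArg T (h c d hcd n hn ((map_mem_segment hT).1 hm'))

end Transport

section Basic

variable {G H : SimpleGraph V} {P : V → ℝ × ℝ}

theorem hull_corner {A B C : ℝ × ℝ} : A ∈ convexHull ℝ ({A, B, C} : Set (ℝ × ℝ)) ∧
    B ∈ convexHull ℝ ({A, B, C} : Set (ℝ × ℝ)) ∧ C ∈ convexHull ℝ ({A, B, C} : Set (ℝ × ℝ)) :=
  ⟨subset_convexHull _ _ (by simp), subset_convexHull _ _ (by simp), subset_convexHull _ _ (by simp)⟩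

theorem hull_segment {S : Set (ℝ × ℝ)} {A B q : ℝ × ℝ} (hA : A ∈ convexHull ℝ S)
    (hB : B ∈ convexHull ℝ S) (hq : q ∈ segment ℝ A B) : q ∈ convexHull ℝ S :=
  (convex_convexHull ℝ S).segment_subset hA hB hq

theorem Layout.adj_corner (L : Layout G P) {b k l z : V} (h1 : G.Adj b k) (h2 : G.Adj b l)
    (h3 : G.Adj k l) (hz : P z ∈ convexHull ℝ {P b, P k, P l}) : z = b ∨ G.Adj b z := by
  by_cases e1 : z = b
  · exact Or.inl e1
  · by_cases e2 : z = k
    · exact Or.inr (e2 ▸ h1)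
    · by_cases e3 : z = l
      · exact Or.inr (e3 ▸ h2)
      · exact Or.inr (L.coex h1 h3 h2.symm hz e1 e2 e3).1

/-- The vertices in the hull of a clique of four vertices are adjacent to its vertex `b`, since this hull
is covered by the triangles with corner `b`. -/
theorem Layout.adj_fan (L : Layout G P) {b j k l z : V} (h1 : G.Adj b j) (h2 : G.Adj b k)
    (h3 : G.Adj b l) (h4 : G.Adj j k) (h5 : G.Adj j l) (h6 : G.Adj k l)
    (hz : P z ∈ convexHull ℝ {P b, P j, P k, P l}) : z = b ∨ G.Adj b z := by
  rcases hull4_fan (K := ![P j, P k, P l]) hz with h | h | h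
  · exact L.adj_corner h1 h2 h4 h
  · exact L.adj_corner h1 h3 h5 h
  · exact L.adj_corner h2 h3 h6 h

/-- The vertices in a triangle of edges are pairwise adjacent. -/
theorem Layout.triangle_clique (L : Layout G P) {u v w s t : V} (h1 : G.Adj u v) (h2 : G.Adj u w)
    (h3 : G.Adj v w) (hs : P s ∈ convexHull ℝ {P u, P v, P w})
    (ht : P t ∈ convexHull ℝ {P u, P v, P w}) : s = t ∨ G.Adj s t := by
  have perm1 : ({P v, P u, P w} : Set (ℝ × ℝ)) = {P u, P v, P w} := Set.insert_comm _ _ _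
  have perm2 : ({P w, P u, P v} : Set (ℝ × ℝ)) = {P u, P v, P w} := by
    rw [Set.insert_comm, Set.pair_comm]
  by_cases e1 : s = u
  · subst e1
    exact (L.adj_corner h1 h2 h3 ht).imp Eq.symm id
  by_cases e2 : s = v
  · subst e2
    exact (L.adj_corner h1.symm h3 h2 (by rwa [perm1])).imp Eq.symm id
  by_cases e3 : s = w
  · subst e3
    exact (L.adj_corner h2.symm h3.symm h1 (by rwa [perm2])).imp Eq.symm id
  obtain ⟨g1, g2, g3⟩ := L.coex h1 h3 h2.symm hs e1 e2 e3
  refine (L.adj_fan g1.symm g2.symm g3.symm h1 h2 h3 ?_).imp Eq.symm id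
  exact convexHull_mono (Set.subset_insert _ _) ht

theorem Kill.symm {u v w x : V} (h : Kill G P u v w x) : Kill G P v u w x := by
  obtain ⟨h1, h2, h3, h4, h5, m, h6, h7⟩ := h
  exact ⟨h1, h3, h2, h5, h4, m, by rwa [segment_symm], h7⟩

theorem Crosses.symm {c d z z' : V} (h : Crosses P c d z z') : Crosses P c d z' z := by
  obtain ⟨m, h1, h2, h3, h4⟩ := h
  exact ⟨m, h1, by rwa [segment_symm], h4, h3⟩

theorem Uncrossed.symm {z z' : V} (h : Uncrossed H P z z') : Uncrossed H P z' z :=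
  fun c d hcd hc => h c d hcd hc.symm

theorem Bare.symm {z z' : V} (h : Bare P z z') : Bare P z' z :=
  fun t ht => (h t (by rwa [segment_symm])).symm

theorem Kill.adj (L : Layout G P) {u v w x : V} (huv : G.Adj u v) (h : Kill G P u v w x) :
    G.Adj w u ∧ G.Adj w v := by
  obtain ⟨h1, h2, h3, h4, h5, m, h6, h7⟩ := h
  have wu : w ≠ u := by rintro rfl; exact h2 h1
  have wv : w ≠ v := by rintro rfl; exact h3 h1
  rcases L.red h1 huv wu wv h4 h5 h7 h6 with h | h | h | h
  · exact h
  · exact absurd h.1.symm h2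
  · exact absurd h.2 h2
  · exact absurd h.2 h3

/-- If an edge `ab` kills the side `zz'` of a triangle `zz'k`, then its end `a` is adjacent to `k`. -/
theorem Kill.adj_apex (L : Layout G P) {z z' a b k : V} (hzz : G.Adj z z') (h : Kill G P z z' a b)
    (hk : G.Adj k z) (hk' : G.Adj k z') : a = k ∨ G.Adj a k := by
  obtain ⟨ha, ha'⟩ := h.adj L hzz
  obtain ⟨h1, h2, h3, h4, h5, m, h6, h7⟩ := h
  by_cases e : a = k
  · exact Or.inl e
  right
  have bk : b ≠ k := by rintro rfl; exact h2 hk.symm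
  by_cases haT : P a ∈ convexHull ℝ {P z, P z', P k}
  · exact (L.coex hzz hk'.symm hk haT ha.ne ha'.ne e).2.2.symm
  have hbT : P b ∉ convexHull ℝ {P z, P z', P k} := by
    intro hbT
    exact h2 (L.coex hzz hk'.symm hk hbT h4 h5 bk).1
  obtain ⟨n, hn, hn' | hn'⟩ := segment_meets_other_side h6 h7 haT hbT
  · rcases L.red h1 hk.symm ha.ne e h4 bk hn hn' with h | h | h | h
    · exact h.2
    · exact absurd h.1.symm h2
    · exact absurd h.2 h2
    · exact h.1.symm
  · rcases L.red h1 hk'.symm ha'.ne e h5 bk hn hn' with h | h | h | h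
    · exact h.2
    · exact absurd h.1.symm h3
    · exact absurd h.2 h3
    · exact h.1.symm

/-- A frame for an edge `uv` without inner vertices and an edge that kills it. -/
theorem Kill.exists_frame (L : Layout G P) {u v w x : V} {p : ℝ × ℝ} (huv : G.Adj u v)
    (hb : Bare P u v) (h : Kill G P u v w x) (hp : p ∈ segment ℝ (P u) (P v))
    (hp' : p ∈ segment ℝ (P w) (P x)) :
    ∃ (T : ℝ × ℝ →ᵃ[ℝ] ℝ × ℝ) (ν ξ : ℝ), Function.Injective T ∧ T p = (0, 0) ∧
      Frame (T ∘ P) u v w x ν ξ := by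
  obtain ⟨wu, wv⟩ := h.adj L huv
  obtain ⟨h1, h2, h3, h4, h5, -⟩ := h
  have hU : P u ∉ segment ℝ (P w) (P x) := fun hh => h2 (L.onseg h1 hh wu.ne' h4.symm).2.symm
  have hV : P v ∉ segment ℝ (P w) (P x) := fun hh => h3 (L.onseg h1 hh wv.ne' h5.symm).2.symm
  have hW : P w ∉ segment ℝ (P u) (P v) := fun hh => (hb w hh).elim wu.ne wv.ne
  have hX : P x ∉ segment ℝ (P u) (P v) := fun hh => (hb x hh).elim h4 h5
  obtain ⟨T, ν, ξ, hT, hν, hξ, t0, t1, t2, t3, t4⟩ := PlanarCP.exists_frame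
    (fun e : p = P u => hU (e ▸ hp')) (fun e : p = P v => hV (e ▸ hp'))
    (fun e : p = P w => hW (e ▸ hp)) (fun e : p = P x => hX (e ▸ hp)) hp hp' hU hV hW
  exact ⟨T, ν, ξ, hT, t0, t1, t3, t2, t4, hν, hξ⟩

end Basic

end PlanarCP

/-! ### The lower hull between two colour classes in a triangle -/

namespace PlanarCP

variable {V : Type*}

/-- The triangle with corners `(0, 0)`, `(1, 0)` and `(0, 1)`. -/
def InTri (q : ℝ × ℝ) : Prop := 0 ≤ q.1 ∧ 0 ≤ q.2 ∧ q.1 + q.2 ≤ 1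

/-- The vertices `z` and `z'` in the standard triangle span a part of the boundary of the convex hull
of all vertices in this triangle that faces the origin: the linear form `t * q.1 + (1 - t) * q.2` with
positive coefficients attains its minimum `c` over these vertices at `z` and `z'`. -/
structure HullEdge (P : V → ℝ × ℝ) (t c : ℝ) (z z' : V) : Prop where
  t0 : 0 < t
  t1 : t < 1
  c0 : 0 < c
  ct : c ≤ t
  ct' : c ≤ 1 - t
  tri : InTri (P z)
  tri' : InTri (P z')
  val : t * (P z).1 + (1 - t) * (P z).2 = c
  val' : t * (P z').1 + (1 - t) * (P z').2 = c
  low : ∀ y, InTri (P y) → c ≤ t * (P y).1 + (1 - t) * (P y).2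
  bare : Bare P z z'
  ne : z ≠ z'

theorem HullEdge.symm {P : V → ℝ × ℝ} {t c : ℝ} {z z' : V} (C : HullEdge P t c z z') :
    HullEdge P t c z' z :=
  ⟨C.t0, C.t1, C.c0, C.ct, C.ct', C.tri', C.tri, C.val', C.val, C.low, C.bare.symm, C.ne.symm⟩

/-- If the corners `u = (1, 0)` and `w = (0, 1)` have different colours, and every vertex on one of
the two axes has the colour of the corner on this axis, then the hull of the vertices in the triangle
has a bichromatic edge facing the origin. Its slope is found by rotating a line until its lowest
vertices of the two colours are at the same height. -/
theorem exists_hullEdge [Finite V] {P : V → ℝ × ℝ} (hP : Function.Injective P) {u w : V}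
    (pu : P u = (1, 0)) (pw : P w = (0, 1)) {red : V → Prop}
    (hα : ∀ y, InTri (P y) → (P y).1 = 0 → ¬ red y) (hβ : ∀ y, InTri (P y) → (P y).2 = 0 → red y) :
    ∃ t c z z', HullEdge P t c z z' ∧ red z ∧ ¬ red z' := by
  classical
  have := Fintype.ofFinite V
  have uT : InTri (P u) := by rw [pu]; norm_num [InTri]
  have wT : InTri (P w) := by rw [pw]; norm_num [InTri]
  have hu : red u := hβ u uT (by rw [pu])
  have hw : ¬ red w := hα w wT (by rw [pw])
  let R : Finset V := {y | InTri (P y) ∧ red y}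
  let N : Finset V := {y | InTri (P y) ∧ ¬ red y}
  have memR : ∀ y, y ∈ R ↔ InTri (P y) ∧ red y := fun y => by simp [R]
  have memN : ∀ y, y ∈ N ↔ InTri (P y) ∧ ¬ red y := fun y => by simp [N]
  have uR : u ∈ R := (memR u).2 ⟨uT, hu⟩
  have wN : w ∈ N := (memN w).2 ⟨wT, hw⟩
  let l : V → ℝ → ℝ := fun y t => t * (P y).1 + (1 - t) * (P y).2
  have hl : ∀ y, Continuous (l y) := fun y => by fun_prop
  let f : ℝ → ℝ := fun t => R.inf' ⟨u, uR⟩ fun y => l y t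
  let g : ℝ → ℝ := fun t => N.inf' ⟨w, wN⟩ fun y => l y t
  have hf : Continuous f := Continuous.finset_inf'_apply _ fun y _ => hl y
  have hg : Continuous g := Continuous.finset_inf'_apply _ fun y _ => hl y
  have f0 : f 0 ≤ 0 := (Finset.inf'_le _ uR).trans (by simp [l, pu])
  have g1 : g 1 ≤ 0 := (Finset.inf'_le _ wN).trans (by simp [l, pw])
  have g0 : 0 < g 0 := by
    refine (Finset.lt_inf'_iff _).2 ?_
    intro y hy
    obtain ⟨hT, hr⟩ := (memN y).1 hy
    have : (P y).2 ≠ 0 := fun h => hr (hβ y hT h)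
    simpa [l] using lt_of_le_of_ne hT.2.1 this.symm
  have f1 : 0 < f 1 := by
    refine (Finset.lt_inf'_iff _).2 ?_
    intro y hy
    obtain ⟨hT, hr⟩ := (memR y).1 hy
    have : (P y).1 ≠ 0 := fun h => hα y hT h hr
    simpa [l] using lt_of_le_of_ne hT.1 this.symm
  obtain ⟨t, ht, hfg⟩ : ∃ t ∈ Set.Icc (0 : ℝ) 1, f t - g t = 0 :=
    intermediate_value_Icc zero_le_one (hf.sub hg).continuousOn ⟨by simp; linarith, by simp; linarith⟩
  have t0 : 0 < t := by
    rcases eq_or_lt_of_le ht.1 with h | h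
    · rw [← h] at hfg; linarith
    · exact h
  have t1 : t < 1 := by
    rcases eq_or_lt_of_le ht.2 with h | h
    · rw [h] at hfg; linarith
    · exact h
  have lowf : ∀ y, InTri (P y) → f t ≤ l y t := by
    intro y hy
    by_cases h : red y
    · exact Finset.inf'_le _ ((memR y).2 ⟨hy, h⟩)
    · have : g t ≤ l y t := Finset.inf'_le _ ((memN y).2 ⟨hy, h⟩)
      linarith
  obtain ⟨a, ha, haf⟩ := Finset.exists_mem_eq_inf' (s := R) ⟨u, uR⟩ fun y => l y t
  obtain ⟨b, hb, hbf⟩ := Finset.exists_mem_eq_inf' (s := N) ⟨w, wN⟩ fun y => l y t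
  have haf' : l a t = f t := haf.symm
  have hbf' : l b t = f t := by
    have : g t = l b t := hbf
    linarith
  -- a closest pair of lowest vertices of different colours
  let Q : Finset (V × V) := {q | q.1 ∈ R ∧ q.2 ∈ N ∧ l q.1 t = f t ∧ l q.2 t = f t}
  have memQ : ∀ q, q ∈ Q ↔ q.1 ∈ R ∧ q.2 ∈ N ∧ l q.1 t = f t ∧ l q.2 t = f t := fun q => by simp [Q]
  obtain ⟨⟨z, z'⟩, hz, hmin⟩ := Finset.exists_min_image Q (fun q => |(P q.1).1 - (P q.2).1|)
    ⟨(a, b), (memQ _).2 ⟨ha, hb, haf', hbf'⟩⟩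
  obtain ⟨zR, zN, hzl, hzl'⟩ := (memQ _).1 hz
  simp only at zR zN hzl hzl' hmin
  obtain ⟨zT, zr⟩ := (memR _).1 zR
  obtain ⟨zT', zr'⟩ := (memN _).1 zN
  have hcoord : ∀ y y', l y t = f t → l y' t = f t → (P y).1 = (P y').1 → y = y' := by
    intro y y' h1 h2 h3
    apply hP
    ext
    · exact h3
    · apply mul_left_cancel₀ (sub_pos.2 t1).ne'
      simp only [l] at h1 h2
      rw [h3] at h1
      linarith
  refine ⟨t, f t, z, z', ⟨t0, t1, ?_, ?_, ?_, zT, zT', hzl, hzl', lowf, ?_, ?_⟩, zr, zr'⟩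
  · have h1 : 0 ≤ t * (P z).1 := mul_nonneg t0.le zT.1
    have h2 : 0 ≤ (1 - t) * (P z).2 := mul_nonneg (by linarith) zT.2.1
    rcases eq_or_lt_of_le (add_nonneg h1 h2) with h | h
    · have e1 : (P z).1 = 0 := (mul_eq_zero.1 (by linarith : t * (P z).1 = 0)).resolve_left t0.ne'
      exact absurd zr (hα z zT e1)
    · exact h.trans_eq hzl
  · have := lowf u uT
    simpa [l, pu] using this
  · have := lowf w wT
    simpa [l, pw] using this
  · intro y hy
    rw [mem_segment_prod] at hy
    obtain ⟨s, s0, s1, e1, e2⟩ := hy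
    have yT : InTri (P y) := by
      obtain ⟨h1, h2, h3⟩ := zT
      obtain ⟨h1', h2', h3'⟩ := zT'
      refine ⟨by rw [e1]; nlinarith, by rw [e2]; nlinarith, by rw [e1, e2]; nlinarith⟩
    have yl : l y t = f t := by
      have : l y t = (1 - s) * l z t + s * l z' t := by simp only [l, e1, e2]; ring
      rw [this, hzl, hzl']; ring
    have habs : 0 ≤ |(P z).1 - (P z').1| := abs_nonneg _
    by_cases hr : red y
    · have := hmin (y, z') ((memQ _).2 ⟨(memR _).2 ⟨yT, hr⟩, zN, yl, hzl'⟩)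
      simp only [e1] at this
      have e : (1 - s) * (P z).1 + s * (P z').1 - (P z').1 = (1 - s) * ((P z).1 - (P z').1) := by ring
      rw [e, abs_mul, abs_of_nonneg (by linarith : 0 ≤ 1 - s)] at this
      have : s * |(P z).1 - (P z').1| = 0 := le_antisymm (by linarith) (mul_nonneg s0 habs)
      rcases mul_eq_zero.1 this with h | h
      · exact Or.inl (hcoord _ _ yl hzl (by rw [e1, h]; ring))
      · rw [abs_eq_zero] at h
        exact Or.inl (hcoord _ _ yl hzl (by rw [e1]; linear_combination -s * h))
    · have := hmin (z, y) ((memQ _).2 ⟨zR, (memN _).2 ⟨yT, hr⟩, hzl, yl⟩)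
      simp only [e1] at this
      have e : (P z).1 - ((1 - s) * (P z).1 + s * (P z').1) = s * ((P z).1 - (P z').1) := by ring
      rw [e, abs_mul, abs_of_nonneg s0] at this
      have : (1 - s) * |(P z).1 - (P z').1| = 0 :=
        le_antisymm (by linarith) (mul_nonneg (by linarith) habs)
      rcases mul_eq_zero.1 this with h | h
      · exact Or.inr (hcoord _ _ yl hzl' (by rw [e1, (by linarith : s = 1)]; ring))
      · rw [abs_eq_zero] at h
        exact Or.inr (hcoord _ _ yl hzl' (by rw [e1]; linear_combination (1 - s) * h))
  · rintro rfl
    exact zr' zr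

theorem HullEdge.fst_ne {P : V → ℝ × ℝ} (hP : Function.Injective P) {t c : ℝ} {z z' : V}
    (C : HullEdge P t c z z') : (P z).1 ≠ (P z').1 := by
  intro h
  apply C.ne
  apply hP
  ext
  · exact h
  · apply mul_left_cancel₀ (sub_pos.2 C.t1).ne'
    have h1 := C.val
    have h2 := C.val'
    rw [h] at h1
    linarith

theorem HullEdge.mem_interior {P : V → ℝ × ℝ} {t c : ℝ} {z z' : V}
    (C : HullEdge P t c z z') (hlt : (P z).1 < (P z').1) {r : ℝ × ℝ} (hr : r ∈ segment ℝ (P z) (P z'))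
    (hz : r ≠ P z) (hz' : r ≠ P z') : (P z).1 < r.1 ∧ r.1 < (P z').1 ∧ (P z').2 < r.2 ∧
      r.2 < (P z).2 ∧ t * r.1 + (1 - t) * r.2 = c := by
  rw [mem_segment_prod] at hr
  obtain ⟨s, s0, s1, e1, e2⟩ := hr
  have s0' : 0 < s := by
    rcases eq_or_lt_of_le s0 with h | h
    · exact absurd (by ext <;> simp [e1, e2, ← h]) hz
    · exact h
  have s1' : s < 1 := by
    rcases eq_or_lt_of_le s1 with h | h
    · exact absurd (by ext <;> simp [e1, e2, h]) hz'
    · exact h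
  have hv := C.val
  have hv' := C.val'
  have hlt2 : (P z').2 < (P z).2 := by
    have h1 := mul_pos C.t0 (sub_pos.2 hlt)
    have h2 : (1 - t) * (P z').2 < (1 - t) * (P z).2 := by linarith
    exact lt_of_mul_lt_mul_left h2 (by linarith [C.t1])
  have k1 := mul_pos s0' (sub_pos.2 hlt)
  have k2 := mul_pos (sub_pos.2 s1') (sub_pos.2 hlt)
  have k3 := mul_pos s0' (sub_pos.2 hlt2)
  have k4 := mul_pos (sub_pos.2 s1') (sub_pos.2 hlt2)
  refine ⟨by linarith, by linarith, by linarith, by linarith, ?_⟩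
  rw [e1, e2]
  linear_combination (1 - s) * hv + s * hv'

/-- From an inner point of the triangle on the line through a hull edge, a segment that ends below
this line but outside the triangle leaves the triangle through one of the axes. -/
theorem exists_exit {t c : ℝ} (t0 : 0 < t) (t1 : t < 1) (ct : c ≤ t) (ct' : c ≤ 1 - t)
    {r d : ℝ × ℝ} (r1 : 0 < r.1) (r2 : 0 < r.2) (hr : t * r.1 + (1 - t) * r.2 = c)
    (hd : t * d.1 + (1 - t) * d.2 < c) (hdT : ¬ InTri d) :
    ∃ m ∈ segment ℝ r d, (m.2 = 0 ∧ 0 ≤ m.1 ∧ t * m.1 < c) ∨ (m.1 = 0 ∧ 0 ≤ m.2 ∧ (1 - t) * m.2 < c) := by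
  have hcross : ∀ s, 0 < s → t * ((1 - s) * r.1 + s * d.1) + (1 - t) * ((1 - s) * r.2 + s * d.2) < c := by
    intro s hs
    have := mul_pos hs (sub_pos.2 hd)
    linear_combination this + (1 - s) * hr
  have hneg : d.1 < 0 ∨ d.2 < 0 := by
    by_contra hcon
    push Not at hcon
    apply hdT
    refine ⟨hcon.1, hcon.2, ?_⟩
    by_contra h
    push Not at h
    nlinarith [mul_nonneg (sub_nonneg.2 ct) hcon.1, mul_nonneg (sub_nonneg.2 ct') hcon.2,
      mul_pos t0 (sub_pos.2 t1), mul_nonneg t0.le hcon.1]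
  have A : d.1 < 0 → 0 ≤ r.2 * (0 - d.1) + r.1 * d.2 → ∃ m ∈ segment ℝ r d,
      (m.1 = 0 ∧ 0 ≤ m.2 ∧ (1 - t) * m.2 < c) := by
    intro h1 h2
    have hp : 0 < r.1 - d.1 := by linarith
    have e0 : (1 - r.1 / (r.1 - d.1)) * r.1 + r.1 / (r.1 - d.1) * d.1 = 0 := by field_simp; ring
    have e1 : (1 - r.1 / (r.1 - d.1)) * r.2 + r.1 / (r.1 - d.1) * d.2 =
      (r.2 * (0 - d.1) + r.1 * d.2) / (r.1 - d.1) := by field_simp; ring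
    have := hcross (r.1 / (r.1 - d.1)) (div_pos r1 hp)
    refine ⟨(0, (1 - r.1 / (r.1 - d.1)) * r.2 + r.1 / (r.1 - d.1) * d.2), ?_, rfl, ?_, ?_⟩
    · rw [mem_segment_prod]
      exact ⟨_, div_nonneg r1.le hp.le, (div_le_one hp).2 (by linarith), e0.symm, rfl⟩
    · simp only
      rw [e1]
      exact div_nonneg h2 hp.le
    · rw [e0] at this
      simpa using this
  have B : d.2 < 0 → 0 ≤ r.1 * (0 - d.2) + r.2 * d.1 → ∃ m ∈ segment ℝ r d,
      (m.2 = 0 ∧ 0 ≤ m.1 ∧ t * m.1 < c) := by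
    intro h1 h2
    have hp : 0 < r.2 - d.2 := by linarith
    have e0 : (1 - r.2 / (r.2 - d.2)) * r.2 + r.2 / (r.2 - d.2) * d.2 = 0 := by field_simp; ring
    have e1 : (1 - r.2 / (r.2 - d.2)) * r.1 + r.2 / (r.2 - d.2) * d.1 =
      (r.1 * (0 - d.2) + r.2 * d.1) / (r.2 - d.2) := by field_simp; ring
    have := hcross (r.2 / (r.2 - d.2)) (div_pos r2 hp)
    refine ⟨((1 - r.2 / (r.2 - d.2)) * r.1 + r.2 / (r.2 - d.2) * d.1, 0), ?_, rfl, ?_, ?_⟩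
    · rw [mem_segment_prod]
      exact ⟨_, div_nonneg r2.le hp.le, (div_le_one hp).2 (by linarith), rfl, e0.symm⟩
    · simp only
      rw [e1]
      exact div_nonneg h2 hp.le
    · rw [e0] at this
      simpa using this
  rcases le_or_gt 0 (r.2 * (0 - d.1) + r.1 * d.2) with h | h
  · rcases lt_or_ge d.1 0 with h1 | h1
    · obtain ⟨m, hm, hm'⟩ := A h1 h
      exact ⟨m, hm, Or.inr hm'⟩
    · have h2 : d.2 < 0 := hneg.resolve_left (not_lt.2 h1)
      obtain ⟨m, hm, hm'⟩ := B h2 (by nlinarith [mul_pos r1 (neg_pos.2 h2), mul_nonneg r2.le h1])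
      exact ⟨m, hm, Or.inl hm'⟩
  · have h2 : d.2 < 0 := by
      rcases lt_or_ge d.2 0 with h2 | h2
      · exact h2
      · have h1 := hneg.resolve_right (not_lt.2 h2)
        nlinarith [mul_nonneg r1.le h2, mul_pos r2 (neg_pos.2 h1)]
    obtain ⟨m, hm, hm'⟩ := B h2 (by linarith)
    exact ⟨m, hm, Or.inl hm'⟩

/-- A segment `ab` through an inner point `r` of a hull edge `zz'` contains `z` and `z'`, or it has an
end below the line through `z` and `z'`, and its part from `r` to this end meets one of the axes near
the origin. -/
theorem HullEdge.exit {P : V → ℝ × ℝ} (hP : Function.Injective P) {t c : ℝ} {z z' : V}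
    (C : HullEdge P t c z z') {a b : V} {r : ℝ × ℝ} (hr : r ∈ segment ℝ (P z) (P z'))
    (hz : r ≠ P z) (hz' : r ≠ P z') (hab : r ∈ segment ℝ (P a) (P b)) :
    (P z ∈ segment ℝ (P a) (P b) ∧ P z' ∈ segment ℝ (P a) (P b)) ∨
    ∃ d, (d = a ∨ d = b) ∧ t * (P d).1 + (1 - t) * (P d).2 < c ∧ ∃ m ∈ segment ℝ r (P d),
      (m.2 = 0 ∧ 0 ≤ m.1 ∧ t * m.1 < c) ∨ (m.1 = 0 ∧ 0 ≤ m.2 ∧ (1 - t) * m.2 < c) := by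
  wlog hlt : (P z).1 < (P z').1 generalizing z z'
  · exact (this C.symm (by rwa [segment_symm]) hz' hz
      (lt_of_le_of_ne (not_lt.1 hlt) (C.fst_ne hP).symm)).imp And.symm id
  obtain ⟨h1, h2, h3, h4, h5⟩ := C.mem_interior hlt hr hz hz'
  have r1 : 0 < r.1 := C.tri.1.trans_lt h1
  have r2 : 0 < r.2 := C.tri'.2.1.trans_lt h3
  by_cases hlow : ∃ d, (d = a ∨ d = b) ∧ t * (P d).1 + (1 - t) * (P d).2 < c
  · obtain ⟨d, hd, hdc⟩ := hlow
    refine Or.inr ⟨d, hd, hdc, exists_exit C.t0 C.t1 C.ct C.ct' r1 r2 h5 hdc ?_⟩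
    intro hT
    exact absurd (C.low d hT) (not_le.2 hdc)
  · push Not at hlow
    left
    have ha := hlow a (Or.inl rfl)
    have hb := hlow b (Or.inr rfl)
    have noend : ∀ d, P d ≠ r := by
      intro d hd
      rcases C.bare d (hd ▸ hr) with rfl | rfl
      · exact hz hd.symm
      · exact hz' hd.symm
    have hab' := hab
    rw [mem_segment_prod] at hab
    obtain ⟨s, s0, s1, e1, e2⟩ := hab
    have s0' : 0 < s := by
      rcases eq_or_lt_of_le s0 with h | h
      · exact absurd (by ext <;> simp [e1, e2, ← h]) (noend a)
      · exact h
    have s1' : s < 1 := by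
      rcases eq_or_lt_of_le s1 with h | h
      · exact absurd (by ext <;> simp [e1, e2, h]) (noend b)
      · exact h
    have hsum : (1 - s) * (t * (P a).1 + (1 - t) * (P a).2 - c) +
        s * (t * (P b).1 + (1 - t) * (P b).2 - c) = 0 := by
      rw [e1, e2] at h5
      linear_combination h5
    have k1 := mul_nonneg (sub_pos.2 s1').le (sub_nonneg.2 ha)
    have k2 := mul_nonneg s0'.le (sub_nonneg.2 hb)
    have ea : t * (P a).1 + (1 - t) * (P a).2 = c := by
      have := (mul_eq_zero.1 (by linarith : (1 - s) * (t * (P a).1 + (1 - t) * (P a).2 - c) = 0)).resolve_left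
        (sub_pos.2 s1').ne'
      linarith
    have eb : t * (P b).1 + (1 - t) * (P b).2 = c := by
      have := (mul_eq_zero.1 (by linarith : s * (t * (P b).1 + (1 - t) * (P b).2 - c) = 0)).resolve_left
        s0'.ne'
      linarith
    have hne : (1 - t) ≠ 0 := (sub_pos.2 C.t1).ne'
    -- no end of `ab` is on the segment `zz'`, except possibly at its ends
    have out : ∀ d, t * (P d).1 + (1 - t) * (P d).2 = c → (P d).1 ≤ (P z).1 ∨ (P z').1 ≤ (P d).1 := by
      intro d hd
      by_contra hcon
      push Not at hcon
      rcases C.bare d (mem_segment_of_line hne C.val hd C.val' hcon.1.le hcon.2.le) with rfl | rfl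
      · exact lt_irrefl _ hcon.1
      · exact lt_irrefl _ hcon.2
    have key : ∀ d e, t * (P d).1 + (1 - t) * (P d).2 = c → t * (P e).1 + (1 - t) * (P e).2 = c →
        (P d).1 ≤ r.1 → r.1 ≤ (P e).1 →
        P z ∈ segment ℝ (P d) (P e) ∧ P z' ∈ segment ℝ (P d) (P e) := by
      intro d e hd he hdr hre
      have o1 : (P d).1 ≤ (P z).1 := (out d hd).resolve_right (by linarith)
      have o2 : (P z').1 ≤ (P e).1 := (out e he).resolve_left (by linarith)
      exact ⟨mem_segment_of_line hne hd C.val he o1 (by linarith),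
        mem_segment_of_line hne hd C.val' he (by linarith) o2⟩
    rcases le_total (P a).1 (P b).1 with h | h
    · exact key a b ea eb (by rw [e1]; nlinarith) (by rw [e1]; nlinarith)
    · rw [segment_symm]
      exact key b a eb ea (by rw [e1]; nlinarith) (by rw [e1]; nlinarith)

end PlanarCP

/-! ### Bichromatic edges that are not crossed -/

namespace PlanarCP

variable {V : Type*} {G H : SimpleGraph V} {P : V → ℝ × ℝ}

/-- Minimisation of `f` and, among the minimisers of `f`, of `g`. -/
theorem exists_lex_min {α : Type*} {S : Set α} (hS : S.Nonempty) (f g : α → ℕ) :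
    ∃ x ∈ S, (∀ y ∈ S, f x ≤ f y) ∧ ∀ y ∈ S, f y ≤ f x → g x ≤ g y := by
  obtain ⟨a, ha, hmin⟩ := (measure f).wf.has_min S hS
  obtain ⟨b, hb, hmin'⟩ := (measure g).wf.has_min {y ∈ S | f y ≤ f a} ⟨a, ha, le_rfl⟩
  refine ⟨b, hb.1, fun y hy => hb.2.trans (not_lt.1 (hmin y hy)), fun y hy hyb => ?_⟩
  exact not_lt.1 (hmin' y ⟨hy, hyb.trans hb.2⟩)

theorem HullEdge.pos (hP : Function.Injective P) {t c : ℝ} {z z' : V}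
    (C : HullEdge P t c z z') {r : ℝ × ℝ} (hr : r ∈ segment ℝ (P z) (P z'))
    (hz : r ≠ P z) (hz' : r ≠ P z') : 0 < r.1 ∧ 0 < r.2 := by
  wlog hlt : (P z).1 < (P z').1 generalizing z z'
  · exact this C.symm (by rwa [segment_symm]) hz' hz
      (lt_of_le_of_ne (not_lt.1 hlt) (C.fst_ne hP).symm)
  obtain ⟨h1, h2, h3, -⟩ := C.mem_interior hlt hr hz hz'
  exact ⟨C.tri.1.trans_lt h1, C.tri'.2.1.trans_lt h3⟩

theorem Frame.mem_hull {u v w x : V} {ν ξ : ℝ} (F : Frame P u v w x ν ξ) {q : ℝ × ℝ} (hq : InTri q) :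
    q ∈ convexHull ℝ {P u, P v, P w} := by
  have hν := F.hν
  have h0 : ((0, 0) : ℝ × ℝ) ∈ convexHull ℝ {P u, P v, P w} := by
    refine hull_segment hull_corner.2.1 hull_corner.1 ?_
    rw [F.pu, F.pv]
    exact mem_segment_horizontal (by linarith) zero_le_one
  have := hull_corner (A := P u) (B := P v) (C := P w)
  have hsub : convexHull ℝ {((0, 0) : ℝ × ℝ), P u, P w} ⊆ convexHull ℝ {P u, P v, P w} :=
    convexHull_min (by
      rintro y (rfl | rfl | rfl)
      exacts [h0, this.1, this.2.2]) (convex_convexHull ℝ _)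
  apply hsub
  rw [mem_hull3]
  obtain ⟨h1, h2, h3⟩ := hq
  exact ⟨1 - q.1 - q.2, q.1, q.2, by linarith, h1, h2, by ring, by simp [F.pu, F.pw],
    by simp [F.pu, F.pw]⟩

theorem Frame.mem_uv {u v w x : V} {ν ξ : ℝ} (F : Frame P u v w x ν ξ) {s : ℝ} (h1 : -ν ≤ s)
    (h2 : s ≤ 1) : ((s, 0) : ℝ × ℝ) ∈ segment ℝ (P u) (P v) := by
  rw [segment_symm, F.pu, F.pv]
  exact mem_segment_horizontal h1 h2

theorem Frame.mem_wx {u v w x : V} {ν ξ : ℝ} (F : Frame P u v w x ν ξ) {s : ℝ} (h1 : -ξ ≤ s)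
    (h2 : s ≤ 1) : ((0, s) : ℝ × ℝ) ∈ segment ℝ (P w) (P x) := by
  rw [segment_symm, F.pw, F.px]
  exact mem_segment_vertical h1 h2

/-- No edge of the plane subgraph contains two vertices of different colours. -/
theorem PlaneSubgraph.not_both {κ : Type*} (S : PlaneSubgraph G H P) {col : V → κ}
    (hcol : ∀ a b, H.Adj a b → col a = col b) {z z' e g : V} (hne : col z ≠ col z')
    (heg : H.Adj e g) (h1 : P z ∈ segment ℝ (P e) (P g)) (h2 : P z' ∈ segment ℝ (P e) (P g)) :
    False := by
  apply hne
  have := hcol e g heg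
  rcases S.noVertex heg h1 with rfl | rfl <;> rcases S.noVertex heg h2 with rfl | rfl
  · rfl
  · exact this
  · exact this.symm
  · rfl

/-- If an edge `wx` of the plane subgraph crosses a bare edge `uv` and `u`, `v`, `w` form a bichromatic
triangle, then this triangle contains a bichromatic edge that is crossed by fewer edges of the plane
subgraph than `uv`: a hull edge of the vertices in one half of the triangle. -/
theorem Frame.exists_less_crossed [Finite V] {κ : Type*} (L : Layout G P) (S : PlaneSubgraph G H P)
    {col : V → κ} (hcol : ∀ a b, H.Adj a b → col a = col b) {u v w x : V} {ν ξ : ℝ}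
    (F : Frame P u v w x ν ξ) (hb : Bare P u v) (hwx : H.Adj w x) (huw : col u ≠ col w) :
    ∃ z z', P z ∈ convexHull ℝ {P u, P v, P w} ∧ P z' ∈ convexHull ℝ {P u, P v, P w} ∧
      col z ≠ col z' ∧ (∀ e g, H.Adj e g → Crosses P e g z z' → Crosses P e g u v) ∧
      ¬ Crosses P w x z z' := by
  have hν := F.hν
  have hξ := F.hξ
  obtain ⟨t, c, z, z', C, hz, hz'⟩ := exists_hullEdge L.inj F.pu F.pw (red := fun y => col y = col u)
    (by
      intro y hy h1 h2
      have : P y ∈ segment ℝ (P w) (P x) := by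
        have e : P y = (0, (P y).2) := by ext <;> simp [h1]
        rw [e]
        exact F.mem_wx (by linarith [hy.2.1]) (by linarith [hy.2.2])
      rcases S.noVertex hwx this with rfl | rfl
      · exact huw h2.symm
      · exact huw (h2.symm.trans (hcol _ _ hwx).symm))
    (by
      intro y hy h1
      have : P y ∈ segment ℝ (P u) (P v) := by
        have e : P y = ((P y).1, 0) := by ext <;> simp [h1]
        rw [e]
        exact F.mem_uv (by linarith [hy.1]) (by linarith [hy.2.2])
      rcases hb y this with rfl | rfl
      · rfl
      · have := hy.1
        rw [F.pv] at this
        simp only at this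
        linarith)
  have hne : col z ≠ col z' := fun h => hz' (h ▸ hz)
  have hwx1 : ∀ q ∈ segment ℝ (P w) (P x), q.1 = 0 := by
    intro q hq
    rw [mem_segment_prod, F.pw, F.px] at hq
    obtain ⟨s, -, -, e, -⟩ := hq
    simpa using e
  refine ⟨z, z', F.mem_hull C.tri, F.mem_hull C.tri', hne, ?_, ?_⟩
  · rintro e g heg ⟨r, hr, hr', rz, rz'⟩
    have rpos := C.pos L.inj hr' rz rz'
    rcases C.exit L.inj hr' rz rz' hr with ⟨h1, h2⟩ | ⟨d, hd, -, m, hm, hm'⟩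
    · exact (S.not_both hcol hne heg h1 h2).elim
    · have hd' : P d ∈ segment ℝ (P e) (P g) := by
        rcases hd with rfl | rfl
        exacts [left_mem_segment _ _ _, right_mem_segment _ _ _]
      have hmeg : m ∈ segment ℝ (P e) (P g) := (convex_segment _ _).segment_subset hr hd' hm
      rcases hm' with ⟨h1, h2, h3⟩ | ⟨h1, h2, h3⟩
      · have m1 : m.1 < 1 := by
          have : t * m.1 < t * 1 := by linarith [C.ct]
          exact lt_of_mul_lt_mul_left this C.t0.le
        have em : m = (m.1, 0) := by ext <;> simp [h1]
        refine ⟨m, hmeg, ?_, ?_, ?_⟩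
        · rw [em]; exact F.mem_uv (by linarith) m1.le
        · intro h; rw [h, F.pu] at m1; simp at m1
        · intro h; rw [h, F.pv] at h2; simp at h2; linarith
      · exfalso
        have m2 : m.2 < 1 := by
          have : (1 - t) * m.2 < (1 - t) * 1 := by linarith [C.ct']
          exact lt_of_mul_lt_mul_left this (by linarith [C.t1])
        have em : m = (0, m.2) := by ext <;> simp [h1]
        have hmwx : m ∈ segment ℝ (P w) (P x) := by
          rw [em]; exact F.mem_wx (by linarith) m2.le
        by_cases hs : s(e, g) = s(w, x)
        · have : r ∈ segment ℝ (P w) (P x) := by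
            rcases Sym2.eq_iff.1 hs with ⟨rfl, rfl⟩ | ⟨rfl, rfl⟩
            · exact hr
            · rwa [segment_symm]
          exact rpos.1.ne' (hwx1 r this)
        · rcases (S.plane heg hwx hs hmeg hmwx).2 with h | h
          · rw [h, F.pw] at m2; simp at m2
          · rw [h, F.px] at h2; simp at h2; linarith
  · rintro ⟨r, hr, hr', rz, rz'⟩
    exact (C.pos L.inj hr' rz rz').1.ne' (hwx1 r hr)

/-- Descent: a set `C` of vertices with adjacent vertices of different colours contains a bare
bichromatic edge that no edge of the plane subgraph crosses. Here `C` has to contain all vertices on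
the edges and in the triangles of edges that it spans, and an edge of the plane subgraph crossing a
bichromatic edge of `C` needs an end in `C` that forms a triangle with this edge. -/
theorem PlaneSubgraph.exists_uncrossed [Finite V] {κ : Type*} (L : Layout G P)
    (S : PlaneSubgraph G H P) {col : V → κ} (hcol : ∀ a b, H.Adj a b → col a = col b) {C : Set V}
    (htri : ∀ a ∈ C, ∀ b ∈ C, ∀ c ∈ C, G.Adj a b → G.Adj a c → G.Adj b c →
      ∀ y, P y ∈ convexHull ℝ {P a, P b, P c} → y ∈ C)
    (hseg : ∀ a ∈ C, ∀ b ∈ C, G.Adj a b → ∀ y, P y ∈ segment ℝ (P a) (P b) → y ∈ C)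
    (hend : ∀ z ∈ C, ∀ z' ∈ C, G.Adj z z' → col z ≠ col z' → Bare P z z' → ∀ c d, H.Adj c d →
      Crosses P c d z z' → (c ∈ C ∧ G.Adj c z ∧ G.Adj c z') ∨ (d ∈ C ∧ G.Adj d z ∧ G.Adj d z'))
    (hC : ∃ z ∈ C, ∃ z' ∈ C, G.Adj z z' ∧ col z ≠ col z') :
    ∃ z ∈ C, ∃ z' ∈ C, G.Adj z z' ∧ col z ≠ col z' ∧ Bare P z z' ∧ Uncrossed H P z z' := by
  let X : V × V → Set (V × V) := fun q => {e | H.Adj e.1 e.2 ∧ Crosses P e.1 e.2 q.1 q.2}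
  let Y : V × V → Set V := fun q => {t | P t ∈ segment ℝ (P q.1) (P q.2)}
  obtain ⟨a, ha, b, hb, hab, hcab⟩ := hC
  obtain ⟨⟨z, z'⟩, ⟨hz, hz', hzz, hne⟩, hmin, hmin'⟩ := exists_lex_min
    (S := {q : V × V | q.1 ∈ C ∧ q.2 ∈ C ∧ G.Adj q.1 q.2 ∧ col q.1 ≠ col q.2})
    ⟨(a, b), ha, hb, hab, hcab⟩ (fun q => (X q).ncard) (fun q => (Y q).ncard)
  simp only at hz hz' hzz hne
  have Xsymm : ∀ z z', X (z, z') = X (z', z) := by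
    intro z z'
    ext e
    exact and_congr_right fun _ => ⟨Crosses.symm, Crosses.symm⟩
  have Ysymm : ∀ z z', Y (z, z') = Y (z', z) := by
    intro z z'
    ext e
    simp only [Y, Set.mem_ofPred_eq, segment_symm ℝ (P z)]
  have hsub : ∀ z z' t, P t ∈ segment ℝ (P z) (P z') → t ≠ z' →
      (X (z, t)).ncard ≤ (X (z, z')).ncard ∧ (Y (z, t)).ncard < (Y (z, z')).ncard := by
    intro z z' t ht htz
    have hsub : segment ℝ (P z) (P t) ⊆ segment ℝ (P z) (P z') :=
      (convex_segment _ _).segment_subset (left_mem_segment _ _ _) ht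
    have hz' : P z' ∉ segment ℝ (P z) (P t) := fun h => htz (L.inj (segment_antisymm ht h))
    constructor
    · refine Set.ncard_le_ncard ?_ (Set.toFinite _)
      rintro ⟨e, g⟩ ⟨heg, m, hm, hm', mz, mt⟩
      exact ⟨heg, m, hm, hsub hm', mz, fun h => hz' (h ▸ hm')⟩
    · refine Set.ncard_lt_ncard (Set.ssubset_iff_subset_ne.2 ⟨fun y hy => hsub hy, ?_⟩) (Set.toFinite _)
      intro h
      have : z' ∈ Y (z, z') := right_mem_segment _ _ _
      rw [← h] at this
      exact hz' this
  have hbare : Bare P z z' := by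
    intro t ht
    by_contra hcon
    push Not at hcon
    obtain ⟨h1, h2⟩ := L.onseg hzz ht hcon.1 hcon.2
    have htC := hseg z hz z' hz' hzz t ht
    by_cases hc : col t = col z
    · obtain ⟨k1, k2⟩ := hsub z' z t (by rwa [segment_symm]) hcon.1
      rw [Xsymm z' z, Ysymm z' z] at *
      exact absurd (hmin' (z', t) ⟨hz', htC, h2, fun h => hne (hc.symm.trans h.symm)⟩ k1)
        (not_le.2 k2)
    · obtain ⟨k1, k2⟩ := hsub z z' t ht hcon.2
      exact absurd (hmin' (z, t) ⟨hz, htC, h1, fun h => hc h.symm⟩ k1) (not_le.2 k2)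
  refine ⟨z, hz, z', hz', hzz, hne, hbare, ?_⟩
  -- the main step, for a crossing edge `cd` whose end `c` is adjacent to `z` and `z'`
  have main : ∀ z ∈ C, ∀ z' ∈ C, G.Adj z z' → Bare P z z' →
      (∀ y ∈ {q : V × V | q.1 ∈ C ∧ q.2 ∈ C ∧ G.Adj q.1 q.2 ∧ col q.1 ≠ col q.2},
        (X (z, z')).ncard ≤ (X y).ncard) →
      ∀ c ∈ C, ∀ d, H.Adj c d → Crosses P c d z z' → G.Adj c z → G.Adj c z' → col z ≠ col c → False := by
    rintro z hz z' hz' hzz hbare hmin c hc d hcd hcr hcz hcz' hcol'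
    obtain ⟨m, hm, hm', mz, mz'⟩ := id hcr
    have hdz : d ≠ z := by
      rintro rfl
      exact hcol' (hcol _ _ hcd).symm
    have hW : P c ∉ segment ℝ (P z) (P z') := fun h => (hbare c h).elim hcz.ne hcz'.ne
    have hU : P z ∉ segment ℝ (P c) (P d) := fun h => (S.noVertex hcd h).elim hcz.ne' hdz.symm
    have hV : P z' ∉ segment ℝ (P c) (P d) := by
      intro h
      rcases S.noVertex hcd h with h | rfl
      · exact hcz'.ne' h
      · exact (overlap hm hm' mz').elim hW hU
    have hX : P d ∉ segment ℝ (P z) (P z') := by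
      intro h
      rcases hbare d h with h | rfl
      · exact hdz h
      · exact hV (right_mem_segment _ _ _)
    obtain ⟨T, ν, ξ, hT, hν, hξ, t0, t1, t2, t3, t4⟩ := PlanarCP.exists_frame mz mz'
      (fun e : m = P c => hW (e ▸ hm')) (fun e : m = P d => hX (e ▸ hm')) hm' hm hU hV hW
    have F : Frame (T ∘ P) z z' c d ν ξ := ⟨t1, t3, t2, t4, hν, hξ⟩
    obtain ⟨y, y', hy, hy', hyy, h1, h2⟩ := F.exists_less_crossed (L.map hT) (S.map hT) hcol
      ((bare_map hT).2 hbare) hcd hcol'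
    simp only [crosses_map hT] at h1 h2
    have hy := (map_mem_hull3 hT).1 hy
    have hy' := (map_mem_hull3 hT).1 hy'
    have hadj : G.Adj y y' := by
      rcases L.triangle_clique hzz hcz.symm hcz'.symm hy hy' with h | h
      · exact (hyy (h ▸ rfl)).elim
      · exact h
    refine absurd (hmin (y, y') ⟨htri z hz z' hz' c hc hzz hcz.symm hcz'.symm y hy,
      htri z hz z' hz' c hc hzz hcz.symm hcz'.symm y' hy', hadj, hyy⟩) (not_le.2 ?_)
    refine Set.ncard_lt_ncard (Set.ssubset_iff_subset_ne.2 ⟨?_, ?_⟩) (Set.toFinite _)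
    · rintro ⟨e, g⟩ ⟨heg, he⟩
      exact ⟨heg, h1 e g heg he⟩
    · intro h
      have : (c, d) ∈ X (z, z') := ⟨hcd, hcr⟩
      rw [← h] at this
      exact h2 this.2
  have main' : ∀ c ∈ C, ∀ d, H.Adj c d → Crosses P c d z z' → G.Adj c z → G.Adj c z' → False := by
    intro c hc d hcd hcr hcz hcz'
    by_cases h : col z = col c
    · refine main z' hz' z hz hzz.symm hbare.symm ?_ c hc d hcd hcr.symm hcz' hcz
        fun h' => hne (h.trans h'.symm)
      rw [Xsymm]
      exact hmin
    · exact main z hz z' hz' hzz hbare hmin c hc d hcd hcr hcz hcz' h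
  intro c d hcd hcr
  rcases hend z hz z' hz' hzz hne hbare c d hcd hcr with ⟨hc, h1, h2⟩ | ⟨hd, h1, h2⟩
  · exact main' c hc d hcd hcr h1 h2
  · obtain ⟨m, hm, hm'⟩ := hcr
    exact main' d hd c hcd.symm ⟨m, by rwa [segment_symm], hm'⟩ h1 h2

end PlanarCP

/-! ### The killers of an edge that share their far end -/

namespace PlanarCP

variable {V : Type*} {G H : SimpleGraph V} {P : V → ℝ × ℝ}

/-- In a frame, the cone with apex `x = (0, -ξ)` spanned by the segment `uv`. -/
def cone (ν ξ : ℝ) : Set (ℝ × ℝ) := {q | -ν * (ξ + q.2) ≤ q.1 * ξ ∧ q.1 * ξ ≤ ξ + q.2}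

theorem convex_cone (ν ξ : ℝ) : Convex ℝ (cone ν ξ) := by
  rw [convex_iff_segment_subset]
  rintro a ⟨a1, a2⟩ b ⟨b1, b2⟩ q hq
  rw [mem_segment_prod] at hq
  obtain ⟨t, t0, t1, e1, e2⟩ := hq
  have k1 := mul_nonneg t0 (sub_nonneg.2 b1)
  have k2 := mul_nonneg t0 (sub_nonneg.2 b2)
  have k3 := mul_nonneg (sub_nonneg.2 t1) (sub_nonneg.2 a1)
  have k4 := mul_nonneg (sub_nonneg.2 t1) (sub_nonneg.2 a2)
  constructor
  · rw [e1, e2]; linarith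
  · rw [e1, e2]; linarith

namespace Frame

variable {u v w x : V} {ν ξ : ℝ}

theorem mem_uv_iff (F : Frame P u v w x ν ξ) {q : ℝ × ℝ} :
    q ∈ segment ℝ (P u) (P v) ↔ q.2 = 0 ∧ -ν ≤ q.1 ∧ q.1 ≤ 1 := by
  constructor
  · intro h
    rw [mem_segment_prod, F.pu, F.pv] at h
    obtain ⟨t, t0, t1, e1, e2⟩ := h
    have := F.hν
    simp only at e1 e2
    refine ⟨by linarith, by nlinarith, by nlinarith⟩
  · rintro ⟨h1, h2, h3⟩
    have : q = (q.1, 0) := by ext <;> simp [h1]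
    rw [this]
    exact F.mem_uv h2 h3

theorem cone_axis (F : Frame P u v w x ν ξ) {q : ℝ × ℝ} (hq : q ∈ cone ν ξ) (h : q.2 = 0) :
    q ∈ segment ℝ (P u) (P v) := by
  rw [F.mem_uv_iff]
  obtain ⟨h1, h2⟩ := hq
  have := F.hξ
  rw [h, add_zero] at h1 h2
  refine ⟨h, le_of_mul_le_mul_right h1 this, ?_⟩
  exact le_of_mul_le_mul_right (by linarith) this

theorem cone_x (F : Frame P u v w x ν ξ) : P x ∈ cone ν ξ := by
  rw [F.px]; simp [cone]

theorem cone_uv (F : Frame P u v w x ν ξ) {q : ℝ × ℝ} (hq : q ∈ segment ℝ (P u) (P v)) :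
    q ∈ cone ν ξ := by
  rw [F.mem_uv_iff] at hq
  obtain ⟨h1, h2, h3⟩ := hq
  have := F.hξ
  constructor
  · rw [h1]; nlinarith
  · rw [h1]; nlinarith

/-- A point is in the cone if the segment from it to the apex contains another point of the cone. -/
theorem cone_of_mem (F : Frame P u v w x ν ξ) {q s : ℝ × ℝ} (hs : s ∈ segment ℝ q (P x))
    (hc : s ∈ cone ν ξ) (hs2 : -ξ < s.2) : q ∈ cone ν ξ := by
  rw [mem_segment_prod, F.px] at hs
  obtain ⟨t, t0, t1, e1, e2⟩ := hs
  have t1' : 0 < 1 - t := by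
    rcases eq_or_lt_of_le t1 with h | h
    · rw [h] at e2; simp at e2; linarith
    · linarith
  obtain ⟨h1, h2⟩ := hc
  simp only at e1 e2
  rw [e1, e2] at h1 h2
  constructor
  · refine le_of_mul_le_mul_left ?_ t1'
    linarith
  · refine le_of_mul_le_mul_left ?_ t1'
    linarith

theorem snd_nonneg_of_mem (F : Frame P u v w x ν ξ) {q s : ℝ × ℝ} (hs : s ∈ segment ℝ q (P x))
    (hs2 : 0 ≤ s.2) : 0 ≤ q.2 := by
  rw [mem_segment_prod, F.px] at hs
  obtain ⟨t, t0, t1, e1, e2⟩ := hs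
  have := F.hξ
  by_contra hq
  push Not at hq
  simp only at e2
  have h1 := mul_nonneg t0 this.le
  have h2 := mul_nonneg (sub_nonneg.2 t1) (neg_pos.2 hq).le
  rcases eq_or_lt_of_le t0 with h | h
  · rw [← h] at e2; linarith
  · have := mul_pos h this
    linarith

/-- The killers of `uv` with far end `x` are the neighbours of `x` in the cone above `uv`. -/
theorem kill_iff (F : Frame P u v w x ν ξ) (hb : Bare P u v) (hK : Kill G P u v w x) {a : V} :
    Kill G P u v a x ↔ G.Adj a x ∧ P a ∈ cone ν ξ ∧ 0 < (P a).2 := by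
  obtain ⟨-, k2, k3, k4, k5, -⟩ := hK
  have hξ := F.hξ
  constructor
  · rintro ⟨h1, -, -, -, -, s, hs, hs'⟩
    obtain ⟨s2, -⟩ := F.mem_uv_iff.1 hs
    have hc := F.cone_of_mem hs' (F.cone_uv hs) (by linarith)
    refine ⟨h1, hc, lt_of_le_of_ne (F.snd_nonneg_of_mem hs' s2.ge) fun h => ?_⟩
    rcases hb a (F.cone_axis hc h.symm) with rfl | rfl
    · exact k2 h1
    · exact k3 h1
  · rintro ⟨h1, h2, h3⟩
    have hs := axis_mem_segment (A := P x) (B := P a) (by rw [F.px]; simp; linarith) h3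
    exact ⟨h1, k2, k3, k4, k5, _, F.cone_axis
      ((convex_cone ν ξ).segment_subset F.cone_x h2 hs) rfl, by rwa [segment_symm]⟩

/-- A convex set that avoids `u` and `v` and contains a point of `uv` meets the axis only between `u`
and `v`. -/
theorem axis_between (F : Frame P u v w x ν ξ) {K : Set (ℝ × ℝ)} (hK : Convex ℝ K) (hu : P u ∉ K)
    (hv : P v ∉ K) {p s : ℝ × ℝ} (hp : p ∈ K) (hp' : p ∈ segment ℝ (P u) (P v)) (hs : s ∈ K)
    (hs2 : s.2 = 0) : -ν < s.1 ∧ s.1 < 1 := by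
  obtain ⟨p2, p1, p1'⟩ := F.mem_uv_iff.1 hp'
  have ep : p = (p.1, 0) := by ext <;> simp [p2]
  have es : s = (s.1, 0) := by ext <;> simp [hs2]
  constructor
  · by_contra h
    push Not at h
    apply hv
    rw [ep] at hp
    rw [es] at hs
    rw [F.pv]
    exact hK.segment_subset hs hp (mem_segment_horizontal h p1)
  · by_contra h
    push Not at h
    apply hu
    rw [ep] at hp
    rw [es] at hs
    rw [F.pu]
    exact hK.segment_subset hp hs (mem_segment_horizontal p1' h)

end Frame

/-- A triangle of edges with corner `x` contains neither `u` nor `v` if `x` is not adjacent to them. -/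
theorem Kill.not_mem_hull (L : Layout G P) {u v w x : V} (hK : Kill G P u v w x) {b c : V}
    (h1 : G.Adj x b) (h2 : G.Adj x c) (h3 : G.Adj b c) :
    P u ∉ convexHull ℝ {P x, P b, P c} ∧ P v ∉ convexHull ℝ {P x, P b, P c} := by
  obtain ⟨-, k2, k3, k4, k5, -⟩ := hK
  exact ⟨fun h => (L.adj_corner h1 h2 h3 h).elim k4.symm fun h => k2 h.symm,
    fun h => (L.adj_corner h1 h2 h3 h).elim k5.symm fun h => k3 h.symm⟩

/-- If `ax`, `ay` are edges, `yx` kills `uv`, and `a` is on the side of `y` of the line `uv`, then `ax`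
kills `uv`, since otherwise `u` or `v` would lie in the triangle `axy`. -/
theorem Frame.kill_of_above (L : Layout G P) {u v w x : V} {ν ξ : ℝ} (F : Frame P u v w x ν ξ)
    {a y : V} (hK : Kill G P u v y x) (hax : G.Adj a x) (hay : G.Adj a y) (ha : 0 < (P a).2) :
    Kill G P u v a x := by
  have hξ := F.hξ
  obtain ⟨hu, hv⟩ := hK.not_mem_hull L hax.symm hK.1.symm hay
  obtain ⟨k1, k2, k3, k4, k5, p, hp, hp'⟩ := hK
  have hs := axis_mem_segment (A := P x) (B := P a) (by rw [F.px]; simp; linarith) ha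
  obtain ⟨b1, b2⟩ := F.axis_between (convex_convexHull ℝ _) hu hv
    (hull_segment hull_corner.2.2 hull_corner.1 hp') hp
    (hull_segment hull_corner.1 hull_corner.2.1 hs) rfl
  exact ⟨hax, k2, k3, k4, k5, _, F.mem_uv_iff.2 ⟨rfl, b1.le, b2.le⟩, by rwa [segment_symm]⟩

/-- The killers of `uv` with a common far end are pairwise adjacent. -/
theorem Kill.clique (L : Layout G P) {u v w y x : V} (huv : G.Adj u v) (hw : Kill G P u v w x)
    (hy : Kill G P u v y x) (hne : y ≠ w) : G.Adj y w := by
  obtain ⟨wu, wv⟩ := hw.adj L huv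
  obtain ⟨yu, yv⟩ := hy.adj L huv
  obtain ⟨k1, k2, k3, k4, k5, -⟩ := hw
  obtain ⟨h1, -, -, -, -, r, hr, hr'⟩ := hy
  by_cases hyT : P y ∈ convexHull ℝ {P u, P v, P w}
  · exact (L.coex huv wv.symm wu hyT yu.ne yv.ne hne).2.2.symm
  have hxT : P x ∉ convexHull ℝ {P u, P v, P w} := fun h =>
    k2 (L.coex huv wv.symm wu h k4 k5 k1.ne').1
  obtain ⟨n, hn, hn' | hn'⟩ := segment_meets_other_side hr hr' hyT hxT
  · rcases L.red h1 wu.symm yu.ne hne k4 k1.ne' hn hn' with h | h | h | h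
    · exact h.2
    · exact absurd h.1.symm k2
    · exact absurd h.2 k2
    · exact h.1.symm
  · rcases L.red h1 wv.symm yv.ne hne k5 k1.ne' hn hn' with h | h | h | h
    · exact h.2
    · exact absurd h.1.symm k3
    · exact absurd h.2 k3
    · exact h.1.symm

/-- The set of killers of `uv` with a common far end is closed under taking vertices in triangles. -/
theorem Kill.star_triangle (L : Layout G P) {u v x a b c : V} (huv : G.Adj u v) (hb : Bare P u v)
    (ha : Kill G P u v a x) (hb' : Kill G P u v b x) (hc : Kill G P u v c x) (hab : G.Adj a b)
    (hac : G.Adj a c) (hbc : G.Adj b c) {y : V} (hy : P y ∈ convexHull ℝ {P a, P b, P c}) :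
    Kill G P u v y x := by
  obtain ⟨-, -, -, -, -, p, hp, hp'⟩ := id ha
  obtain ⟨T, ν, ξ, hT, -, F⟩ := ha.exists_frame L huv hb hp hp'
  have L' := L.map hT
  rw [← kill_map hT] at *
  rw [← map_mem_hull3 hT] at hy
  rw [← bare_map hT] at hb
  have K := fun d => F.kill_iff (a := d) hb ha
  obtain ⟨a1, a2, a3⟩ := (K a).1 ha
  obtain ⟨b1, b2, b3⟩ := (K b).1 hb'
  obtain ⟨c1, c2, c3⟩ := (K c).1 hc
  have hyc : (T ∘ P) y ∈ cone ν ξ := convexHull_min (by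
    rintro q (rfl | rfl | rfl)
    exacts [a2, b2, c2]) (convex_cone ν ξ) hy
  have hy2 : 0 < ((T ∘ P) y).2 := convexHull_min (t := {q : ℝ × ℝ | 0 < q.2}) (by
    rintro q (rfl | rfl | rfl)
    exacts [a3, b3, c3]) convex_upper' hy
  refine (K y).2 ⟨?_, hyc, hy2⟩
  rcases L'.adj_fan a1.symm b1.symm c1.symm hab hac hbc
    (convexHull_mono (Set.subset_insert _ _) hy) with h | h
  · rw [h, F.px] at hy2
    have := F.hξ
    simp only at hy2
    linarith
  · exact h.symm

/-- The set of killers of `uv` with a common far end is closed under taking vertices on edges. -/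
theorem Kill.star_segment (L : Layout G P) {u v x a b : V} (huv : G.Adj u v) (hb : Bare P u v)
    (ha : Kill G P u v a x) (hb' : Kill G P u v b x) (hab : G.Adj a b)
    {y : V} (hy : P y ∈ segment ℝ (P a) (P b)) : Kill G P u v y x := by
  by_cases h1 : y = a
  · exact h1 ▸ ha
  by_cases h2 : y = b
  · exact h2 ▸ hb'
  obtain ⟨-, -, -, -, -, p, hp, hp'⟩ := id ha
  obtain ⟨T, ν, ξ, hT, -, F⟩ := ha.exists_frame L huv hb hp hp'
  have L' := L.map hT
  rw [← kill_map hT] at *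
  rw [← map_mem_segment hT] at hy
  rw [← bare_map hT] at hb
  have K := fun d => F.kill_iff (a := d) hb ha
  obtain ⟨a1, a2, a3⟩ := (K a).1 ha
  obtain ⟨b1, b2, b3⟩ := (K b).1 hb'
  have hy2 : 0 < ((T ∘ P) y).2 := by
    exact convex_upper'.segment_subset a3 b3 hy
  refine (K y).2 ⟨?_, (convex_cone ν ξ).segment_subset a2 b2 hy, hy2⟩
  rcases L'.adj_corner a1.symm b1.symm hab (hull_segment hull_corner.2.1 hull_corner.2.2 hy) with h | h
  · rw [h, F.px] at hy2
    have := F.hξ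
    simp only at hy2
    linarith
  · exact h.symm

/-- An edge of a plane subgraph that crosses a bare edge `zz'` not in the subgraph has no end in
common with it. -/
theorem PlaneSubgraph.ne_of_crosses (S : PlaneSubgraph G H P) {z z' c d : V} (hb : Bare P z z')
    (hzz : ¬ H.Adj z z') (hcd : H.Adj c d) (hc : Crosses P c d z z') : c ≠ z := by
  rintro rfl
  obtain ⟨m, h1, h2, h3, h4⟩ := hc
  rw [segment_symm] at h1 h2
  rcases overlap h1 h2 h3 with h | h
  · rw [segment_symm] at h
    rcases hb d h with rfl | rfl
    · exact hcd.ne rfl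
    · exact hzz hcd
  · rw [segment_symm] at h
    rcases S.noVertex hcd h with rfl | rfl
    · rw [segment_same, Set.mem_singleton_iff] at h2
      exact h3 h2
    · exact hzz hcd

/-- An edge `cd` of the plane subgraph that crosses an edge between two killers `z`, `z'` of `uv` with
common far end `x` has an end that is also such a killer, if `uv` is not crossed. -/
theorem Kill.star_end (L : Layout G P) (S : PlaneSubgraph G H P) {u v x z z' c d : V}
    (huv : G.Adj u v) (hb : Bare P u v) (hun : Uncrossed H P u v)
    (hz : Kill G P u v z x) (hz' : Kill G P u v z' x) (hzz : G.Adj z z') (hzb : Bare P z z')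
    (hzH : ¬ H.Adj z z') (hcd : H.Adj c d) (hcr : Crosses P c d z z') :
    (Kill G P u v c x ∧ G.Adj c z ∧ G.Adj c z') ∨ (Kill G P u v d x ∧ G.Adj d z ∧ G.Adj d z') := by
  have hcr' : Crosses P d c z z' := by
    obtain ⟨m, h1, h2⟩ := hcr
    exact ⟨m, by rwa [segment_symm], h2⟩
  have cz := S.ne_of_crosses hzb hzH hcd hcr
  have cz' := S.ne_of_crosses hzb.symm (fun h => hzH h.symm) hcd hcr.symm
  have dz := S.ne_of_crosses hzb hzH hcd.symm hcr'
  have dz' := S.ne_of_crosses hzb.symm (fun h => hzH h.symm) hcd.symm hcr'.symm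
  suffices Kill G P u v c x ∨ Kill G P u v d x by
    rcases this with h | h
    · exact Or.inl ⟨h, Kill.clique L huv hz h cz, Kill.clique L huv hz' h cz'⟩
    · exact Or.inr ⟨h, Kill.clique L huv hz h dz, Kill.clique L huv hz' h dz'⟩
  clear hcr'
  obtain ⟨-, -, -, -, -, p, hp, hp'⟩ := id hz
  obtain ⟨T, ν, ξ, hT, -, F⟩ := hz.exists_frame L huv hb hp hp'
  replace L := L.map hT
  replace S := S.map hT
  rw [← crosses_map hT] at hcr
  rw [← uncrossed_map hT] at hun
  rw [← bare_map hT] at hb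
  rw [← kill_map hT] at hz hz'
  rw [← kill_map hT, ← kill_map (w := d) hT]
  generalize hQ : T ∘ P = Q at *
  clear hQ hp hp' hT T hzb
  have K := fun d => F.kill_iff (a := d) hb hz
  have hξ := F.hξ
  have hx2 : (Q x).2 < 0 := by rw [F.px]; simpa using hξ
  obtain ⟨zx, z2, z3⟩ := (K z).1 hz
  obtain ⟨zx', z2', z3'⟩ := (K z').1 hz'
  obtain ⟨nu, nv⟩ := hz.not_mem_hull L zx.symm zx'.symm hzz
  obtain ⟨m, hm, hm', -, -⟩ := hcr
  have m2 : 0 < m.2 := convex_upper'.segment_subset z3 z3' hm'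
  have hTc : convexHull ℝ {Q x, Q z, Q z'} ⊆ cone ν ξ := convexHull_min (by
    rintro q (rfl | rfl | rfl)
    exacts [F.cone_x, z2, z2']) (convex_cone ν ξ)
  have hmT : m ∈ convexHull ℝ {Q x, Q z, Q z'} := hull_segment hull_corner.2.1 hull_corner.2.2 hm'
  -- the edge `cd` does not meet the axis inside the triangle `xzz'`
  have noaxis : ∀ q ∈ segment ℝ (Q c) (Q d), q ∈ convexHull ℝ {Q x, Q z, Q z'} → 0 < q.2 := by
    intro q hq hqT
    by_contra h
    push Not at h
    have hs := axis_mem_segment h m2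
    have hsT := hull_segment hqT hmT hs
    refine hun c d hcd ⟨_, (convex_segment _ _).segment_subset hq hm hs, F.cone_axis (hTc hsT) rfl,
      fun h => nu (h ▸ hsT), fun h => nv (h ▸ hsT)⟩
  have inside : ∀ e, (e = c ∨ e = d) → Q e ∈ convexHull ℝ {Q x, Q z, Q z'} → Kill G Q u v e x := by
    intro e he heT
    have he2 : 0 < (Q e).2 := by
      refine noaxis _ ?_ heT
      rcases he with rfl | rfl
      exacts [left_mem_segment _ _ _, right_mem_segment _ _ _]
    refine (K e).2 ⟨?_, hTc heT, he2⟩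
    rcases L.adj_corner zx.symm zx'.symm hzz heT with rfl | h
    · linarith
    · exact h.symm
  by_cases hcT : Q c ∈ convexHull ℝ {Q x, Q z, Q z'}
  · exact Or.inl (inside c (Or.inl rfl) hcT)
  by_cases hdT : Q d ∈ convexHull ℝ {Q x, Q z, Q z'}
  · exact Or.inr (inside d (Or.inr rfl) hdT)
  -- an end adjacent to `x` and to `z` or `z'`
  have out : ∀ e y, (e = c ∨ e = d) → (y = z ∨ y = z') → G.Adj e y → G.Adj e x →
      ∀ n ∈ segment ℝ (Q c) (Q d), n ∈ segment ℝ (Q x) (Q y) → Kill G Q u v e x := by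
    intro e y he hy hey hex n hn hn'
    have hyK : Kill G Q u v y x := by
      rcases hy with rfl | rfl
      exacts [hz, hz']
    have hyT : Q y ∈ convexHull ℝ {Q x, Q z, Q z'} := by
      rcases hy with rfl | rfl
      exacts [hull_corner.2.1, hull_corner.2.2]
    have hn2 : 0 < n.2 := noaxis n hn (hull_segment hull_corner.1 hyT hn')
    rcases lt_or_ge 0 (Q e).2 with h | h
    · exact F.kill_of_above L hyK hex hey h
    · exfalso
      have hs := axis_mem_segment h hn2
      have heS : Q e ∈ segment ℝ (Q c) (Q d) := by
        rcases he with rfl | rfl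
        exacts [left_mem_segment _ _ _, right_mem_segment _ _ _]
      obtain ⟨ku, kv⟩ := hyK.not_mem_hull L hex.symm hyK.1.symm hey
      have hsT := hull_segment (S := {Q x, Q e, Q y}) hull_corner.2.1
        (hull_segment hull_corner.1 hull_corner.2.2 hn') hs
      obtain ⟨-, -, -, -, -, p, hp, hp'⟩ := id hyK
      obtain ⟨b1, b2⟩ := F.axis_between (convex_convexHull ℝ _) ku kv
        (hull_segment hull_corner.2.2 hull_corner.1 hp') hp hsT rfl
      refine hun c d hcd ⟨_, (convex_segment _ _).segment_subset heS hn hs,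
        F.mem_uv_iff.2 ⟨rfl, b1.le, b2.le⟩, fun h => ku (h ▸ hsT), fun h => kv (h ▸ hsT)⟩
  have cx : c ≠ x := fun h => hcT (h ▸ hull_corner.1)
  have dx : d ≠ x := fun h => hdT (h ▸ hull_corner.1)
  have perm : ({Q x, Q z, Q z'} : Set (ℝ × ℝ)) = {Q z, Q z', Q x} := by
    rw [Set.insert_comm, Set.pair_comm (Q x)]
  rw [perm] at hcT hdT
  obtain ⟨n, hn, hn' | hn'⟩ := segment_meets_other_side hm' hm hcT hdT
  · rcases S.cp hcd zx cz cx dz dx hn hn' with h | h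
    · exact Or.inl (out c z (Or.inl rfl) (Or.inl rfl) h.1 h.2 n hn (by rwa [segment_symm]))
    · exact Or.inr (out d z (Or.inr rfl) (Or.inl rfl) h.1 h.2 n hn (by rwa [segment_symm]))
  · rcases S.cp hcd zx' cz' cx dz' dx hn hn' with h | h
    · exact Or.inl (out c z' (Or.inl rfl) (Or.inr rfl) h.1 h.2 n hn (by rwa [segment_symm]))
    · exact Or.inr (out d z' (Or.inr rfl) (Or.inr rfl) h.1 h.2 n hn (by rwa [segment_symm]))

end PlanarCP

/-! ### Killers of an edge between killers -/

namespace PlanarCP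

variable {V : Type*} {G H : SimpleGraph V} {P : V → ℝ × ℝ}

/-- If `ab` kills an edge between two killers `z`, `z'` of `uv` with common far end `x`, and crosses
`uv` between `a` and `zz'`, then `b` is not adjacent to `u`. -/
theorem Kill.not_adj_far (L : Layout G P) {u v x z z' a b : V} (huv : G.Adj u v) (hb : Bare P u v)
    (hz : Kill G P u v z x) (hz' : Kill G P u v z' x) (hzz : G.Adj z z') (hK : Kill G P z z' a b)
    {r s : ℝ × ℝ} (hr : r ∈ segment ℝ (P z) (P z')) (hr' : r ∈ segment ℝ (P a) (P b))
    (hs : s ∈ segment ℝ (P u) (P v)) (hs' : s ∈ segment ℝ (P a) r) (hsu : s ≠ P u)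
    (hax : G.Adj a x) (hau : G.Adj a u) : ¬ G.Adj u b := by
  intro hub
  have ka := hK.adj L hzz
  obtain ⟨hab, nzb, nzb', bz, bz', -⟩ := id hK
  have zuv := hz.adj L huv
  have zuv' := hz'.adj L huv
  obtain ⟨-, nux, nvx, xu, xv, -⟩ := id hz
  have bv : b ≠ v := by rintro rfl; exact nzb zuv.2
  have bx : b ≠ x := by rintro rfl; exact nzb hz.1
  obtain ⟨p, hp, hp'⟩ := hz.2.2.2.2.2
  obtain ⟨T, ν, ξ, hT, -, F⟩ := hz.exists_frame L huv hb hp hp'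
  replace L := L.map hT
  rw [← map_mem_segment hT] at hr hr' hs hs'
  replace hsu : T s ≠ T (P u) := fun h => hsu (hT h)
  rw [← bare_map hT] at hb
  rw [← kill_map hT] at hz hz'
  generalize T r = r at *
  generalize T s = s at *
  change r ∈ segment ℝ ((T ∘ P) z) ((T ∘ P) z') at hr
  change r ∈ segment ℝ ((T ∘ P) a) ((T ∘ P) b) at hr'
  change s ∈ segment ℝ ((T ∘ P) u) ((T ∘ P) v) at hs
  change s ∈ segment ℝ ((T ∘ P) a) r at hs'
  change s ≠ (T ∘ P) u at hsu
  clear hK hp hp'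
  generalize T ∘ P = Q at *
  clear hT T
  have K := fun d => F.kill_iff (a := d) hb hz
  have hξ := F.hξ
  obtain ⟨zx, z2, z3⟩ := (K z).1 hz
  obtain ⟨zx', z2', z3'⟩ := (K z').1 hz'
  have r2 : 0 < r.2 := convex_upper'.segment_subset z3 z3' hr
  have sab : s ∈ segment ℝ (Q a) (Q b) :=
    (convex_segment _ _).segment_subset (left_mem_segment _ _ _) hr' hs'
  obtain ⟨s2, s1, s1'⟩ := F.mem_uv_iff.1 hs
  have s1u : s.1 < 1 := lt_of_le_of_ne s1' fun h => hsu (by rw [F.pu]; ext <;> simp [h, s2])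
  have sa : s ≠ Q a := by
    intro h
    rcases hb a (h ▸ hs) with rfl | rfl
    · exact hau.ne rfl
    · exact nvx hax
  have a2 : (Q a).2 < 0 := by
    by_contra h
    push Not at h
    rw [mem_segment_prod] at hs'
    obtain ⟨t, t0, t1, e1, e2⟩ := hs'
    rw [s2] at e2
    have h1 := mul_nonneg (sub_nonneg.2 t1) h
    have h2 := mul_nonneg t0 r2.le
    have : t = 0 := (mul_eq_zero.1 (by linarith : t * r.2 = 0)).resolve_right r2.ne'
    rw [this] at e1 e2
    exact sa (by ext <;> linarith)
  have b2 : 0 < (Q b).2 := by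
    rw [mem_segment_prod] at hr'
    obtain ⟨t, t0, t1, e1, e2⟩ := hr'
    by_contra h
    push Not at h
    have h1 := mul_nonneg (sub_nonneg.2 t1) (neg_pos.2 a2).le
    have h2 := mul_nonneg t0 (neg_nonneg.2 h)
    linarith
  -- the line through `a`, `s`, `r`, `b`
  set A := (Q b).2 with hA
  set B := -((Q b).1 - s.1) with hB
  have ob : A * (Q b).1 + B * (Q b).2 = A * s.1 := by rw [hA, hB]; ring
  have os : A * s.1 + B * s.2 = A * s.1 := by rw [s2]; ring
  have oa : A * (Q a).1 + B * (Q a).2 = A * s.1 := by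
    rw [mem_segment_prod] at sab
    obtain ⟨t, t0, t1, e1, e2⟩ := sab
    have ht : 1 - t ≠ 0 := by
      intro ht
      rw [ht, (by linarith : t = 1)] at e2
      linarith
    apply mul_left_cancel₀ ht
    rw [hA, hB]
    rw [s2] at e2
    linear_combination -A * e1 - B * e2 - t * ob
  have olin : ∀ q ∈ segment ℝ (Q a) (Q b), A * q.1 + B * q.2 = A * s.1 := by
    intro q hq
    rw [mem_segment_prod] at hq
    obtain ⟨t, -, -, e1, e2⟩ := hq
    rw [e1, e2]
    linear_combination (1 - t) * oa + t * ob
  -- a killer on the line would be on `ab`, or `b` between it and `a`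
  have offline : ∀ k, G.Adj a k → ¬ G.Adj k b → b ≠ k → 0 < (Q k).2 → A * (Q k).1 + B * (Q k).2 ≠ A * s.1 := by
    intro k hak hkb hne hk2 ok
    rcases le_total (Q k).2 (Q b).2 with h | h
    · have hk := mem_segment_of_line' b2.ne' oa ok ob (a2.trans hk2).le h
      exact hkb (L.onseg hab hk hak.ne' hne.symm).2.symm
    · have hk := mem_segment_of_line' b2.ne' oa ob ok (a2.trans b2).le h
      exact hkb (L.onseg hak hk hab.ne' hne).2
  -- no killer is on the side of `u` of the line
  have main : ∀ k, Kill G Q u v k x → G.Adj a k → ¬ G.Adj k b → b ≠ k → G.Adj k u → G.Adj k v →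
      A * s.1 < A * (Q k).1 + B * (Q k).2 → False := by
    intro k hk hak hkb hne hku hkv ok
    obtain ⟨kx, kc, k2⟩ := (K k).1 hk
    obtain ⟨-, -, -, -, -, p, hp, hp'⟩ := hk
    obtain ⟨p2, p1, p1'⟩ := F.mem_uv_iff.1 hp
    -- the segment from a point `n` of `xk` above `uv` to `k` leaves the triangle `sbu`
    have leave : ∀ n ∈ segment ℝ (Q k) (Q x), 0 ≤ n.2 → A * s.1 ≤ A * n.1 + B * n.2 →
        A * n.1 + -((Q b).1 - 1) * n.2 ≤ A → False := by
      intro n hn n2 on gn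
      rcases le_or_gt (A * (Q k).1 + -((Q b).1 - 1) * (Q k).2) A with gk | gk
      · have hkT : Q k ∈ convexHull ℝ {s, Q b, Q u} := by
          have h1 : 0 < 1 - s.1 := by linarith
          have h2 : 0 < (1 - s.1) * A := mul_pos h1 b2
          have h3 : (1 - s.1) ≠ 0 := h1.ne'
          have h4 : A ≠ 0 := b2.ne'
          rw [mem_hull3]
          refine ⟨(A - (A * (Q k).1 + -((Q b).1 - 1) * (Q k).2)) / ((1 - s.1) * A), (Q k).2 / A,
            (A * (Q k).1 + B * (Q k).2 - A * s.1) / ((1 - s.1) * A), div_nonneg (by linarith) h2.le,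
            div_nonneg k2.le b2.le, div_nonneg (by linarith) h2.le, ?_, ?_, ?_⟩
          · rw [hB]; field_simp; ring
          · rw [F.pu, hB]; field_simp; ring
          · rw [F.pu, s2, ← hA]; field_simp; ring
        have hkT' : Q k ∈ convexHull ℝ {Q a, Q b, Q u} := by
          refine convexHull_min ?_ (convex_convexHull ℝ _) hkT
          rintro q (rfl | rfl | rfl)
          exacts [hull_segment hull_corner.1 hull_corner.2.1 sab, hull_corner.2.1, hull_corner.2.2]
        exact hkb (L.coex hab hub.symm hau.symm hkT' hak.ne' hne.symm hku.ne).2.1.symm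
      · obtain ⟨N, hN, gN⟩ := exists_mem_segment_zero gn gk
        have N2 : 0 ≤ N.2 := convex_upper.segment_subset (x := n) (y := Q k) n2 k2.le hN
        have oN : A * s.1 ≤ A * N.1 + B * N.2 :=
          (convex_halfplane A B (A * s.1)).segment_subset on ok.le hN
        have N2' : N.2 ≤ A := by
          have : 0 ≤ (1 - s.1) * (A - N.2) := by rw [hB] at oN; linarith
          have := (mul_nonneg_iff_of_pos_left (by linarith)).1 this
          linarith
        have hNub : N ∈ segment ℝ (Q u) (Q b) :=
          mem_segment_of_line' b2.ne' (by rw [F.pu]; simp) gN (by rw [← hA]; ring)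
            (by rw [F.pu]; exact N2) N2'
        have hNk : N ∈ segment ℝ (Q k) (Q x) :=
          (convex_segment _ _).segment_subset hn (left_mem_segment _ _ _) hN
        rcases L.red hub kx hku.ne' xu.symm hne bx hNub hNk with h | h | h | h
        · exact nux h.2
        · exact hkb h.1.symm
        · exact hkb h.2
        · exact nux h.1.symm
    rcases le_or_gt s.1 p.1 with h | h
    · refine leave p hp' p2.ge ?_ ?_
      · rw [p2]; nlinarith
      · rw [p2]; nlinarith
    · obtain ⟨n, hn, on⟩ := exists_mem_segment_zero (A := p) (B := Q k) (a := A) (b := B) (c := A * s.1)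
        (by rw [p2]; nlinarith) ok
      have n2 : 0 ≤ n.2 := convex_upper.segment_subset (x := p) (y := Q k) p2.ge k2.le hn
      have hnk : n ∈ segment ℝ (Q k) (Q x) :=
        (convex_segment _ _).segment_subset hp' (left_mem_segment _ _ _) hn
      rcases le_or_gt n.2 A with hnA | hnA
      · refine leave n hnk n2 on.ge ?_
        have : 0 ≤ (1 - s.1) * (A - n.2) := mul_nonneg (by linarith) (by linarith)
        rw [hB] at on
        linarith
      · have hbn : Q b ∈ segment ℝ s n :=
          mem_segment_of_line' b2.ne' os ob on (by rw [s2]; exact b2.le) hnA.le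
        have hbT : Q b ∈ convexHull ℝ {Q k, Q u, Q v} :=
          hull_segment (hull_segment hull_corner.2.1 hull_corner.2.2 hs)
            (hull_segment (hull_segment hull_corner.2.1 hull_corner.2.2 hp) hull_corner.1 hn) hbn
        exact hkb (L.coex hku huv hkv.symm hbT hne hub.ne' bv).1
  have oz := offline z ka.1 nzb bz z3
  have oz' := offline z' ka.2 nzb' bz' z3'
  rcases lt_or_gt_of_ne oz with h | h
  · rcases lt_or_gt_of_ne oz' with h' | h'
    · have := olin r hr'
      rw [mem_segment_prod] at hr
      obtain ⟨t, t0, t1, e1, e2⟩ := hr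
      rw [e1, e2] at this
      rcases eq_or_lt_of_le t0 with ht | ht
      · rw [← ht] at this; linarith
      · have h1 := mul_pos ht (sub_pos.2 h')
        have h2 := mul_nonneg (sub_nonneg.2 t1) (sub_pos.2 h).le
        linarith
    · exact main z' hz' ka.2 nzb' bz' zuv'.1 zuv'.2 h'
  · exact main z hz ka.1 nzb bz zuv.1 zuv.2 h

/-- A killer of an edge between two killers of `uv` with a common far end is itself a killer of
`uv`. -/
theorem Kill.star_kill (L : Layout G P) {u v x z z' a b : V} (huv : G.Adj u v) (hb : Bare P u v)
    (hz : Kill G P u v z x) (hz' : Kill G P u v z' x) (hzz : G.Adj z z') (hK : Kill G P z z' a b) :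
    ∃ y, Kill G P u v a y := by
  have ka := hK.adj L hzz
  obtain ⟨hab, nzb, nzb', bz, bz', r, hr, hr'⟩ := id hK
  have zuv := hz.adj L huv
  have zuv' := hz'.adj L huv
  obtain ⟨-, nux, nvx, xu, xv, p, hp, hp'⟩ := id hz
  obtain ⟨T, ν, ξ, hT, -, F⟩ := hz.exists_frame L huv hb hp hp'
  have far := @Kill.not_adj_far V G P L
  have LQ := L.map hT
  have hrQ := (map_mem_segment hT).2 hr
  have hrQ' := (map_mem_segment hT).2 hr'
  have hpQ := (map_mem_segment hT).2 hp
  have hpQ' := (map_mem_segment hT).2 hp'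
  change T r ∈ segment ℝ ((T ∘ P) z) ((T ∘ P) z') at hrQ
  change T r ∈ segment ℝ ((T ∘ P) a) ((T ∘ P) b) at hrQ'
  change T p ∈ segment ℝ ((T ∘ P) u) ((T ∘ P) v) at hpQ
  change T p ∈ segment ℝ ((T ∘ P) z) ((T ∘ P) x) at hpQ'
  have hzQ := (kill_map hT).2 hz
  have hzQ' := (kill_map hT).2 hz'
  have hbQ := (bare_map hT).2 hb
  have K := fun d => F.kill_iff (a := d) hbQ hzQ
  have hξ := F.hξ
  obtain ⟨zx, z2, z3⟩ := (K z).1 hzQ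
  obtain ⟨zx', z2', z3'⟩ := (K z').1 hzQ'
  have r2 : 0 < (T r).2 := convex_upper'.segment_subset z3 z3' hrQ
  have rc : T r ∈ cone ν ξ := (convex_cone ν ξ).segment_subset z2 z2' hrQ
  have x2 : ((T ∘ P) x).2 = -ξ := by rw [F.px]
  have hax : G.Adj a x := by
    rcases hK.adj_apex L hzz zx.symm zx'.symm with rfl | h
    · exfalso
      -- a killing edge starting in `x` would end in another killer of `uv`, adjacent to `z`
      have hbc : (T ∘ P) b ∈ cone ν ξ := F.cone_of_mem (s := T r) (by rwa [segment_symm]) rc (by linarith)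
      have hb2 : 0 < ((T ∘ P) b).2 := by
        refine lt_of_le_of_ne (F.snd_nonneg_of_mem (s := T r) (by rwa [segment_symm]) r2.le) fun h => ?_
        rw [mem_segment_prod] at hrQ'
        obtain ⟨t, t0, t1, e1, e2⟩ := hrQ'
        rw [← h, x2] at e2
        have := mul_nonneg (sub_nonneg.2 t1) hξ.le
        linarith
      have hbK := (kill_map hT).1 ((K b).2 ⟨hab.symm, hbc, hb2⟩)
      exact nzb (Kill.clique L huv hz hbK bz).symm
    · exact h
  rcases lt_or_ge 0 ((T ∘ P) a).2 with ha | ha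
  · exact ⟨x, (kill_map hT).1 (F.kill_of_above LQ hzQ hax ka.1 ha)⟩
  have hau : a ≠ u := by rintro rfl; exact nux hax
  have hav : a ≠ v := by rintro rfl; exact nvx hax
  have adju : G.Adj a u := (hK.adj_apex L hzz zuv.1.symm zuv'.1.symm).resolve_left hau
  have adjv : G.Adj a v := (hK.adj_apex L hzz zuv.2.symm zuv'.2.symm).resolve_left hav
  -- `ab` crosses `uv`, since neither `u` nor `v` is in the hull of the clique `x`, `a`, `z`, `z'`
  have hu : (T ∘ P) u ∉ convexHull ℝ {(T ∘ P) x, (T ∘ P) a, (T ∘ P) z, (T ∘ P) z'} := fun h =>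
    (LQ.adj_fan hax.symm zx.symm zx'.symm ka.1 ka.2 hzz h).elim xu.symm fun h => nux h.symm
  have hv : (T ∘ P) v ∉ convexHull ℝ {(T ∘ P) x, (T ∘ P) a, (T ∘ P) z, (T ∘ P) z'} := fun h =>
    (LQ.adj_fan hax.symm zx.symm zx'.symm ka.1 ka.2 hzz h).elim xv.symm fun h => nvx h.symm
  have hs := axis_mem_segment ha r2
  set σ := (((T ∘ P) a).1 * (T r).2 - ((T ∘ P) a).2 * (T r).1) / ((T r).2 - ((T ∘ P) a).2)
  have hx4 : (T ∘ P) x ∈ convexHull ℝ {(T ∘ P) x, (T ∘ P) a, (T ∘ P) z, (T ∘ P) z'} :=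
    subset_convexHull _ _ (by simp)
  have ha4 : (T ∘ P) a ∈ convexHull ℝ {(T ∘ P) x, (T ∘ P) a, (T ∘ P) z, (T ∘ P) z'} :=
    subset_convexHull _ _ (by simp)
  have hz4 : (T ∘ P) z ∈ convexHull ℝ {(T ∘ P) x, (T ∘ P) a, (T ∘ P) z, (T ∘ P) z'} :=
    subset_convexHull _ _ (by simp)
  have hz4' : (T ∘ P) z' ∈ convexHull ℝ {(T ∘ P) x, (T ∘ P) a, (T ∘ P) z, (T ∘ P) z'} :=
    subset_convexHull _ _ (by simp)
  have hs4 := hull_segment ha4 (hull_segment hz4 hz4' hrQ) hs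
  obtain ⟨b1, b2⟩ := F.axis_between (convex_convexHull ℝ _) hu hv (hull_segment hz4 hx4 hpQ') hpQ hs4 rfl
  have hsuv := F.mem_uv b1.le b2.le
  obtain ⟨s, hse, hs'⟩ := exists_of_map_mem_segment hs
  rw [hse] at hsuv hs4
  have hsu : s ≠ P u := by rintro rfl; exact hu hs4
  have hsv : s ≠ P v := by rintro rfl; exact hv hs4
  replace hsuv := (map_mem_segment hT).1 hsuv
  refine ⟨b, hab, ?_, ?_, ?_, ?_, s, hsuv, ?_⟩
  · exact far huv hb hz hz' hzz hK hr hr' hsuv hs' hsu hax adju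
  · exact far huv.symm hb.symm hz.symm hz'.symm hzz hK hr hr' (by rwa [segment_symm]) hs' hsv hax adjv
  · rintro rfl; exact nzb zuv.1
  · rintro rfl; exact nzb zuv.2
  · exact (convex_segment _ _).segment_subset (left_mem_segment _ _ _) hr' hs'

/-- The vertices whose edges kill `uv`. -/
def killers (G : SimpleGraph V) (P : V → ℝ × ℝ) (u v : V) : Set V := {w | ∃ x, Kill G P u v w x}

/-- If no uncrossed bichromatic edge has fewer killers than `uv`, then all killers of `uv` with the
same far end have the same colour: otherwise descent among them leads to an edge whose killers are
some, but not all of the killers of `uv`. -/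
theorem Kill.star_mono [Finite V] {κ : Type*} (L : Layout G P) (S : PlaneSubgraph G H P)
    {col : V → κ} (hcol : ∀ a b, H.Adj a b → col a = col b) {u v x w w' : V} (huv : G.Adj u v)
    (hb : Bare P u v) (hun : Uncrossed H P u v)
    (hmin : ∀ z z', G.Adj z z' → col z ≠ col z' → Uncrossed H P z z' →
      (killers G P u v).ncard ≤ (killers G P z z').ncard)
    (hw : Kill G P u v w x) (hw' : Kill G P u v w' x) : col w = col w' := by
  by_contra hne
  obtain ⟨z, hz, z', hz', hzz, hzc, hzb, hzu⟩ := S.exists_uncrossed L hcol (C := {y | Kill G P u v y x})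
    (fun a ha b hb' c hc hab hac hbc y hy => Kill.star_triangle L huv hb ha hb' hc hab hac hbc hy)
    (fun a ha b hb' hab y hy => Kill.star_segment L huv hb ha hb' hab hy)
    (fun z hz z' hz' hzz hzc hzb c d hcd hcr =>
      Kill.star_end L S huv hb hun hz hz' hzz hzb (fun h => hzc (hcol _ _ h)) hcd hcr)
    ⟨w, hw, w', hw', Kill.clique L huv hw' hw fun h => hne (h ▸ rfl), hne⟩
  refine absurd (hmin z z' hzz hzc hzu) (not_le.2 (Set.ncard_lt_ncard
    (Set.ssubset_iff_subset_ne.2 ⟨?_, ?_⟩) (Set.toFinite _)))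
  · rintro a ⟨b, hab⟩
    exact Kill.star_kill L huv hb hz hz' hzz hab
  · intro h
    have : z ∈ killers G P u v := ⟨x, hz⟩
    rw [← h] at this
    obtain ⟨b, hb⟩ := this
    exact hb.2.1 hb.1

end PlanarCP

/-! ### Killers of a hull edge -/

namespace PlanarCP

variable {V : Type*} {G H : SimpleGraph V} {P : V → ℝ × ℝ}

set_option maxHeartbeats 1000000 in
/-- Let `uv` be killed by `wx`, and let `zz'` be a hull edge in the triangle between the two edges.
Then the killers of `zz'` are killers of `uv`. If `w` is one of them, by an edge `wb`, then `wb` kills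
`uv`, too, and meets `uv` closer to `u` than `wx` does. -/
theorem Frame.hullEdge_kill (L : Layout G P) {u v w x : V} {ν ξ : ℝ} (F : Frame P u v w x ν ξ)
    (huv : G.Adj u v) (hb : Bare P u v) (hK : Kill G P u v w x) {t c : ℝ} {z z' : V}
    (C : HullEdge P t c z z') {a b : V} (hab : Kill G P z z' a b) :
    (∃ y, Kill G P u v a y) ∧
      (a = w → Kill G P u v w b ∧ ∃ m, 0 < m ∧ m < 1 ∧ ((m, 0) : ℝ × ℝ) ∈ segment ℝ (P w) (P b)) := by
  wlog hlt : (P z).1 < (P z').1 generalizing z z'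
  · exact this C.symm hab.symm (lt_of_le_of_ne (not_lt.1 hlt) (C.fst_ne L.inj).symm)
  have hν := F.hν
  have hξ := F.hξ
  obtain ⟨wu, wv⟩ := hK.adj L huv
  obtain ⟨wx, nux, nvx, xu, xv, -⟩ := id hK
  have hzT := F.mem_hull C.tri
  have hzT' := F.mem_hull C.tri'
  have hzz : G.Adj z z' := (L.triangle_clique huv wu.symm wv.symm hzT hzT').resolve_left C.ne
  obtain ⟨az, az'⟩ := hab.adj L hzz
  obtain ⟨adj, nzb, nzb', bz, bz', r, hr, hr'⟩ := id hab
  -- relation of the corners `u`, `v`, `w` to `z`, `z'`, `a` and `b`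
  have corner : ∀ k, P k ∈ convexHull ℝ {P u, P v, P w} → (a = k ∨ G.Adj a k) ∧ b ≠ k := by
    intro k hk
    have h1 := L.triangle_clique huv wu.symm wv.symm hk hzT
    have h2 := L.triangle_clique huv wu.symm wv.symm hk hzT'
    constructor
    · rcases h1 with rfl | h1
      · exact Or.inr az
      · rcases h2 with rfl | h2
        · exact Or.inr az'
        · exact hab.adj_apex L hzz h1 h2
    · rintro rfl
      rcases h1 with h | h
      · exact bz h
      · exact nzb h.symm
  obtain ⟨au, bu⟩ := corner u hull_corner.1
  obtain ⟨av, bv⟩ := corner v hull_corner.2.1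
  obtain ⟨aw, bw⟩ := corner w hull_corner.2.2
  have ax : a ≠ x := by
    rintro rfl
    rcases au with h | h
    · exact xu h
    · exact nux h.symm
  -- no triangle of edges with side `ab` and third corner `k` contains `z` or `z'`
  have noT : ∀ k, (a = k ∨ G.Adj a k) → G.Adj b k →
      P z ∉ convexHull ℝ {P a, P b, P k} ∧ P z' ∉ convexHull ℝ {P a, P b, P k} := by
    intro k hak hbk
    have key : ∀ y, G.Adj a y → ¬ G.Adj y b → b ≠ y → P y ∉ convexHull ℝ {P a, P b, P k} := by
      intro y ay nyb hby hy
      rcases hak with rfl | hak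
      · have : P y ∈ segment ℝ (P a) (P b) := by
          rw [← convexHull_pair]
          rwa [Set.pair_comm (P b), Set.insert_eq_of_mem (Set.mem_insert _ _)] at hy
        exact nyb (L.onseg adj this ay.ne' hby.symm).2.symm
      · by_cases hyk : y = k
        · subst hyk
          exact nyb hbk.symm
        · exact nyb (L.coex adj hbk hak.symm hy ay.ne' hby.symm hyk).2.1.symm
    exact ⟨key z az nzb bz, key z' az' nzb' bz'⟩
  have rz : r ≠ P z := by
    rintro rfl
    exact nzb (L.onseg adj hr' az.ne' bz.symm).2.symm
  have rz' : r ≠ P z' := by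
    rintro rfl
    exact nzb' (L.onseg adj hr' az'.ne' bz'.symm).2.symm
  obtain ⟨i1, i2, i3, i4, hrc⟩ := C.mem_interior hlt hr rz rz'
  have r1 : 0 < r.1 := C.tri.1.trans_lt i1
  have r2 : 0 < r.2 := C.tri'.2.1.trans_lt i3
  have t0 := C.t0
  have t1 : 0 < 1 - t := sub_pos.2 C.t1
  have c0 := C.c0
  -- the points in which the line through `z` and `z'` meets the axes
  have q1 : c / t ≤ 1 := (div_le_one t0).2 C.ct
  have q2 : c / (1 - t) ≤ 1 := (div_le_one t1).2 C.ct'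
  have q1' : 0 < c / t := div_pos c0 t0
  have q2' : 0 < c / (1 - t) := div_pos c0 t1
  have hzq : P z ∈ segment ℝ ((0, c / (1 - t)) : ℝ × ℝ) r :=
    mem_segment_of_line t1.ne' (by simp; field_simp) C.val hrc C.tri.1 i1.le
  have hzq' : P z' ∈ segment ℝ r ((c / t, 0) : ℝ × ℝ) := by
    refine mem_segment_of_line t1.ne' hrc C.val' (by simp; field_simp) i2.le ?_
    rw [le_div_iff₀ t0]
    have := C.val'
    have := mul_nonneg t1.le C.tri'.2.1
    linarith
  obtain ⟨d, hd, hdc, m, hm, hm'⟩ : ∃ d, (d = a ∨ d = b) ∧ t * (P d).1 + (1 - t) * (P d).2 < c ∧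
      ∃ m ∈ segment ℝ r (P d), (m.2 = 0 ∧ 0 ≤ m.1 ∧ t * m.1 < c) ∨
        (m.1 = 0 ∧ 0 ≤ m.2 ∧ (1 - t) * m.2 < c) := by
    rcases C.exit L.inj hr rz rz' hr' with ⟨h, -⟩ | h
    · exact absurd (L.onseg adj h az.ne' bz.symm).2.symm nzb
    · exact h
  have hmab : m ∈ segment ℝ (P a) (P b) := by
    refine (convex_segment _ _).segment_subset hr' ?_ hm
    rcases hd with rfl | rfl
    exacts [left_mem_segment _ _ _, right_mem_segment _ _ _]
  have h0wx : ((0, 0) : ℝ × ℝ) ∈ segment ℝ (P w) (P x) := F.mem_wx (by linarith) zero_le_one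
  have h0uv : ((0, 0) : ℝ × ℝ) ∈ segment ℝ (P u) (P v) := F.mem_uv (by linarith) zero_le_one
  -- a segment `wx` met by `ab` makes `a` adjacent to `x`
  have toX : a ≠ w → ¬ G.Adj b w → ∀ n ∈ segment ℝ (P a) (P b), n ∈ segment ℝ (P w) (P x) →
      G.Adj a x := by
    intro haw hbw n hn hn'
    by_cases hbx : b = x
    · exact hbx ▸ adj
    · rcases L.red adj wx haw ax bw hbx hn hn' with h | h | h | h
      · exact h.2
      · exact absurd h.1 hbw
      · exact absurd h.2.symm hbw
      · exact h.1.symm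
  -- if `b` is adjacent to `k = u` or `k = v` but not to `w`, then `bk` does not meet `wx`
  have nomeet : ¬ G.Adj b w → ∀ k, (k = u ∨ k = v) → G.Adj b k → ∀ n ∈ segment ℝ (P b) (P k),
      n ∉ segment ℝ (P w) (P x) := by
    intro hbw k hk hbk n hn hn'
    have kx : ¬ G.Adj k x ∧ k ≠ x ∧ k ≠ w := by
      rcases hk with rfl | rfl
      exacts [⟨nux, xu.symm, wu.ne'⟩, ⟨nvx, xv.symm, wv.ne'⟩]
    have hbx : b ≠ x := by rintro rfl; exact kx.1 hbk.symm
    rcases L.red hbk wx bw hbx kx.2.2 kx.2.1 hn hn' with h | h | h | h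
    · exact hbw h.1
    · exact kx.1 h.2
    · exact hbw h.1.symm
    · exact kx.1 h.2.symm
  have fst_eq : ∀ q : ℝ × ℝ, q.1 = 0 → q = (0, q.2) := fun q h => by ext <;> simp [h]
  have snd_eq : ∀ q : ℝ × ℝ, q.2 = 0 → q = (q.1, 0) := fun q h => by ext <;> simp [h]
  -- the triangle `abk` does not contain a piece of the line of `wx` from `wx` to `bk`
  have noh : ¬ G.Adj b w → ∀ k, (k = u ∨ k = v) → G.Adj b k → G.Adj a k →
      ∀ n ∈ convexHull ℝ {P a, P b, P k}, n.1 = 0 → -ξ ≤ n.2 → n.2 ≤ 1 →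
      ∀ h ∈ segment ℝ (P b) (P k), h.1 = 0 → False := by
    intro hbw k hk hbk hak n hn n1 n2 n2' h hh h1
    have hhT : h ∈ convexHull ℝ {P a, P b, P k} := hull_segment hull_corner.2.1 hull_corner.2.2 hh
    rw [fst_eq n n1] at hn
    rw [fst_eq h h1] at hhT hh
    rcases le_or_gt h.2 1 with g | g
    · rcases le_or_gt (-ξ) h.2 with g' | g'
      · exact nomeet hbw k hk hbk _ hh (F.mem_wx g' g)
      · have : P x ∈ convexHull ℝ {P a, P b, P k} := by
          rw [F.px]
          exact hull_segment hhT hn (mem_segment_vertical g'.le n2)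
        have kx : ¬ G.Adj k x ∧ x ≠ k := by
          rcases hk with rfl | rfl
          exacts [⟨nux, xu⟩, ⟨nvx, xv⟩]
        have perm : ({P a, P b, P k} : Set (ℝ × ℝ)) = {P k, P a, P b} := by
          rw [Set.insert_comm (P k), Set.pair_comm (P k)]
        rw [perm] at this
        rcases L.adj_corner hak.symm hbk.symm adj this with e | e
        · exact kx.2 e
        · exact kx.1 e
    · have : P w ∈ convexHull ℝ {P a, P b, P k} := by
        rw [F.pw]
        exact hull_segment hn hhT (mem_segment_vertical n2' g.le)
      rw [Set.insert_comm] at this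
      rcases L.adj_corner adj.symm hbk hak this with e | e
      · exact bw e.symm
      · exact hbw e
  have caseI : m.1 = 0 → 0 ≤ m.2 → (1 - t) * m.2 < c → a ≠ w ∧ ∃ y, Kill G P u v a y := by
    intro m1 m2 m2c
    have em := fst_eq m m1
    have m2q : m.2 ≤ c / (1 - t) := by rw [le_div_iff₀ t1]; linarith
    have m2' : m.2 < 1 := lt_of_mul_lt_mul_left (by linarith [C.ct'] : (1 - t) * m.2 < (1 - t) * 1) t1.le
    have hmwx : m ∈ segment ℝ (P w) (P x) := by rw [em]; exact F.mem_wx (by linarith) m2'.le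
    have haw : a ≠ w := by
      rintro rfl
      rw [mem_segment_prod, F.pw] at hmab hr'
      obtain ⟨τ, -, -, e1, e2⟩ := hmab
      obtain ⟨τ', -, -, e1', e2'⟩ := hr'
      simp only at e1 e2 e1'
      rw [m1] at e1
      rcases mul_eq_zero.1 (by linarith : τ * (P b).1 = 0) with h | h
      · rw [h] at e2; linarith
      · rw [h] at e1'; linarith
    have hbw : ¬ G.Adj b w := by
      intro hbw
      refine (noT w aw hbw).1 (hull_segment (hull_segment (A := m) ?_ hull_corner.2.2 ?_)
        (hull_segment hull_corner.1 hull_corner.2.1 hr') hzq)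
      · exact hull_segment hull_corner.1 hull_corner.2.1 hmab
      · rw [em, F.pw]
        exact mem_segment_vertical m2q q2
    have hax := toX haw hbw m hmab hmwx
    replace aw := aw.resolve_left haw
    replace au := au.resolve_left (by rintro rfl; exact nux hax)
    replace av := av.resolve_left (by rintro rfl; exact nvx hax)
    refine ⟨haw, ?_⟩
    rcases lt_or_ge 0 (P a).2 with a2 | a2
    · exact ⟨x, F.kill_of_above L hK hax aw a2⟩
    obtain ⟨ku, kv⟩ := hK.not_mem_hull L hax.symm wx.symm aw
    have between := fun s => F.axis_between (s := s) (convex_convexHull ℝ _) ku kv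
      (hull_segment hull_corner.2.2 hull_corner.1 h0wx) h0uv
    have hmT : m ∈ convexHull ℝ {P x, P a, P w} := hull_segment hull_corner.2.2 hull_corner.1 hmwx
    rcases hd with rfl | rfl
    · -- the order on the line is `a`, `m`, `r`, `b`
      have ha1 : (P d).1 < 0 := by
        rw [mem_segment_prod] at hm
        obtain ⟨τ, τ0, τ1, e1, e2⟩ := hm
        rw [m1] at e1
        by_contra h
        push Not at h
        have k1 := mul_nonneg (sub_nonneg.2 τ1) r1.le
        have k2 := mul_nonneg τ0 h
        have : τ = 1 := by
          have := (mul_eq_zero.1 (by linarith : (1 - τ) * r.1 = 0)).resolve_right r1.ne'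
          linarith
        rw [this] at e1 e2
        have ed : P d = (0, 0) := by ext <;> simp <;> linarith
        rcases hb d (ed ▸ h0uv) with h | h
        · exact au.ne h
        · exact av.ne h
      have hb1 : 0 < (P b).1 := by
        rw [mem_segment_prod] at hr'
        obtain ⟨τ, τ0, τ1, e1, e2⟩ := hr'
        by_contra h
        push Not at h
        have k1 := mul_nonneg (sub_nonneg.2 τ1) (neg_pos.2 ha1).le
        have k2 := mul_nonneg τ0 (neg_nonneg.2 h)
        linarith
      obtain ⟨s, hs, s2⟩ : ∃ s ∈ segment ℝ (P d) m, s.2 = 0 := by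
        rcases eq_or_lt_of_le m2 with h | h
        · exact ⟨m, right_mem_segment _ _ _, h.symm⟩
        · exact ⟨_, axis_mem_segment a2 h, rfl⟩
      have hsab : s ∈ segment ℝ (P d) (P b) :=
        (convex_segment _ _).segment_subset (left_mem_segment _ _ _) hmab hs
      obtain ⟨s1, s1'⟩ := between s (hull_segment hull_corner.2.1 hmT hs) s2
      have sc : s.1 ≤ c / t := by
        have : -c ≤ -t * s.1 + -(1 - t) * s.2 :=
          (convex_halfplane (-t) (-(1 - t)) (-c)).segment_subset (x := P d) (y := m)
            (by simp; linarith) (by simp [m1]; linarith) hs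
        rw [le_div_iff₀ t0]
        rw [s2] at this
        linarith
      refine ⟨b, adj, ?_, ?_, bu, bv, s, F.mem_uv_iff.2 ⟨s2, s1.le, s1'.le⟩, hsab⟩
      · intro hub
        refine (noT u (Or.inr au) hub.symm).2 (hull_segment
          (hull_segment hull_corner.1 hull_corner.2.1 hr') (hull_segment (A := s) ?_ hull_corner.2.2 ?_)
          hzq')
        · exact hull_segment hull_corner.1 hull_corner.2.1 hsab
        · rw [snd_eq s s2, F.pu]
          exact mem_segment_horizontal sc q1
      · intro hvb
        have hh := axis_mem_segment' (A := P v) (B := P b) (by rw [F.pv]; simp; linarith) hb1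
        rw [segment_symm] at hh
        exact noh hbw v (Or.inr rfl) hvb.symm av m (hull_segment hull_corner.1 hull_corner.2.1 hmab) m1
          (by linarith) m2'.le _ hh rfl
    · -- the order on the line is `a`, `r`, `m`, `b`
      have hb1 : (P d).1 < 0 := by
        rw [mem_segment_prod] at hm
        obtain ⟨τ, τ0, τ1, e1, e2⟩ := hm
        rw [m1] at e1
        by_contra h
        push Not at h
        have k1 := mul_nonneg (sub_nonneg.2 τ1) r1.le
        have k2 := mul_nonneg τ0 h
        have : τ = 1 := by
          have := (mul_eq_zero.1 (by linarith : (1 - τ) * r.1 = 0)).resolve_right r1.ne'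
          linarith
        rw [this] at e1 e2
        have ed : m = P d := by ext <;> linarith
        rw [ed] at hmwx m2
        refine hbw (L.onseg wx hmwx bw ?_).1.symm
        rintro rfl
        rw [F.px] at m2
        simp only at m2
        linarith
      have hrm : r ∈ segment ℝ (P a) m := mem_segment_of_mem hr' hm
      have hs := axis_mem_segment a2 r2
      set s1 := ((P a).1 * r.2 - (P a).2 * r.1) / (r.2 - (P a).2)
      have hsab : (s1, 0) ∈ segment ℝ (P a) (P d) :=
        (convex_segment _ _).segment_subset (left_mem_segment _ _ _) hr' hs
      obtain ⟨b1, b2⟩ := between (s1, 0) (hull_segment hull_corner.2.1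
        (hull_segment hull_corner.2.1 hmT hrm) hs) rfl
      simp only at b1 b2
      have hac : c ≤ t * (P a).1 + (1 - t) * (P a).2 := by
        rw [mem_segment_prod] at hr'
        obtain ⟨τ, τ0, τ1, e1, e2⟩ := hr'
        rw [e1, e2] at hrc
        by_contra h
        push Not at h
        have k1 := mul_nonneg τ0 (sub_pos.2 hdc).le
        have k2 := mul_nonneg (sub_nonneg.2 τ1) (sub_pos.2 h).le
        rcases eq_or_lt_of_le τ0 with h0 | h0
        · rw [← h0] at hrc; linarith
        · have := mul_pos h0 (sub_pos.2 hdc)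
          linarith
      have sc : c / t ≤ s1 := by
        have : c ≤ t * s1 + (1 - t) * 0 :=
          (convex_halfplane t (1 - t) c).segment_subset hac hrc.ge hs
        rw [div_le_iff₀ t0]
        linarith
      refine ⟨d, adj, ?_, ?_, bu, bv, _, F.mem_uv_iff.2 ⟨rfl, b1.le, b2.le⟩, hsab⟩
      · intro hub
        have hh := axis_mem_segment' (A := P d) (B := P u) hb1.le (by rw [F.pu]; simp)
        exact noh hbw u (Or.inl rfl) hub.symm au m (hull_segment hull_corner.1 hull_corner.2.1 hmab) m1
          (by linarith) m2'.le _ hh rfl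
      · intro hvb
        refine (noT v (Or.inr av) hvb.symm).2 (hull_segment
          (hull_segment hull_corner.1 hull_corner.2.1 hr')
          (hull_segment (B := (s1, 0)) hull_corner.2.2 ?_ ?_) hzq')
        · exact hull_segment hull_corner.1 hull_corner.2.1 hsab
        · rw [F.pv]
          exact mem_segment_horizontal (by linarith) sc
  rcases hm' with ⟨m2, m1, m1c⟩ | ⟨m1, m2, m2c⟩
  swap
  · obtain ⟨h1, h2⟩ := caseI m1 m2 m2c
    exact ⟨h2, fun h => absurd h h1⟩
  rcases eq_or_lt_of_le m1 with m0 | m0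
  · obtain ⟨h1, h2⟩ := caseI m0.symm m2.ge (by rw [m2]; linarith)
    exact ⟨h2, fun h => absurd h h1⟩
  -- now `ab` meets `uv` in the point `m` between the origin and `u`
  have em := snd_eq m m2
  have m1q : m.1 ≤ c / t := by rw [le_div_iff₀ t0]; linarith
  have m1' : m.1 < 1 := lt_of_mul_lt_mul_left (by linarith [C.ct] : t * m.1 < t * 1) t0.le
  have hmuv : m ∈ segment ℝ (P u) (P v) := by rw [em]; exact F.mem_uv (by linarith) m1'.le
  have hab2 : (P a).2 ≠ 0 ∧ (P b).2 ≠ 0 ∧ a ≠ u ∧ a ≠ v := by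
    have hr2 := hr'
    rw [mem_segment_prod] at hr2
    obtain ⟨τ', τ0', τ1', e1', e2'⟩ := hr2
    have hne : ¬ ((P a).2 = 0 ∧ (P b).2 = 0) := by
      rintro ⟨h1, h2⟩
      rw [h1, h2] at e2'
      linarith
    have hmab' := hmab
    rw [mem_segment_prod] at hmab'
    obtain ⟨τ, τ0, τ1, e1, e2⟩ := hmab'
    rw [m2] at e2
    have hma : (P a).2 = 0 → m = P a := by
      intro h
      rw [h] at e2
      have : τ = 0 := (mul_eq_zero.1 (by linarith : τ * (P b).2 = 0)).resolve_right
        fun h' => hne ⟨h, h'⟩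
      rw [this] at e1
      ext <;> linarith
    have hmb : (P b).2 = 0 → m = P b := by
      intro h
      rw [h] at e2
      have : 1 - τ = 0 := (mul_eq_zero.1 (by linarith : (1 - τ) * (P a).2 = 0)).resolve_right
        fun h' => hne ⟨h', h⟩
      rw [this, (by linarith : τ = 1)] at e1
      ext <;> linarith
    have au' : a ≠ u := by
      rintro rfl
      have := hma (by rw [F.pu])
      rw [this, F.pu] at m1'
      simp at m1'
    have av' : a ≠ v := by
      rintro rfl
      have := hma (by rw [F.pv])
      rw [this, F.pv] at m1
      simp only at m1
      linarith
    refine ⟨fun h => ?_, fun h => ?_, au', av'⟩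
    · rcases hb a (hma h ▸ hmuv) with h | h
      exacts [au' h, av' h]
    · rcases hb b (hmb h ▸ hmuv) with h | h
      exacts [bu h, bv h]
  obtain ⟨a2, b2, au', av'⟩ := hab2
  replace au := au.resolve_left au'
  replace av := av.resolve_left av'
  have hbu : ¬ G.Adj b u := by
    intro hbu
    refine (noT u (Or.inr au) hbu).2 (hull_segment (hull_segment hull_corner.1 hull_corner.2.1 hr')
      (hull_segment (A := m) ?_ hull_corner.2.2 ?_) hzq')
    · exact hull_segment hull_corner.1 hull_corner.2.1 hmab
    · rw [em, F.pu]
      exact mem_segment_horizontal m1q q1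
  by_cases hbv : G.Adj b v
  swap
  · have hkill : Kill G P u v a b :=
      ⟨adj, fun h => hbu h.symm, fun h => hbv h.symm, bu, bv, m, hmuv, hmab⟩
    refine ⟨⟨b, hkill⟩, ?_⟩
    rintro rfl
    exact ⟨hkill, m.1, m0, m1', em ▸ hmab⟩
  -- the case that `b` is adjacent to `v`
  have h0T : ((0, 0) : ℝ × ℝ) ∈ convexHull ℝ {P a, P b, P v} := by
    refine hull_segment (A := P v) (B := m) hull_corner.2.2
      (hull_segment hull_corner.1 hull_corner.2.1 hmab) ?_
    rw [em, F.pv]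
    exact mem_segment_horizontal (by linarith) m0.le
  have hrT : r ∈ convexHull ℝ {P a, P b, P v} := hull_segment hull_corner.1 hull_corner.2.1 hr'
  have hbw : ¬ G.Adj b w := by
    intro hbw
    have hq : ((0, c / (1 - t)) : ℝ × ℝ) ∈ segment ℝ (0, 0) (P w) := by
      rw [F.pw]; exact mem_segment_vertical q2'.le q2
    rcases aw with rfl | aw
    · exact (noT v (Or.inr av) hbv).1 (hull_segment (hull_segment h0T hull_corner.1 hq) hrT hzq)
    · have hsub : convexHull ℝ {P a, P b, P v} ⊆ convexHull ℝ {P b, P a, P v, P w} := by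
        apply convexHull_mono
        rintro q (rfl | rfl | rfl) <;> simp
      have hzF : P z ∈ convexHull ℝ {P b, P a, P v, P w} :=
        hull_segment (hull_segment (hsub h0T) (subset_convexHull _ _ (by simp)) hq) (hsub hrT) hzq
      rcases L.adj_fan adj.symm hbv hbw av aw wv.symm hzF with h | h
      · exact bz h.symm
      · exact nzb h.symm
  have haw : a ≠ w := by rintro rfl; exact hbw adj.symm
  refine ⟨?_, fun h => absurd h haw⟩
  replace aw := aw.resolve_left haw
  have noh' := noh hbw v (Or.inr rfl) hbv av (0, 0) h0T rfl (by simpa using hξ.le) (by simp)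
  rcases lt_or_ge (P b).1 0 with hb1 | hb1
  swap
  · exfalso
    rcases eq_or_lt_of_le hb1 with h | h
    · exact noh' (P b) (left_mem_segment _ _ _) h.symm
    · have hh := axis_mem_segment' (A := P v) (B := P b) (by rw [F.pv]; simp; linarith) h
      rw [segment_symm] at hh
      exact noh' _ hh rfl
  rcases lt_or_gt_of_ne a2 with ha2 | ha2
  · exfalso
    have hb2 : 0 < (P b).2 := by
      rw [mem_segment_prod] at hr'
      obtain ⟨τ, τ0, τ1, e1, e2⟩ := hr'
      by_contra h
      push Not at h
      have k1 := mul_nonneg (sub_nonneg.2 τ1) (neg_pos.2 ha2).le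
      have k2 := mul_nonneg τ0 (neg_nonneg.2 h)
      linarith
    have hac : t * (P a).1 + (1 - t) * (P a).2 < c := by
      rcases hd with rfl | rfl
      · exact hdc
      · exfalso
        rw [mem_segment_prod] at hm
        obtain ⟨τ, τ0, τ1, e1, e2⟩ := hm
        rw [m2] at e2
        have k1 := mul_nonneg (sub_nonneg.2 τ1) r2.le
        have k2 := mul_nonneg τ0 hb2.le
        have := (mul_eq_zero.1 (by linarith : (1 - τ) * r.2 = 0)).resolve_right r2.ne'
        have := (mul_eq_zero.1 (by linarith : τ * (P d).2 = 0)).resolve_right hb2.ne'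
        linarith
    have hbc : c ≤ t * (P b).1 + (1 - t) * (P b).2 := by
      rw [mem_segment_prod] at hr'
      obtain ⟨τ, τ0, τ1, e1, e2⟩ := hr'
      rw [e1, e2] at hrc
      by_contra h
      push Not at h
      have k1 := mul_nonneg τ0 (sub_pos.2 h).le
      have k2 := mul_nonneg (sub_nonneg.2 τ1) (sub_pos.2 hac).le
      rcases eq_or_lt_of_le τ0 with h0 | h0
      · rw [← h0] at hrc; linarith
      · have := mul_pos h0 (sub_pos.2 h)
        linarith
    have hh := axis_mem_segment' hb1.le r1
    set h2 := ((P b).2 * r.1 - (P b).1 * r.2) / (r.1 - (P b).1)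
    have hc : c / (1 - t) ≤ h2 := by
      have : c ≤ t * 0 + (1 - t) * h2 := (convex_halfplane t (1 - t) c).segment_subset hbc hrc.ge hh
      rw [div_le_iff₀ t1]
      linarith
    refine (noT v (Or.inr av) hbv).1 (hull_segment (hull_segment h0T
      (hull_segment hull_corner.2.1 hrT hh) ?_) hrT hzq)
    exact mem_segment_vertical q2'.le hc
  · have hb2 : (P b).2 < 0 := by
      have hmab' := hmab
      rw [mem_segment_prod] at hmab'
      obtain ⟨τ, τ0, τ1, e1, e2⟩ := hmab'
      by_contra h
      push Not at h
      have k1 := mul_nonneg (sub_nonneg.2 τ1) ha2.le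
      have k2 := mul_nonneg τ0 h
      have := (mul_eq_zero.1 (by linarith : (1 - τ) * (P a).2 = 0)).resolve_right a2
      have := (mul_eq_zero.1 (by linarith : τ * (P b).2 = 0)).resolve_right b2
      linarith
    have hh := axis_mem_segment' hb1.le m0
    set h2 := ((P b).2 * m.1 - (P b).1 * m.2) / (m.1 - (P b).1) with hh2
    have hhab : ((0, h2) : ℝ × ℝ) ∈ segment ℝ (P a) (P b) :=
      (convex_segment _ _).segment_subset (right_mem_segment _ _ _) hmab hh
    have h20 : h2 ≤ 0 := by
      rw [hh2, m2]
      exact div_nonpos_of_nonpos_of_nonneg (by nlinarith) (by linarith)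
    rcases le_or_gt (-ξ) h2 with g | g
    · have hax := toX haw hbw _ hhab (F.mem_wx g (by linarith))
      exact ⟨x, F.kill_of_above L hK hax aw ha2⟩
    · exfalso
      have : P x ∈ convexHull ℝ {P a, P b, P v} := by
        rw [F.px]
        exact hull_segment (hull_segment hull_corner.1 hull_corner.2.1 hhab) h0T
          (mem_segment_vertical g.le (by linarith))
      have perm : ({P a, P b, P v} : Set (ℝ × ℝ)) = {P v, P a, P b} := by
        rw [Set.insert_comm (P v), Set.pair_comm (P v)]
      rw [perm] at this
      rcases L.adj_corner av.symm hbv.symm adj this with e | e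
      · exact xv e
      · exact nvx e

end PlanarCP

/-! ### Killers seen from the killed edge -/

namespace PlanarCP

variable {V : Type*} {G H : SimpleGraph V} {P : V → ℝ × ℝ}

/-- A segment that leaves the intersection of three open half-planes does so through one of the
three lines. -/
theorem exists_first_exit {x y : Fin 3 → ℝ} (hx : ∀ i, 0 < x i) (hy : ∃ i, y i ≤ 0) :
    ∃ t, 0 ≤ t ∧ t ≤ 1 ∧ (∀ i, 0 ≤ (1 - t) * x i + t * y i) ∧ ∃ i, (1 - t) * x i + t * y i = 0 := by
  let g : ℝ → ℝ := fun t => Finset.univ.inf' ⟨(0 : Fin 3), Finset.mem_univ _⟩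
    fun i => (1 - t) * x i + t * y i
  have hg : Continuous g := Continuous.finset_inf'_apply _ fun i _ => by fun_prop
  have g0 : 0 ≤ g 0 := by
    refine (Finset.le_inf'_iff _ _).2 fun i _ => ?_
    simpa using (hx i).le
  have g1 : g 1 ≤ 0 := by
    obtain ⟨i, hi⟩ := hy
    exact (Finset.inf'_le _ (Finset.mem_univ i)).trans (by simpa using hi)
  obtain ⟨t, ht, hgt⟩ : ∃ t ∈ Set.Icc (0 : ℝ) 1, g t = 0 :=
    intermediate_value_Icc' zero_le_one hg.continuousOn ⟨g1, g0⟩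
  refine ⟨t, ht.1, ht.2, fun i => ?_, ?_⟩
  · rw [← hgt]
    exact Finset.inf'_le _ (Finset.mem_univ i)
  · obtain ⟨i, -, hi⟩ := Finset.exists_mem_eq_inf' (s := Finset.univ) ⟨(0 : Fin 3), Finset.mem_univ _⟩
      fun i => (1 - t) * x i + t * y i
    exact ⟨i, hi.symm.trans hgt⟩

/-- Let an edge `aa'` of the plane subgraph cross `wb` between `w` and `uv`, closest to `uv`, where
`ab` kills `uv`. Among the vertices above `uv` in the triangle of `a`, `b` and the crossing point, take
the one that is seen from `b` closest to `w`, and of several such vertices the one closest to `b`.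
From `uv`, the view of this killer along its edge to `b` is not blocked by the plane subgraph. -/
theorem Frame.exists_clear_side [Finite V] (L : Layout G P) (S : PlaneSubgraph G H P)
    {u v w b : V} {ν η : ℝ} (F : Frame P u v w b ν η) (hb : Bare P u v) (hun : Uncrossed H P u v)
    (hK : Kill G P u v w b) {a a' : V} {μ s : ℝ} (haa : H.Adj a a')
    (hm : ((0, μ) : ℝ × ℝ) ∈ segment ℝ (P a) (P a')) (hma' : (0, μ) ≠ P a') (hμ : 0 < μ) (hμ1 : μ ≤ 1)
    (hs : s = 1 ∨ s = -1) (ha1 : 0 < s * (P a).1) (ha : Kill G P u v a b)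
    (hT : ∀ t, P t ∈ convexHull ℝ {P a, (0, μ), P b} → t = b ∨ G.Adj b t)
    (hlow : ∀ c d, H.Adj c d → ∀ k, ((0, k) : ℝ × ℝ) ∈ segment ℝ (P c) (P d) → 0 ≤ k → k ≤ μ → μ ≤ k)
    (hver : ∀ t, (P t).1 = 0 → 0 < (P t).2 → (P t).2 ≤ μ → False) :
    ∃ y, Kill G P u v y b ∧ 0 < s * (P y).1 ∧
      s * (P y).1 * (η + (P a).2) ≤ s * (P a).1 * (η + (P y).2) ∧
      Clear H P y ((P y).1 * η / (η + (P y).2), 0) := by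
  have hη := F.hξ
  have hss : s * s = 1 := by rcases hs with rfl | rfl <;> norm_num
  have hs0 : s ≠ 0 := by rintro rfl; norm_num at hss
  obtain ⟨hab, nub, nvb, bu, bv, -⟩ := id hK
  have K := fun d => F.kill_iff (a := d) hb hK
  obtain ⟨-, hac, ha2⟩ := (K a).1 ha
  have hTc : convexHull ℝ {P a, (0, μ), P b} ⊆ cone ν η := by
    refine convexHull_min ?_ (convex_cone ν η)
    have hwc : P w ∈ cone ν η := ((K w).1 hK).2.1
    rintro q (rfl | rfl | rfl)
    · exact hac
    · exact (convex_cone ν η).segment_subset hwc F.cone_x (F.mem_wx (by linarith) hμ1)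
    · exact F.cone_x
  have hu : P u ∉ convexHull ℝ {P a, (0, μ), P b} := fun h =>
    (hT u h).elim bu.symm fun h => nub h.symm
  have hv : P v ∉ convexHull ℝ {P a, (0, μ), P b} := fun h =>
    (hT v h).elim bv.symm fun h => nvb h.symm
  -- weights in the triangle
  have hTmem : ∀ q : ℝ × ℝ, 0 ≤ s * q.1 →
      (q.2 - μ) * (s * (P a).1) - s * q.1 * ((P a).2 - μ) ≤ 0 →
      s * q.1 * (η + (P a).2) ≤ s * (P a).1 * (η + q.2) → q ∈ convexHull ℝ {P a, (0, μ), P b} := by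
    intro q h1 h2 h3
    have hA : s * (P a).1 ≠ 0 := ha1.ne'
    have hmη : η + μ ≠ 0 := by linarith
    have hden : 0 < s * (P a).1 * (η + μ) := mul_pos ha1 (by linarith)
    have hA1 : (P a).1 ≠ 0 := by rintro h; rw [h] at ha1; simp at ha1
    rw [mem_hull3]
    refine ⟨s * q.1 / (s * (P a).1), (s * (P a).1 * (η + q.2) - s * q.1 * (η + (P a).2)) /
      (s * (P a).1 * (η + μ)), -((q.2 - μ) * (s * (P a).1) - s * q.1 * ((P a).2 - μ)) /
      (s * (P a).1 * (η + μ)), div_nonneg h1 ha1.le, div_nonneg (by linarith) hden.le,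
      div_nonneg (by linarith) hden.le, ?_, ?_, ?_⟩
    · field_simp; ring
    · rw [F.px]; simp; field_simp
    · rw [F.px]; simp only; field_simp; ring
  have hTineq : ∀ q ∈ convexHull ℝ {P a, (0, μ), P b}, 0 ≤ s * q.1 ∧
      (q.2 - μ) * (s * (P a).1) - s * q.1 * ((P a).2 - μ) ≤ 0 ∧
      s * q.1 * (η + (P a).2) ≤ s * (P a).1 * (η + q.2) := by
    intro q hq
    rw [mem_hull3] at hq
    obtain ⟨x, y, z, hx, hy, hz, hxyz, e1, e2⟩ := hq
    rw [F.px] at e1 e2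
    simp only at e1 e2
    have k1 := mul_nonneg hx ha1.le
    have k2 := mul_nonneg hz (mul_nonneg ha1.le (by linarith : 0 ≤ η + μ))
    have k3 := mul_nonneg hy (mul_nonneg ha1.le (by linarith : 0 ≤ η + μ))
    have hy' : y = 1 - x - z := by linarith
    rw [e1, e2]
    refine ⟨by linarith, ?_, ?_⟩
    · rw [hy']; linarith
    · rw [(by linarith : z = 1 - x - y)]; linarith
  have ha'T : P a ∈ convexHull ℝ {P a, (0, μ), P b} := hull_corner.1
  have hposden : ∀ t : V, 0 < (P t).2 → 0 < η + (P t).2 := fun t ht => by linarith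
  -- the choice of `y`
  let Y : Set V := {t | P t ∈ convexHull ℝ {P a, (0, μ), P b} ∧ 0 < (P t).2}
  obtain ⟨y₀, hy₀, hmin₀⟩ := Set.exists_min_image Y (fun t => s * (P t).1 / (η + (P t).2))
    (Set.toFinite _) ⟨a, ha'T, ha2⟩
  obtain ⟨y, ⟨hy, hyeq⟩, hmin⟩ := Set.exists_min_image
    {t ∈ Y | s * (P t).1 / (η + (P t).2) = s * (P y₀).1 / (η + (P y₀).2)} (fun t => (P t).2)
    (Set.toFinite _) ⟨y₀, hy₀, rfl⟩
  obtain ⟨hyT, hy2⟩ := hy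
  obtain ⟨hy1, hyf, hya⟩ := hTineq _ hyT
  have hyη := hposden y hy2
  have hy1' : 0 < s * (P y).1 := by
    refine lt_of_le_of_ne hy1 fun h => ?_
    have h1 : (P y).1 = 0 := (mul_eq_zero.1 h.symm).resolve_left hs0
    refine hver y h1 hy2 ?_
    rw [h1] at hyf
    have : ((P y).2 - μ) * (s * (P a).1) ≤ 0 := by linarith
    nlinarith
  have hYmin : ∀ t ∈ Y, s * (P y).1 * (η + (P t).2) ≤ s * (P t).1 * (η + (P y).2) := by
    intro t ht
    have := hmin₀ t ht
    rw [← hyeq, div_le_div_iff₀ hyη (hposden t ht.2)] at this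
    exact this
  have hYmin' : ∀ t ∈ Y, s * (P t).1 * (η + (P y).2) = s * (P y).1 * (η + (P t).2) →
      (P y).2 ≤ (P t).2 := by
    intro t ht h
    refine hmin t ⟨ht, ?_⟩
    rw [← hyeq, div_eq_div_iff (hposden t ht.2).ne' hyη.ne']
    exact h
  have hyb : G.Adj y b := by
    rcases hT y hyT with rfl | h
    · rw [F.px] at hy2
      simp only at hy2
      linarith
    · exact h.symm
  refine ⟨y, (K y).2 ⟨hyb, hTc hyT, hy2⟩, hy1', hYmin a ⟨ha'T, ha2⟩, ?_⟩
  -- an edge of the plane subgraph that blocks the view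
  intro c d hcd n hn hny
  by_contra hne
  set π := (P y).1 * η / (η + (P y).2) with hπ
  have hπy : π * (η + (P y).2) = (P y).1 * η := by rw [hπ]; field_simp
  have hπb : ((π, 0) : ℝ × ℝ) ∈ segment ℝ (P y) (P b) := by
    rw [mem_segment_prod, F.px]
    refine ⟨(P y).2 / (η + (P y).2), div_nonneg hy2.le hyη.le, (div_le_one hyη).2 (by linarith), ?_, ?_⟩
    · rw [hπ]; field_simp; ring
    · simp only; field_simp; ring
  have hnT : n ∈ convexHull ℝ {P a, (0, μ), P b} :=
    hull_segment hyT (hull_segment hyT hull_corner.2.2 hπb) hny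
  obtain ⟨hn1, hnf, hna⟩ := hTineq n hnT
  obtain ⟨hn2, hn2', hnφ⟩ : 0 ≤ n.2 ∧ n.2 < (P y).2 ∧
      s * n.1 * (η + (P y).2) = s * (P y).1 * (η + n.2) := by
    rw [mem_segment_prod] at hny
    obtain ⟨τ, τ0, τ1, e1, e2⟩ := hny
    simp only at e1 e2
    have hτ : 0 < τ := by
      rcases eq_or_lt_of_le τ0 with h | h
      · exact absurd (by ext <;> simp [e1, e2, ← h]) hne
      · exact h
    have := mul_pos hτ hy2
    refine ⟨?_, by linarith, ?_⟩
    · rw [e2]; have := mul_nonneg (sub_nonneg.2 τ1) hy2.le; linarith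
    · rw [e1, e2]
      linear_combination s * τ * hπy
  have nocross : ∀ k ∈ segment ℝ (P c) (P d), k ∈ convexHull ℝ {P a, (0, μ), P b} → k.2 ≠ 0 := by
    intro k hk hkT hk2
    exact hun c d hcd ⟨k, hk, F.cone_axis (hTc hkT) hk2, fun h => hu (h ▸ hkT), fun h => hv (h ▸ hkT)⟩
  replace hn2 : 0 < n.2 := lt_of_le_of_ne hn2 (nocross n hn hnT).symm
  have hn1' : 0 < s * n.1 := by
    have : 0 < s * (P y).1 * (η + n.2) := mul_pos hy1' (by linarith)
    rw [← hnφ] at this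
    exact (mul_pos_iff_of_pos_right hyη).1 this
  have noend : ∀ e, n ≠ P e := by
    rintro e rfl
    exact absurd (hYmin' e ⟨hnT, hn2⟩ hnφ) (not_le.2 hn2')
  -- the point `n` is strictly below the line of `aa'`
  have hnf' : (n.2 - μ) * (s * (P a).1) - s * n.1 * ((P a).2 - μ) < 0 := by
    have hden : 0 < s * (P a).1 * (η + μ) := mul_pos ha1 (by linarith)
    have hρ : (η + n.2) / (η + (P y).2) * (η + (P y).2) = η + n.2 := by field_simp
    have hρ' : s * n.1 = (η + n.2) / (η + (P y).2) * (s * (P y).1) := by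
      rw [div_mul_eq_mul_div, eq_div_iff hyη.ne', hnφ]
      ring
    have h1 : (n.2 - μ) * (s * (P a).1) - s * n.1 * ((P a).2 - μ) =
        (η + n.2) / (η + (P y).2) * (((P y).2 - μ) * (s * (P a).1) - s * (P y).1 * ((P a).2 - μ)) -
        (1 - (η + n.2) / (η + (P y).2)) * (s * (P a).1 * (η + μ)) := by
      linear_combination -(s * (P a).1) * hρ - ((P a).2 - μ) * hρ'
    have h2 : (η + n.2) / (η + (P y).2) < 1 := (div_lt_one hyη).2 (by linarith)
    have h3 : 0 ≤ (η + n.2) / (η + (P y).2) := div_nonneg (by linarith) hyη.le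
    have h4 := mul_pos (sub_pos.2 h2) hden
    have h5 := mul_nonneg h3 (neg_nonneg.2 hyf)
    rw [h1]
    linarith
  -- the end `e` of `cd` on the side of `w`, or closer to `b` if `cd` is on the line `yb`
  have main : ∀ e e', H.Adj e e' → n ∈ segment ℝ (P e) (P e') →
      s * (P e).1 * (η + (P y).2) ≤ s * (P y).1 * (η + (P e).2) →
      (s * (P e).1 * (η + (P y).2) = s * (P y).1 * (η + (P e).2) → (P e).2 < (P y).2) →
      (∀ k ∈ segment ℝ (P e) (P e'), k ∈ convexHull ℝ {P a, (0, μ), P b} → k.2 ≠ 0) → False := by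
    intro e e' hee hne' he he' nocross
    have heY : e ∉ Y := by
      intro heY
      have heq := le_antisymm he (hYmin e heY)
      exact absurd (hYmin' e heY heq) (not_le.2 (he' heq))
    -- points above `uv` seen from `b` between `w` and `y` and below the line of `aa'`
    have inT : ∀ q : ℝ × ℝ, 0 ≤ s * q.1 → 0 ≤ q.2 →
        (q.2 - μ) * (s * (P a).1) - s * q.1 * ((P a).2 - μ) ≤ 0 →
        s * q.1 * (η + (P y).2) ≤ s * (P y).1 * (η + q.2) → q ∈ convexHull ℝ {P a, (0, μ), P b} := by
      intro q h1 h2 h3 h4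
      refine hTmem q h1 h3 (le_of_mul_le_mul_right ?_ hyη)
      have k1 := mul_le_mul_of_nonneg_right h4 (by linarith : 0 ≤ η + (P a).2)
      have k2 := mul_le_mul_of_nonneg_right hya (by linarith : 0 ≤ η + q.2)
      linarith
    obtain ⟨τ, τ0, τ1, hall, i, hi⟩ := exists_first_exit
      (x := ![s * n.1, n.2, -((n.2 - μ) * (s * (P a).1) - s * n.1 * ((P a).2 - μ))])
      (y := ![s * (P e).1, (P e).2,
        -(((P e).2 - μ) * (s * (P a).1) - s * (P e).1 * ((P a).2 - μ))])
      (by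
        intro i
        fin_cases i
        exacts [hn1', hn2, neg_pos.2 hnf'])
      (by
        by_contra hcon
        push Not at hcon
        have h1 : 0 < s * (P e).1 := hcon 0
        have h2 : 0 < (P e).2 := hcon 1
        have h3 : 0 < -(((P e).2 - μ) * (s * (P a).1) - s * (P e).1 * ((P a).2 - μ)) := hcon 2
        exact heY ⟨inT _ h1.le h2.le (by linarith) he, h2⟩)
    set k : ℝ × ℝ := ((1 - τ) * n.1 + τ * (P e).1, (1 - τ) * n.2 + τ * (P e).2) with hk
    have k0 : 0 ≤ (1 - τ) * (s * n.1) + τ * (s * (P e).1) := hall 0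
    have k1 : 0 ≤ (1 - τ) * n.2 + τ * (P e).2 := hall 1
    have k2 : 0 ≤ (1 - τ) * -((n.2 - μ) * (s * (P a).1) - s * n.1 * ((P a).2 - μ)) +
      τ * -(((P e).2 - μ) * (s * (P a).1) - s * (P e).1 * ((P a).2 - μ)) := hall 2
    have hkn : k ∈ segment ℝ n (P e) := mem_segment_prod.2 ⟨τ, τ0, τ1, rfl, rfl⟩
    have hkee : k ∈ segment ℝ (P e) (P e') :=
      (convex_segment _ _).segment_subset hne' (left_mem_segment _ _ _) hkn
    have hk1 : 0 ≤ s * k.1 := by simp only [hk]; linarith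
    have hkf : (k.2 - μ) * (s * (P a).1) - s * k.1 * ((P a).2 - μ) ≤ 0 := by
      simp only [hk]; linarith
    have hkφ : s * k.1 * (η + (P y).2) ≤ s * (P y).1 * (η + k.2) := by
      have := mul_le_mul_of_nonneg_left he τ0
      simp only [hk]
      linear_combination this + (1 - τ) * hnφ
    have hkT : k ∈ convexHull ℝ {P a, (0, μ), P b} := inT k hk1 k1 hkf hkφ
    have hk2 : 0 < k.2 := lt_of_le_of_ne k1 (nocross k hkee hkT).symm
    -- the exit is not through the edge `aa'`
    have hkf0 : (k.2 - μ) * (s * (P a).1) - s * k.1 * ((P a).2 - μ) ≠ 0 := by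
      intro hkf0
      have hkam : k ∈ segment ℝ ((0, μ) : ℝ × ℝ) (P a) := by
        have hA : s * (P a).1 ≠ 0 := ha1.ne'
        have hA1 : (P a).1 ≠ 0 := by rintro h; rw [h] at ha1; simp at ha1
        rw [mem_segment_prod]
        refine ⟨s * k.1 / (s * (P a).1), div_nonneg hk1 ha1.le, (div_le_one ha1).2 ?_, ?_, ?_⟩
        · obtain ⟨-, -, h3⟩ := hTineq k hkT
          have h4 : (η + μ) * (s * k.1) ≤ (η + μ) * (s * (P a).1) := by linarith
          exact le_of_mul_le_mul_left h4 (by linarith)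
        · simp only; field_simp; ring
        · simp only
          apply mul_left_cancel₀ hA
          have : s * k.1 / (s * (P a).1) * (s * (P a).1) = s * k.1 := by field_simp
          linear_combination hkf0 - ((P a).2 - μ) * this
      have hkaa : k ∈ segment ℝ (P a) (P a') :=
        (convex_segment _ _).segment_subset hm (left_mem_segment _ _ _) hkam
      have hne2 : s(e, e') ≠ s(a, a') := by
        intro h
        have line : ∀ q ∈ segment ℝ (P a) (P a'),
            (q.2 - μ) * (s * (P a).1) - s * q.1 * ((P a).2 - μ) = 0 := by
          have hm' := hm
          rw [mem_segment_prod] at hm'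
          obtain ⟨ρ, ρ0, ρ1, f1, f2⟩ := hm'
          simp only at f1 f2
          intro q hq
          rw [mem_segment_prod] at hq
          obtain ⟨θ, θ0, θ1, g1, g2⟩ := hq
          have hρ : ρ ≠ 0 := by
            rintro rfl
            have : (P a).1 = 0 := by linarith
            rw [this] at ha1
            simp at ha1
          apply mul_left_cancel₀ hρ
          rw [g1, g2]
          linear_combination θ * (s * (P a).1 * (-f2) + s * ((P a).2 - μ) * f1)
        have : n ∈ segment ℝ (P a) (P a') := by
          rcases Sym2.eq_iff.1 h with ⟨rfl, rfl⟩ | ⟨rfl, rfl⟩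
          · exact hne'
          · rwa [segment_symm]
        exact hnf'.ne (line n this)
      obtain ⟨h1, h2⟩ := S.plane hee haa hne2 hkee hkaa
      have hke : k = P e := by
        refine h1.resolve_right fun h => ?_
        rw [segment_symm, h] at hkn
        exact noend e' (segment_antisymm hne' hkn)
      have hka : k = P a := by
        refine h2.resolve_right fun h => ?_
        rw [h, segment_symm] at hkam
        exact hma' (segment_antisymm hm hkam)
      have : e = a := L.inj (hke.symm.trans hka)
      exact heY (this ▸ ⟨ha'T, ha2⟩)
    fin_cases i
    · have h0 : (1 - τ) * (s * n.1) + τ * (s * (P e).1) = 0 := hi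
      have hk10 : k.1 = 0 := by
        refine (mul_eq_zero.1 (?_ : s * k.1 = 0)).resolve_left hs0
        simp only [hk]; linarith
      have ek : k = (0, k.2) := by ext <;> simp [hk10]
      rw [hk10] at hkf
      have hkμ : k.2 ≤ μ := by
        have : (k.2 - μ) * (s * (P a).1) ≤ 0 := by linarith
        by_contra h
        push Not at h
        have := mul_pos (sub_pos.2 h) ha1
        linarith
      have := hlow e e' hee k.2 (ek ▸ hkee) hk2.le hkμ
      apply hkf0
      rw [hk10, le_antisymm hkμ this]
      ring
    · exact hk2.ne' hi
    · have h0 : (1 - τ) * -((n.2 - μ) * (s * (P a).1) - s * n.1 * ((P a).2 - μ)) +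
        τ * -(((P e).2 - μ) * (s * (P a).1) - s * (P e).1 * ((P a).2 - μ)) = 0 := hi
      apply hkf0
      simp only [hk]
      linarith
  have hn' : n ∈ segment ℝ (P d) (P c) := by rwa [segment_symm]
  have nocross' : ∀ k ∈ segment ℝ (P d) (P c), k ∈ convexHull ℝ {P a, (0, μ), P b} → k.2 ≠ 0 := by
    rwa [segment_symm]
  have hcomb := hn
  rw [mem_segment_prod] at hcomb
  obtain ⟨θ, θ0, θ1, g1, g2⟩ := hcomb
  have θ0' : 0 < θ := by
    rcases eq_or_lt_of_le θ0 with h | h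
    · exact absurd (by ext <;> simp [g1, g2, ← h]) (noend c)
    · exact h
  have θ1' : 0 < 1 - θ := by
    rcases eq_or_lt_of_le θ1 with h | h
    · exact absurd (by ext <;> simp [g1, g2, h]) (noend d)
    · linarith
  have hsum : (1 - θ) * (s * (P c).1 * (η + (P y).2) - s * (P y).1 * (η + (P c).2)) +
      θ * (s * (P d).1 * (η + (P y).2) - s * (P y).1 * (η + (P d).2)) = 0 := by
    rw [g1, g2] at hnφ
    linear_combination hnφ
  rcases lt_trichotomy (s * (P c).1 * (η + (P y).2)) (s * (P y).1 * (η + (P c).2)) with h | h | h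
  · exact main c d hcd hn h.le (fun h' => absurd h' h.ne) nocross
  · have hd : s * (P d).1 * (η + (P y).2) = s * (P y).1 * (η + (P d).2) := by
      rw [h] at hsum
      have := (mul_eq_zero.1 (by linarith : θ * (s * (P d).1 * (η + (P y).2) -
        s * (P y).1 * (η + (P d).2)) = 0)).resolve_left θ0'.ne'
      linarith
    rcases lt_or_ge (P c).2 (P y).2 with hc2 | hc2
    · exact main c d hcd hn h.le (fun _ => hc2) nocross
    · refine main d c hcd.symm hn' hd.le (fun _ => ?_) nocross'
      by_contra hd2
      push Not at hd2
      have k1 := mul_nonneg θ1'.le (sub_nonneg.2 hc2)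
      have k2 := mul_nonneg θ0'.le (sub_nonneg.2 hd2)
      linarith
  · have hd : s * (P d).1 * (η + (P y).2) < s * (P y).1 * (η + (P d).2) := by
      have k1 := mul_pos θ1' (sub_pos.2 h)
      by_contra hd
      push Not at hd
      have k2 := mul_nonneg θ0'.le (sub_nonneg.2 hd)
      linarith
    exact main d c hcd.symm hn' hd.le (fun h' => absurd h' hd.ne) nocross'

end PlanarCP

/-! ### Clear killers -/

namespace PlanarCP

variable {V : Type*} {G H : SimpleGraph V} {P : V → ℝ × ℝ}

set_option maxHeartbeats 1000000 in
/-- If `wb` kills `uv` at the origin of a frame, then some `yb` kills `uv` such that the view from `uv`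
to `y` is clear and `yb` meets `uv` on the side of `u` of the given point `p`. Here the view from `p` to
`w` has to be clear, so that no edge of the plane subgraph separates a part of `wb` from `p`, unless
`p` is beyond `v`. -/
theorem Frame.exists_clear [Finite V] (L : Layout G P) (S : PlaneSubgraph G H P)
    {u v w b : V} {ν η : ℝ} (F : Frame P u v w b ν η) (hb : Bare P u v) (hun : Uncrossed H P u v)
    (hK : Kill G P u v w b) {p : ℝ} (hp : p < 0) (hbar : Clear H P w (p, 0) ∨ p < -ν) :
    ∃ y q, Kill G P u v y b ∧ ((q, 0) : ℝ × ℝ) ∈ segment ℝ (P y) (P b) ∧ p < q ∧ -ν ≤ q ∧ q ≤ 1 ∧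
      Clear H P y (q, 0) := by
  have hη := F.hξ
  have hν := F.hν
  obtain ⟨hwb, nub, nvb, bu, bv, -⟩ := id hK
  -- the vertex `w₀` of `wb` above `uv` that is closest to `uv`
  obtain ⟨w₀, ⟨h01, h02, h03⟩, hmin⟩ := Set.exists_min_image
    {y | (P y).1 = 0 ∧ 0 < (P y).2 ∧ (P y).2 ≤ 1} (fun y => (P y).2) (Set.toFinite _)
    ⟨w, by rw [Set.mem_ofPred_eq, F.pw]; norm_num⟩
  have e0 : P w₀ = (0, (P w₀).2) := by ext <;> simp [h01]
  set ω := (P w₀).2 with hω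
  have hvert : ∀ k, -η ≤ k → k ≤ ω → ((0, k) : ℝ × ℝ) ∈ segment ℝ (P w₀) (P b) := by
    intro k h1 h2
    rw [segment_symm, e0, F.px]
    exact mem_segment_vertical h1 h2
  have h0uv : ((0, 0) : ℝ × ℝ) ∈ segment ℝ (P u) (P v) := F.mem_uv (by linarith) zero_le_one
  have h0 : ((0, 0) : ℝ × ℝ) ∈ segment ℝ (P w₀) (P b) := hvert 0 (by linarith) h02.le
  have hK₀ : Kill G P u v w₀ b := by
    refine ⟨?_, nub, nvb, bu, bv, _, h0uv, h0⟩
    by_cases h : w₀ = w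
    · exact h ▸ hwb
    · refine (L.onseg hwb (e0 ▸ F.mem_wx (by linarith) h03) h ?_).2.symm
      rintro rfl
      rw [hω, F.px] at h02
      simp only at h02
      linarith
  have huc : ∀ c d, H.Adj c d → ((0, 0) : ℝ × ℝ) ∉ segment ℝ (P c) (P d) := by
    intro c d hcd h
    refine hun c d hcd ⟨_, h, h0uv, ?_, ?_⟩
    · rw [F.pu]; simp
    · rw [F.pv]; simp; linarith
  by_cases hclear : Clear H P w₀ (0, 0)
  · exact ⟨w₀, 0, hK₀, h0, hp, by linarith, zero_le_one, hclear⟩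
  -- the lowest point of `w₀b` above `uv` on an edge of the plane subgraph
  obtain ⟨μ, hμM, hμmin⟩ : ∃ μ ∈ {k : ℝ | k ∈ Set.Icc 0 ω ∧ ∃ c d, H.Adj c d ∧
      ((0, k) : ℝ × ℝ) ∈ segment ℝ (P c) (P d)}, ∀ k ∈ {k : ℝ | k ∈ Set.Icc 0 ω ∧ ∃ c d, H.Adj c d ∧
      ((0, k) : ℝ × ℝ) ∈ segment ℝ (P c) (P d)}, μ ≤ k := by
    have hclosed : IsClosed {k : ℝ | ∃ c d, H.Adj c d ∧ ((0, k) : ℝ × ℝ) ∈ segment ℝ (P c) (P d)} := by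
      have : {k : ℝ | ∃ c d, H.Adj c d ∧ ((0, k) : ℝ × ℝ) ∈ segment ℝ (P c) (P d)} =
          ⋃ e : {e : V × V // H.Adj e.1 e.2},
            (fun k : ℝ => ((0, k) : ℝ × ℝ)) ⁻¹' segment ℝ (P e.1.1) (P e.1.2) := by
        ext k
        simp
      rw [this]
      refine isClosed_iUnion_of_finite fun e => IsClosed.preimage (by fun_prop) ?_
      rw [segment_eq_image]
      exact (isCompact_Icc.image (by fun_prop)).isClosed
    have hcomp : IsCompact {k : ℝ | k ∈ Set.Icc 0 ω ∧ ∃ c d, H.Adj c d ∧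
        ((0, k) : ℝ × ℝ) ∈ segment ℝ (P c) (P d)} := isCompact_Icc.inter_right hclosed
    simp only [Clear] at hclear
    push Not at hclear
    obtain ⟨c, d, hcd, m, hm, hm', -⟩ := hclear
    have hm0 : m.1 = 0 ∧ 0 ≤ m.2 ∧ m.2 ≤ ω := by
      rw [mem_segment_prod, e0] at hm'
      obtain ⟨t, t0, t1, e1, e2⟩ := hm'
      simp only at e1 e2
      refine ⟨by linarith, by nlinarith, by nlinarith⟩
    have em : m = (0, m.2) := by ext <;> simp [hm0.1]
    obtain ⟨μ, h1, h2⟩ := hcomp.exists_isMinOn ⟨m.2, hm0.2, c, d, hcd, em ▸ hm⟩ continuousOn_id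
    exact ⟨μ, h1, fun k hk => h2 hk⟩
  obtain ⟨⟨hμ0, -⟩, c, d, hcd, hm⟩ := hμM
  have hμω : μ < ω := by
    simp only [Clear] at hclear
    push Not at hclear
    obtain ⟨c, d, hcd, m, hm, hm', hne⟩ := hclear
    rw [mem_segment_prod, e0] at hm'
    obtain ⟨t, t0, t1, e1, e2⟩ := hm'
    simp only at e1 e2
    have em : m = (0, m.2) := by ext <;> simp [e1]
    have hm2 : m.2 < ω := by
      refine lt_of_le_of_ne (by nlinarith) fun h => hne ?_
      rw [e0, em, h]
    exact (hμmin m.2 ⟨⟨by nlinarith, hm2.le⟩, c, d, hcd, em ▸ hm⟩).trans_lt hm2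
  have hμ : 0 < μ := by
    rcases eq_or_lt_of_le hμ0 with h | h
    · exact absurd (h ▸ hm) (huc c d hcd)
    · exact h
  have hlow : ∀ c d, H.Adj c d → ∀ k, ((0, k) : ℝ × ℝ) ∈ segment ℝ (P c) (P d) → 0 ≤ k → k ≤ μ →
      μ ≤ k := fun c d hcd k hk h1 h2 => hμmin k ⟨⟨h1, h2.trans hμω.le⟩, c, d, hcd, hk⟩
  have hver : ∀ t, (P t).1 = 0 → 0 < (P t).2 → (P t).2 ≤ μ → False := by
    intro t h1 h2 h3
    have := hmin t ⟨h1, h2, by linarith⟩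
    linarith
  -- an edge of the plane subgraph through the lowest point crosses the axis of `wb`
  have noncol : ∀ c d, H.Adj c d → ((0, μ) : ℝ × ℝ) ∈ segment ℝ (P c) (P d) → (P c).1 ≠ 0 := by
    intro c d hcd hm hc
    have hm' := hm
    rw [mem_segment_prod] at hm'
    obtain ⟨t, t0, t1, e1, e2⟩ := hm'
    simp only at e1 e2
    rw [hc] at e1
    have vert : ∀ e, (P e).1 = 0 → (P e).2 ≤ μ → P e ∈ segment ℝ (P c) (P d) → False := by
      intro e h1 h2 h3
      have h4 : (P e).2 ≤ 0 := by
        by_contra h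
        exact hver e h1 (not_le.1 h) h2
      refine huc c d hcd ((convex_segment _ _).segment_subset h3 hm ?_)
      rw [(by ext <;> simp [h1] : P e = (0, (P e).2))]
      exact mem_segment_vertical h4 hμ0
    rcases mul_eq_zero.1 (by linarith : t * (P d).1 = 0) with h | h
    · rw [h] at e2
      exact vert c hc (by linarith) (left_mem_segment _ _ _)
    · rcases le_total (P c).2 (P d).2 with hle | hle
      · exact vert c hc (by nlinarith) (left_mem_segment _ _ _)
      · exact vert d h (by nlinarith) (right_mem_segment _ _ _)
  have fin : ∀ a a', H.Adj a a' → ((0, μ) : ℝ × ℝ) ∈ segment ℝ (P a) (P a') → G.Adj a w₀ → G.Adj a b →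
      ∃ y q, Kill G P u v y b ∧ ((q, 0) : ℝ × ℝ) ∈ segment ℝ (P y) (P b) ∧ p < q ∧ -ν ≤ q ∧ q ≤ 1 ∧
        Clear H P y (q, 0) := by
    intro a a' haa hm haw hab
    have ha1 : (P a).1 ≠ 0 := noncol a a' haa hm
    have ha1' : (P a').1 ≠ 0 := noncol a' a haa.symm (by rwa [segment_symm])
    obtain ⟨nu, nv⟩ := hK₀.not_mem_hull L hab.symm hK₀.1.symm haw
    have hmT : ((0, μ) : ℝ × ℝ) ∈ convexHull ℝ {P b, P a, P w₀} :=
      hull_segment hull_corner.2.2 hull_corner.1 (hvert μ (by linarith) hμω.le)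
    have ha2 : 0 < (P a).2 := by
      by_contra h
      push Not at h
      have hs := axis_mem_segment (B := ((0, μ) : ℝ × ℝ)) h hμ
      have hsT := hull_segment hull_corner.2.1 hmT hs
      obtain ⟨b1, b2⟩ := F.axis_between (convex_convexHull ℝ _) nu nv
        (hull_segment hull_corner.2.2 hull_corner.1 h0) h0uv hsT rfl
      exact hun a a' haa ⟨_, (convex_segment _ _).segment_subset (left_mem_segment _ _ _) hm hs,
        F.mem_uv_iff.2 ⟨rfl, b1.le, b2.le⟩, fun h => nu (h ▸ hsT), fun h => nv (h ▸ hsT)⟩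
    have hKa : Kill G P u v a b := F.kill_of_above L hK₀ hab haw ha2
    have hT : ∀ t, P t ∈ convexHull ℝ {P a, (0, μ), P b} → t = b ∨ G.Adj b t := by
      intro t ht
      refine L.adj_corner hab.symm hK₀.1.symm haw (convexHull_min ?_ (convex_convexHull ℝ _) ht)
      rintro q (rfl | rfl | rfl)
      exacts [hull_corner.2.1, hmT, hull_corner.1]
    obtain ⟨s, hs, hsa⟩ : ∃ s : ℝ, (s = 1 ∨ s = -1) ∧ 0 < s * (P a).1 := by
      rcases lt_or_gt_of_ne ha1 with h | h
      · exact ⟨-1, Or.inr rfl, by linarith⟩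
      · exact ⟨1, Or.inl rfl, by linarith⟩
    obtain ⟨y, hy, hy1, hya, hyc⟩ := F.exists_clear_side L S hb hun hK haa hm
      (fun h => ha1' (by rw [← h])) hμ (by linarith) hs hsa hKa hT hlow hver
    obtain ⟨hyb, hycone, hy2⟩ := (F.kill_iff hb hK).1 hy
    have hyη : 0 < η + (P y).2 := by linarith
    have hqb : (((P y).1 * η / (η + (P y).2), 0) : ℝ × ℝ) ∈ segment ℝ (P y) (P b) := by
      rw [mem_segment_prod, F.px]
      refine ⟨(P y).2 / (η + (P y).2), div_nonneg hy2.le hyη.le, (div_le_one hyη).2 (by linarith),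
        ?_, ?_⟩
      · simp only; field_simp; ring
      · simp only; field_simp; ring
    obtain ⟨-, q1, q2⟩ := F.mem_uv_iff.1
      (F.cone_axis ((convex_cone ν η).segment_subset hycone F.cone_x hqb) rfl)
    refine ⟨y, _, hy, hqb, ?_, q1, q2, hyc⟩
    rcases hbar with hbar | hbar
    swap
    · exact hbar.trans_le q1
    rcases hs with rfl | rfl
    · exact hp.trans (div_pos (mul_pos (by linarith) hη) hyη)
    -- the edge `aa'` does not cross the clear view from `p` to `w`
    have hpa : p < (P a).1 + p * (P a).2 := by
      by_contra h
      push Not at h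
      obtain ⟨n, hn, hn'⟩ := exists_mem_segment_zero (A := P a) (B := ((0, μ) : ℝ × ℝ)) (a := 1)
        (b := p) (c := p) (by linarith) (by nlinarith)
      have n2 : 0 < n.2 := convex_upper'.segment_subset (x := P a) (y := ((0, μ) : ℝ × ℝ)) ha2 hμ hn
      have n1 : n.1 ≤ 0 := by
        rw [mem_segment_prod] at hn
        obtain ⟨t, t0, t1, e1, -⟩ := hn
        rw [e1]
        nlinarith
      have n2' : n.2 ≤ 1 := by nlinarith
      have hnw : n ∈ segment ℝ (P w) (p, 0) := by
        rw [segment_symm, F.pw]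
        exact mem_segment_of_line' one_ne_zero (by simp) hn' (by simp) n2.le n2'
      have hnaa : n ∈ segment ℝ (P a) (P a') :=
        (convex_segment _ _).segment_subset (left_mem_segment _ _ _) hm hn
      have := hbar a a' haa n hnaa hnw
      rcases S.noVertex haa (this ▸ hnaa) with rfl | rfl
      · exact ha1 (by rw [F.pw])
      · exact ha1' (by rw [F.pw])
    have haη : 0 < η + (P a).2 := by linarith
    have k1 : p * (η + (P a).2) < (P a).1 * η := by
      have g1 := mul_pos (sub_pos.2 hpa) hη
      have g2 := mul_pos (neg_pos.2 hp) ha2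
      have g3 := mul_pos g2 hη
      linarith
    rw [lt_div_iff₀ hyη]
    refine lt_of_mul_lt_mul_right ?_ haη.le
    have g1 := mul_lt_mul_of_pos_right k1 hyη
    have g2 := mul_le_mul_of_nonneg_right hya hη.le
    linarith
  have hc1 := noncol c d hcd hm
  have hd1 := noncol d c hcd.symm (by rwa [segment_symm])
  have hb1 : (P b).1 = 0 := by rw [F.px]
  rcases S.cp hcd hK₀.1 (fun h => hc1 (h ▸ h01)) (fun h => hc1 (h ▸ hb1)) (fun h => hd1 (h ▸ h01))
    (fun h => hd1 (h ▸ hb1)) hm (hvert μ (by linarith) hμω.le) with h | h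
  · exact fin c d hcd hm h.1 h.2
  · exact fin d c hcd.symm (by rwa [segment_symm]) h.1 h.2

/-- A killed edge has a clear killer. -/
theorem Kill.exists_clear [Finite V] (L : Layout G P) (S : PlaneSubgraph G H P) {u v w b : V}
    (huv : G.Adj u v) (hb : Bare P u v) (hun : Uncrossed H P u v) (hK : Kill G P u v w b) :
    ∃ y q, Kill G P u v y b ∧ q ∈ segment ℝ (P u) (P v) ∧ q ∈ segment ℝ (P y) (P b) ∧
      Clear H P y q := by
  obtain ⟨n, hn, hn'⟩ := hK.2.2.2.2.2
  obtain ⟨T, ν, η, hT, -, F⟩ := hK.exists_frame L huv hb hn hn'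
  have hν := F.hν
  obtain ⟨y, q, hy, hqy, -, h1, h2, hc⟩ := F.exists_clear (L.map hT) (S.map hT) ((bare_map hT).2 hb)
    ((uncrossed_map hT).2 hun) ((kill_map hT).2 hK) (p := -ν - 1) (by linarith) (Or.inr (by linarith))
  obtain ⟨q', hq', hqy'⟩ := exists_of_map_mem_segment hqy
  rw [hq'] at hc
  have := F.mem_uv h1 h2
  rw [hq'] at this
  exact ⟨y, q', (kill_map hT).1 hy, (map_mem_segment hT).1 this, hqy', (clear_map hT).1 hc⟩

/-- If `w` is clearly visible from the point `p` of `uv`, and an edge `wb` kills `uv` in a point closer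
to `u`, then there is also such an edge `yb` with a clear view of `y`. -/
theorem Kill.exists_clear_closer [Finite V] (L : Layout G P) (S : PlaneSubgraph G H P) {u v w b : V}
    (huv : G.Adj u v) (hb : Bare P u v) (hun : Uncrossed H P u v) (hK : Kill G P u v w b)
    {p n : ℝ × ℝ} (hp : p ∈ segment ℝ (P u) (P v)) (hc : Clear H P w p)
    (hn : n ∈ segment ℝ (P w) (P b)) (hnp : n ∈ segment ℝ (P u) p) (hne : n ≠ p) :
    ∃ y q, Kill G P u v y b ∧ q ∈ segment ℝ (P u) p ∧ q ≠ p ∧ q ∈ segment ℝ (P y) (P b) ∧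
      Clear H P y q := by
  have hnuv : n ∈ segment ℝ (P u) (P v) :=
    (convex_segment _ _).segment_subset (left_mem_segment _ _ _) hp hnp
  obtain ⟨T, ν, η, hT, hn0, F⟩ := hK.exists_frame L huv hb hnuv hn
  have hTp := F.mem_uv_iff.1 ((map_mem_segment hT).2 hp)
  have ep : T p = ((T p).1, 0) := by ext <;> simp [hTp.1]
  have hp1 : (T p).1 < 0 := by
    by_contra h
    push Not at h
    have hnp' := (map_mem_segment hT).2 hnp
    change T n ∈ segment ℝ ((T ∘ P) u) (T p) at hnp'
    rw [mem_segment_prod, hn0, F.pu] at hnp'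
    obtain ⟨t, t0, t1, e1, -⟩ := hnp'
    simp only at e1
    have k1 := mul_nonneg t0 h
    have ht : t = 1 := by linarith
    rw [ht] at e1
    apply hne
    apply hT
    rw [hn0, ep]
    ext
    · simp; linarith
    · rfl
  obtain ⟨y, q, hy, hqy, hpq, h1, h2, hc'⟩ := F.exists_clear (L.map hT) (S.map hT)
    ((bare_map hT).2 hb) ((uncrossed_map hT).2 hun) ((kill_map hT).2 hK) hp1
    (Or.inl (ep ▸ (clear_map hT).2 hc))
  obtain ⟨q', hq', hqy'⟩ := exists_of_map_mem_segment hqy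
  have hqp : T q' ∈ segment ℝ (T (P u)) (T p) := by
    rw [← hq', segment_symm, ep, show T (P u) = (1, 0) from F.pu]
    exact mem_segment_horizontal hpq.le h2
  rw [hq'] at hc'
  refine ⟨y, q', (kill_map hT).1 hy, (map_mem_segment hT).1 hqp, ?_, hqy', (clear_map hT).1 hc'⟩
  rintro rfl
  rw [← hq'] at hpq
  exact lt_irrefl _ hpq

end PlanarCP

/-! ### All edges are monochromatic -/

namespace PlanarCP

variable {V : Type*} {G H : SimpleGraph V} {P : V → ℝ × ℝ} {κ : Type*} {col : V → κ}

theorem Kill.unique (L : Layout G P) {u v w x : V} (huv : G.Adj u v) (hb : Bare P u v)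
    (hK : Kill G P u v w x) {p q : ℝ × ℝ} (hp : p ∈ segment ℝ (P u) (P v))
    (hp' : p ∈ segment ℝ (P w) (P x)) (hq : q ∈ segment ℝ (P u) (P v))
    (hq' : q ∈ segment ℝ (P w) (P x)) : q = p := by
  obtain ⟨T, ν, ξ, hT, h0, F⟩ := hK.exists_frame L huv hb hp hp'
  have h1 := (F.mem_uv_iff.1 ((map_mem_segment hT).2 hq)).1
  have h2 := (map_mem_segment hT).2 hq'
  change T q ∈ segment ℝ ((T ∘ P) w) ((T ∘ P) x) at h2
  rw [mem_segment_prod, F.pw, F.px] at h2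
  obtain ⟨t, -, -, e1, -⟩ := h2
  apply hT
  rw [h0]
  ext
  · simpa using e1
  · exact h1

/-- A killer of a part of an edge kills the whole edge. -/
theorem Kill.of_part (L : Layout G P) {u v t a b : V} (huv : G.Adj u v)
    (ht : P t ∈ segment ℝ (P u) (P v)) (htu : t ≠ u) (htv : t ≠ v) (hK : Kill G P u t a b) :
    Kill G P u v a b := by
  obtain ⟨hut, hvt⟩ := L.onseg huv ht htu htv
  obtain ⟨au, atn⟩ := hK.adj L hut
  obtain ⟨hab, nub, ntb, bu, bt, m, hm, hm'⟩ := hK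
  have hmuv : m ∈ segment ℝ (P u) (P v) :=
    (convex_segment _ _).segment_subset (left_mem_segment _ _ _) ht hm
  have htm : P t ∈ segment ℝ (P v) m := by
    rw [segment_symm] at ht hm
    exact mem_segment_of_mem ht hm
  have bv : b ≠ v := by rintro rfl; exact ntb hvt.symm
  refine ⟨hab, nub, fun hvb => ?_, bu, bv, m, hmuv, hm'⟩
  by_cases hav : a = v
  · subst hav
    have : P t ∈ segment ℝ (P a) (P b) :=
      (convex_segment _ _).segment_subset (left_mem_segment _ _ _) hm' htm
    exact ntb (L.onseg hab this htv bt.symm).2.symm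
  · have hav' : G.Adj a v := by
      rcases L.red huv hab au.ne' bu.symm (Ne.symm hav) bv.symm hmuv hm' with h | h | h | h
      · exact absurd h.2 nub
      · exact h.1.symm
      · exact h.2
      · exact absurd h.1.symm nub
    have : P t ∈ convexHull ℝ {P a, P b, P v} :=
      hull_segment hull_corner.2.2 (hull_segment hull_corner.1 hull_corner.2.1 hm') htm
    exact ntb (L.coex hab hvb.symm hav'.symm this atn.ne' bt.symm htv).2.1.symm

theorem Uncrossed.of_part (hP : Function.Injective P) {u v t : V} (h : Uncrossed H P u v)
    (ht : P t ∈ segment ℝ (P u) (P v)) (htv : t ≠ v) : Uncrossed H P u t := by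
  rintro c d hcd ⟨m, hm, hm', h1, h2⟩
  have hsub := (convex_segment (𝕜 := ℝ) (P u) (P v)).segment_subset (left_mem_segment _ _ _) ht
  refine h c d hcd ⟨m, hm, hsub hm', h1, ?_⟩
  rintro rfl
  exact htv (hP (segment_antisymm ht hm'))

theorem killers_symm (u v : V) : killers G P u v = killers G P v u := by
  ext w
  exact ⟨fun ⟨x, h⟩ => ⟨x, h.symm⟩, fun ⟨x, h⟩ => ⟨x, h.symm⟩⟩

/-- Let `uv` be an uncrossed bichromatic edge with as few killers as possible. A killer of `uv` that is
clearly visible from `uv` has the colour of `u`: consider the one of another colour whose edge meets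
`uv` closest to `u`. The hull edge between its view and `u` has the same killers as `uv`, so there is
a killer of the same colour still closer to `u`. -/
theorem Kill.col_eq_of_clear [Finite V] (L : Layout G P) (S : PlaneSubgraph G H P)
    (hcol : ∀ a b, H.Adj a b → col a = col b) {u v : V} (huv : G.Adj u v)
    (hb : Bare P u v) (hun : Uncrossed H P u v)
    (hmin : ∀ z z', G.Adj z z' → col z ≠ col z' → Uncrossed H P z z' →
      (killers G P u v).ncard ≤ (killers G P z z').ncard) {w x : V} {p : ℝ × ℝ}
    (hK : Kill G P u v w x) (hp : p ∈ segment ℝ (P u) (P v)) (hp' : p ∈ segment ℝ (P w) (P x))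
    (hc : Clear H P w p) : col w = col u := by
  by_contra hne
  let I : Type _ := {k : V × V // ∃ p, Kill G P u v k.1 k.2 ∧ p ∈ segment ℝ (P u) (P v) ∧
      p ∈ segment ℝ (P k.1) (P k.2) ∧ Clear H P k.1 p ∧ col k.1 ≠ col u}
  have : Nonempty I := ⟨⟨(w, x), p, hK, hp, hp', hc, hne⟩⟩
  have : Finite I := Subtype.finite
  clear hK hp hp' hc hne w x p
  let D : ℝ × ℝ → ℝ := fun q => |q.1 - (P u).1| + |q.2 - (P u).2|
  have hD : ∀ p q, q ∈ segment ℝ (P u) p → q ≠ p → D q < D p := by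
    intro p q hq hne
    rw [mem_segment_prod] at hq
    obtain ⟨t, t0, t1, e1, e2⟩ := hq
    have t1' : t < 1 := by
      rcases eq_or_lt_of_le t1 with h | h
      · exact absurd (by ext <;> simp [e1, e2, h]) hne
      · exact h
    have hDq : D q = t * D p := by
      simp only [D]
      rw [show q.1 - (P u).1 = t * (p.1 - (P u).1) by rw [e1]; ring,
        show q.2 - (P u).2 = t * (p.2 - (P u).2) by rw [e2]; ring, abs_mul, abs_mul,
        abs_of_nonneg t0]
      ring
    have hD0 : 0 ≤ D p := by positivity
    have hDp : D p ≠ 0 := by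
      intro h
      simp only [D] at h
      have h1 := abs_nonneg (p.1 - (P u).1)
      have h2 := abs_nonneg (p.2 - (P u).2)
      have h3 := abs_eq_zero.1 (by linarith : |p.1 - (P u).1| = 0)
      have h4 := abs_eq_zero.1 (by linarith : |p.2 - (P u).2| = 0)
      apply hne
      ext
      · rw [e1]; linear_combination (t - 1) * h3
      · rw [e2]; linear_combination (t - 1) * h4
    have := mul_pos (sub_pos.2 t1') (lt_of_le_of_ne hD0 hDp.symm)
    linarith
  choose f hf using fun k : I => k.2
  obtain ⟨k, hk⟩ := Finite.exists_min fun k => D (f k)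
  obtain ⟨hK, hp, hp', hc, hne⟩ := hf k
  obtain ⟨⟨w, x⟩, hkk⟩ := k
  generalize hpp : f ⟨(w, x), hkk⟩ = p at *
  simp only at hK hp hp' hc hne
  have hmono := fun w w' x => Kill.star_mono (w := w) (w' := w') (x := x) L S hcol huv hb hun hmin
  have closest : ∀ y b q, Kill G P u v y b → q ∈ segment ℝ (P u) p → q ≠ p →
      q ∈ segment ℝ (P y) (P b) → Clear H P y q → col y = col u := by
    intro y b q hy hq hqp hqy hqc
    by_contra hyu
    have hquv := (convex_segment (𝕜 := ℝ) (P u) (P v)).segment_subset (left_mem_segment _ _ _) hp hq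
    have h1 := hk ⟨(y, b), q, hy, hquv, hqy, hqc, hyu⟩
    obtain ⟨-, g1, g2, -⟩ := hf ⟨(y, b), q, hy, hquv, hqy, hqc, hyu⟩
    rw [Kill.unique L huv hb hy hquv hqy g1 g2] at h1
    exact absurd (hD p q hq hqp) (not_lt.2 h1)
  clear hk hpp
  obtain ⟨wu, wv⟩ := hK.adj L huv
  obtain ⟨T, ν, ξ, hT, h0, F⟩ := hK.exists_frame L huv hb hp hp'
  have hν := F.hν
  have hξ := F.hξ
  have LT := L.map hT
  have ST := S.map hT
  have hKT := (kill_map hT).2 hK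
  have hbT := (bare_map hT).2 hb
  have hunT := (uncrossed_map hT).2 hun
  have hcT := (clear_map hT).2 hc
  rw [h0] at hcT
  have h0uv : ((0, 0) : ℝ × ℝ) ∈ segment ℝ ((T ∘ P) u) ((T ∘ P) v) := F.mem_uv (by linarith) zero_le_one
  obtain ⟨t, c, z, z', C, hz, hz'⟩ := exists_hullEdge LT.inj F.pu F.pw
    (red := fun y => col y = col u)
    (by
      intro y hy h1 h2
      refine hne (Eq.trans ?_ h2)
      have e : (T ∘ P) y = (0, ((T ∘ P) y).2) := by ext <;> simp only [h1]
      have y2 := hy.2.1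
      have y2' : ((T ∘ P) y).2 ≤ 1 := by linarith [hy.2.2]
      have hyx : y ≠ x := by
        rintro rfl
        rw [F.px] at y2
        simp only at y2
        linarith
      have hyadj : G.Adj y x := by
        by_cases hyw : y = w
        · exact hyw ▸ hK.1
        · exact (LT.onseg hK.1 (e ▸ F.mem_wx (by linarith) y2') hyw hyx).2.symm
      refine hmono w y x hK ((kill_map hT).1 ⟨hyadj, hK.2.1, hK.2.2.1, hK.2.2.2.1, hK.2.2.2.2.1, _,
        h0uv, ?_⟩)
      rw [segment_symm, e, F.px]
      exact mem_segment_vertical (by linarith) y2)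
    (by
      intro y hy h1
      have e : (T ∘ P) y = (((T ∘ P) y).1, 0) := by ext <;> simp only [h1]
      rcases hbT y (e ▸ F.mem_uv (by linarith [hy.1]) (by linarith [hy.2.2, hy.2.1])) with rfl | rfl
      · rfl
      · have := hy.1
        rw [F.pv] at this
        simp only at this
        linarith)
  have hzz : col z ≠ col z' := fun h => hz' (h ▸ hz)
  have hadj : G.Adj z z' := (LT.triangle_clique huv wu.symm wv.symm (F.mem_hull C.tri)
    (F.mem_hull C.tri')).resolve_left C.ne
  have hzun : Uncrossed H (T ∘ P) z z' := by
    rintro e g heg ⟨r, hr, hr', rz, rz'⟩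
    rcases C.exit LT.inj hr' rz rz' hr with ⟨h1, h2⟩ | ⟨d, hd, -, m, hm, hm'⟩
    · exact ST.not_both hcol hzz heg h1 h2
    · have hmeg : m ∈ segment ℝ ((T ∘ P) e) ((T ∘ P) g) := by
        refine (convex_segment _ _).segment_subset hr ?_ hm
        rcases hd with rfl | rfl
        exacts [left_mem_segment _ _ _, right_mem_segment _ _ _]
      rcases hm' with ⟨h1, h2, h3⟩ | ⟨h1, h2, h3⟩
      · have m1 : m.1 < 1 :=
          lt_of_mul_lt_mul_left (by linarith [C.ct] : t * m.1 < t * 1) C.t0.le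
        refine hunT e g heg ⟨m, hmeg, F.mem_uv_iff.2 ⟨h1, by linarith, m1.le⟩, ?_, ?_⟩
        · intro h; rw [h, F.pu] at m1; simp at m1
        · intro h; rw [h, F.pv] at h2; simp at h2; linarith
      · have m2 : m.2 < 1 :=
          lt_of_mul_lt_mul_left (by linarith [C.ct'] : (1 - t) * m.2 < (1 - t) * 1)
            (by linarith [C.t1])
        have hmw : m ∈ segment ℝ ((T ∘ P) w) (0, 0) := by
          rw [segment_symm, F.pw, (by ext <;> simp [h1] : m = (0, m.2))]
          exact mem_segment_vertical h2 m2.le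
        have := hcT e g heg m hmeg hmw
        rw [this, F.pw] at m2
        simp at m2
  have hsub : killers G P z z' ⊆ killers G P u v := by
    rintro a ⟨b, hab⟩
    obtain ⟨⟨y, hy⟩, -⟩ := F.hullEdge_kill LT huv hbT hKT C ((kill_map hT).2 hab)
    exact ⟨y, (kill_map hT).1 hy⟩
  have heq := Set.eq_of_subset_of_ncard_le hsub (hmin z z' hadj hzz ((uncrossed_map hT).1 hzun))
    (Set.toFinite _)
  have hw : w ∈ killers G P u v := ⟨x, hK⟩
  rw [← heq] at hw
  obtain ⟨b, hwb⟩ := hw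
  obtain ⟨hkb, m, hm0, hm1, hm⟩ := (F.hullEdge_kill LT huv hbT hKT C ((kill_map hT).2 hwb)).2 rfl
  replace hkb := (kill_map hT).1 hkb
  obtain ⟨n, hn, hn'⟩ := exists_of_map_mem_segment hm
  have hnp : n ∈ segment ℝ (P u) p := by
    rw [← map_mem_segment hT, ← hn, h0, show T (P u) = (1, 0) from F.pu, segment_symm]
    exact mem_segment_horizontal hm0.le hm1.le
  have hnp' : n ≠ p := by
    rintro rfl
    rw [h0, Prod.mk.injEq] at hn
    exact hm0.ne' hn.1
  obtain ⟨y, q, hy, hq, hqp, hqy, hqc⟩ := hkb.exists_clear_closer L S huv hb hun hp hc hn' hnp hnp'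
  exact hne ((hmono w y b hkb hy).trans (closest y b q hy hq hqp hqy hqc))

/-- If every edge of `G` is in the plane subgraph `H`, killed, or crossed by `H`, then the ends of every
edge of `G` have the same colour in every colouring that is constant along `H`. -/
theorem PlaneSubgraph.col_eq [Finite V] (L : Layout G P) (S : PlaneSubgraph G H P)
    (hcol : ∀ a b, H.Adj a b → col a = col b)
    (hcov : ∀ u v, G.Adj u v → H.Adj u v ∨ (∃ w x, Kill G P u v w x) ∨
      ∃ c d, H.Adj c d ∧ Crosses P c d u v) {a b : V} (hab : G.Adj a b) : col a = col b := by
  by_contra hne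
  obtain ⟨z, -, z', -, hzz, hzc, -, hzu⟩ := S.exists_uncrossed L hcol (C := Set.univ)
    (fun _ _ _ _ _ _ _ _ _ _ _ => trivial) (fun _ _ _ _ _ _ _ => trivial)
    (by
      intro z _ z' _ hzz hzc hzb c d hcd hcr
      have hzH : ¬ H.Adj z z' := fun h => hzc (hcol _ _ h)
      obtain ⟨m, h1, h2, h3, h4⟩ := id hcr
      have hcr' : Crosses P d c z z' := ⟨m, by rwa [segment_symm], h2, h3, h4⟩
      rcases S.cp hcd hzz (S.ne_of_crosses hzb hzH hcd hcr)
        (S.ne_of_crosses hzb.symm (fun h => hzH h.symm) hcd hcr.symm)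
        (S.ne_of_crosses hzb hzH hcd.symm hcr')
        (S.ne_of_crosses hzb.symm (fun h => hzH h.symm) hcd.symm hcr'.symm) h1 h2 with h | h
      · exact Or.inl ⟨trivial, h⟩
      · exact Or.inr ⟨trivial, h⟩)
    ⟨a, trivial, b, trivial, hab, hne⟩
  obtain ⟨⟨u, v⟩, ⟨huv, huvc, hun⟩, hmin, hmin'⟩ := exists_lex_min
    (S := {q : V × V | G.Adj q.1 q.2 ∧ col q.1 ≠ col q.2 ∧ Uncrossed H P q.1 q.2})
    ⟨(z, z'), hzz, hzc, hzu⟩ (fun q => (killers G P q.1 q.2).ncard)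
    (fun q => {t | P t ∈ segment ℝ (P q.1) (P q.2)}.ncard)
  simp only at huv huvc hun
  have part : ∀ u v t, G.Adj u v → Uncrossed H P u v → P t ∈ segment ℝ (P u) (P v) → t ≠ u → t ≠ v →
      col u ≠ col t →
      (u, t) ∈ {q : V × V | G.Adj q.1 q.2 ∧ col q.1 ≠ col q.2 ∧ Uncrossed H P q.1 q.2} ∧
      (killers G P u t).ncard ≤ (killers G P u v).ncard ∧
      {y | P y ∈ segment ℝ (P u) (P t)}.ncard < {y | P y ∈ segment ℝ (P u) (P v)}.ncard := by
    intro u v t huv hun ht htu htv hc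
    refine ⟨⟨(L.onseg huv ht htu htv).1, hc, hun.of_part L.inj ht htv⟩, ?_, ?_⟩
    · refine Set.ncard_le_ncard ?_ (Set.toFinite _)
      rintro y ⟨x, hy⟩
      exact ⟨x, hy.of_part L huv ht htu htv⟩
    · refine Set.ncard_lt_ncard (Set.ssubset_iff_subset_ne.2 ⟨fun y hy => ?_, fun h => ?_⟩)
        (Set.toFinite _)
      · exact (convex_segment _ _).segment_subset (left_mem_segment _ _ _) ht hy
      · have hv : v ∈ {y | P y ∈ segment ℝ (P u) (P v)} := right_mem_segment _ _ _
        rw [← h] at hv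
        exact htv (L.inj (segment_antisymm ht hv))
  have hb : Bare P u v := by
    intro t ht
    by_contra hcon
    push Not at hcon
    by_cases hc : col u = col t
    · obtain ⟨h1, h2, h3⟩ := part v u t huv.symm hun.symm (by rwa [segment_symm]) hcon.2 hcon.1
        (fun h => huvc (hc.trans h.symm))
      rw [killers_symm v u, segment_symm ℝ (P v) (P u)] at *
      exact absurd (hmin' _ h1 h2) (not_le.2 h3)
    · obtain ⟨h1, h2, h3⟩ := part u v t huv hun ht hcon.1 hcon.2 hc
      exact absurd (hmin' _ h1 h2) (not_le.2 h3)
  replace hmin : ∀ z z', G.Adj z z' → col z ≠ col z' → Uncrossed H P z z' →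
      (killers G P u v).ncard ≤ (killers G P z z').ncard :=
    fun z z' h1 h2 h3 => hmin (z, z') ⟨h1, h2, h3⟩
  rcases hcov u v huv with h | ⟨w, x, hK⟩ | ⟨c, d, hcd, h⟩
  · exact huvc (hcol _ _ h)
  · obtain ⟨y, q, hy, hq, hqy, hqc⟩ := hK.exists_clear L S huv hb hun
    have h1 := Kill.col_eq_of_clear L S hcol huv hb hun hmin hy hq hqy hqc
    have h2 := Kill.col_eq_of_clear L S hcol huv.symm hb.symm hun.symm
      (by rwa [killers_symm v u]) hy.symm (by rwa [segment_symm]) hqy hqc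
    exact huvc (h1.symm.trans h2)
  · exact hun c d hcd h

end PlanarCP

/-! ### Runs of the CP-algorithm -/

namespace GeometricGraph

variable {V : Type*}

theorem Intersect.symm {G : GeometricGraph V} {u v w x : V} (h : G.Intersect u v w x) :
    G.Intersect w x u v := by
  obtain ⟨h1, p, h2, h3, h4⟩ := h
  exact ⟨h1.symm, p, h3, h2, fun h => h4 h.symm⟩

theorem Intersect.swap {G : GeometricGraph V} {u v w x : V} (h : G.Intersect u v w x) :
    G.Intersect v u w x := by
  obtain ⟨h1, p, h2, h3, h4⟩ := h
  exact ⟨by rwa [Sym2.eq_swap], p, by rwa [segment_symm], h3, fun h => h4 ⟨h.1.symm, h.2⟩⟩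

theorem Intersect.congr {G : GeometricGraph V} {a b u v w x : V} (h : G.Intersect a b w x)
    (he : s(a, b) = s(u, v)) : G.Intersect u v w x := by
  rcases Sym2.eq_iff.1 he with ⟨rfl, rfl⟩ | ⟨rfl, rfl⟩
  · exact h
  · exact h.swap

theorem CPCondition.congr {G : GeometricGraph V} {a b u v : V} (h : G.CPCondition u v)
    (he : s(a, b) = s(u, v)) : G.CPCondition a b := by
  rcases Sym2.eq_iff.1 he with ⟨rfl, rfl⟩ | ⟨rfl, rfl⟩
  · exact h
  · exact fun w x hwx hi => (h w x hwx hi.swap).symm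

/-- The invariant of the CP-algorithm. The last part is the maximality of its result: every edge that
satisfies the CP-condition is accepted, still waiting, or has been removed by an accepted edge. -/
structure CPInvariant (G : GeometricGraph V) (W F : Set (Sym2 V)) : Prop where
  waiting : W ⊆ G.edgeSet
  subset : F ⊆ G.edgeSet
  plane : ∀ a b c d, s(a, b) ∈ F → s(c, d) ∈ F → ¬ G.Intersect a b c d
  apart : ∀ a b c d, s(a, b) ∈ F → s(c, d) ∈ W → ¬ G.Intersect a b c d
  cp : ∀ a b, s(a, b) ∈ F → G.CPCondition a b
  maximal : ∀ u v, G.Adj u v → G.CPCondition u v →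
    s(u, v) ∈ W ∨ s(u, v) ∈ F ∨ ∃ c d, s(c, d) ∈ F ∧ G.Intersect c d u v

theorem CPInvariant.initial (G : GeometricGraph V) : G.CPInvariant G.edgeSet ∅ :=
  ⟨subset_rfl, Set.empty_subset _, by simp, by simp, by simp, fun _ _ h _ => Or.inl h⟩

theorem CPInvariant.step {G : GeometricGraph V} {s s' : Set (Sym2 V) × Set (Sym2 V)}
    (h : G.CPInvariant s.1 s.2) (hs : G.CPStep s s') : G.CPInvariant s'.1 s'.2 := by
  cases hs with
  | reject W F u v huv hcp =>
    refine ⟨fun e he => h.waiting he.1, h.subset, h.plane, fun a b c d hab hcd => h.apart a b c d hab hcd.1,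
      h.cp, fun a b hab hc => ?_⟩
    rcases h.maximal a b hab hc with h1 | h1
    · refine Or.inl ⟨h1, fun he => hcp (hc.congr ?_)⟩
      exact (Set.mem_singleton_iff.1 he).symm
    · exact Or.inr h1
  | accept W F u v huv hcp =>
    refine ⟨fun e he => h.waiting he.1.1, ?_, ?_, ?_, ?_, ?_⟩
    · rintro e (rfl | he)
      exacts [h.waiting huv, h.subset he]
    · rintro a b c d (hab | hab) (hcd | hcd) hi
      · exact hi.1 (hab.trans hcd.symm)
      · exact h.apart c d u v hcd huv (hi.congr hab).symm
      · exact h.apart a b u v hab huv (hi.symm.congr hcd).symm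
      · exact h.plane a b c d hab hcd hi
    · rintro a b c d (hab | hab) hcd hi
      · exact hcd.2 c d rfl (hi.congr hab)
      · exact h.apart a b c d hab hcd.1.1 hi
    · rintro a b (hab | hab)
      exacts [hcp.congr hab, h.cp a b hab]
    · intro a b hab hc
      rcases h.maximal a b hab hc with h1 | h1 | ⟨c, d, hcd, hi⟩
      · by_cases he : s(a, b) = s(u, v)
        · exact Or.inr (Or.inl (Or.inl he))
        by_cases hi : G.Intersect u v a b
        · exact Or.inr (Or.inr ⟨u, v, Or.inl rfl, hi⟩)
        · refine Or.inl ⟨⟨h1, he⟩, fun w x hwx hi' => hi ?_⟩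
          exact (hi'.symm.congr hwx.symm).symm
      · exact Or.inr (Or.inl (Or.inr h1))
      · exact Or.inr (Or.inr ⟨c, d, Or.inr hcd, hi⟩)

theorem IsCPResult.invariant {G : GeometricGraph V} {F : Set (Sym2 V)} (h : G.IsCPResult F) :
    G.CPInvariant ∅ F := by
  have : ∀ s, Relation.ReflTransGen G.CPStep (G.edgeSet, ∅) s → G.CPInvariant s.1 s.2 := by
    intro s hs
    induction hs with
    | refl => exact CPInvariant.initial G
    | tail _ hstep ih => exact ih.step hstep
  exact this _ h

/-! ### Coordinates -/

/-- The coordinates of points of the Euclidean plane. -/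
noncomputable def coord : EuclideanSpace ℝ (Fin 2) ≃ₗ[ℝ] ℝ × ℝ :=
  (EuclideanSpace.equiv (Fin 2) ℝ).toLinearEquiv.trans (LinearEquiv.finTwoArrow ℝ ℝ)

theorem coord_mem_segment {a b m : EuclideanSpace ℝ (Fin 2)} :
    coord m ∈ segment ℝ (coord a) (coord b) ↔ m ∈ segment ℝ a b := by
  have := image_segment ℝ coord.toLinearMap.toAffineMap a b
  change coord '' segment ℝ a b = segment ℝ (coord a) (coord b) at this
  rw [← this, coord.injective.mem_set_image]

theorem coord_mem_hull {a b c m : EuclideanSpace ℝ (Fin 2)} :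
    coord m ∈ convexHull ℝ {coord a, coord b, coord c} ↔ m ∈ convexHull ℝ {a, b, c} := by
  have := AffineMap.image_convexHull coord.toLinearMap.toAffineMap {a, b, c}
  change coord '' convexHull ℝ {a, b, c} = convexHull ℝ (coord '' {a, b, c}) at this
  rw [← coord.injective.mem_set_image, this]
  simp [Set.image_insert_eq]

/-- The drawing of a geometric graph in coordinates. -/
noncomputable def drawing (G : GeometricGraph V) (v : V) : ℝ × ℝ := coord (G.pos v)

theorem drawing_mem_segment (G : GeometricGraph V) {a b : V} {m : ℝ × ℝ} :
    m ∈ segment ℝ (G.drawing a) (G.drawing b) ↔ coord.symm m ∈ segment ℝ (G.pos a) (G.pos b) := by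
  rw [← coord_mem_segment, coord.apply_symm_apply]
  rfl

theorem vertex_mem_segment (G : GeometricGraph V) {a b t : V} :
    G.drawing t ∈ segment ℝ (G.drawing a) (G.drawing b) ↔
      G.pos t ∈ segment ℝ (G.pos a) (G.pos b) := coord_mem_segment

/-- Edges with four different ends intersect if they have a common point. -/
theorem intersect_of_mem (G : GeometricGraph V) {a b c d : V} (h1 : a ≠ c) (h2 : a ≠ d) (h3 : b ≠ c)
    (h4 : b ≠ d) {m : EuclideanSpace ℝ (Fin 2)} (hm : m ∈ segment ℝ (G.pos a) (G.pos b))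
    (hm' : m ∈ segment ℝ (G.pos c) (G.pos d)) : G.Intersect a b c d := by
  refine ⟨fun h => ?_, m, hm, hm', ?_⟩
  · rcases Sym2.eq_iff.1 h with ⟨h, -⟩ | ⟨h, -⟩
    exacts [h1 h, h2 h]
  · rintro ⟨rfl | rfl, h | h⟩
    exacts [h1 (G.pos.injective h), h2 (G.pos.injective h), h3 (G.pos.injective h),
      h4 (G.pos.injective h)]

/-- In a connected graph, a vertex on an edge is adjacent to its two ends. -/
theorem adj_of_mem_segment {G : GeometricGraph V} (hconn : G.toSimpleGraph.Connected)
    (hred : G.Redundancy) (hcoex : G.Coexistence) {u v x : V} (huv : G.Adj u v)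
    (hx : G.pos x ∈ segment ℝ (G.pos u) (G.pos v)) (hxu : x ≠ u) (hxv : x ≠ v) :
    G.Adj u x ∧ G.Adj v x := by
  -- one of the two edges suffices
  have one : ∀ u v, G.Adj u v → G.pos x ∈ segment ℝ (G.pos u) (G.pos v) → x ≠ u → x ≠ v →
      G.Adj u x → G.Adj v x := by
    intro u v huv hx hxu hxv hux
    have hi : G.Intersect u v u x := by
      refine ⟨fun h => ?_, G.pos x, hx, right_mem_segment _ _ _, fun h => ?_⟩
      · rcases Sym2.eq_iff.1 h with ⟨-, h⟩ | ⟨h, -⟩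
        exacts [hxv h.symm, hxu h.symm]
      · rcases h.1 with h | h
        exacts [hxu (G.pos.injective h), hxv (G.pos.injective h)]
    rcases hred u v u x huv hux hi with h | h | h | h
    · exact absurd h.1 (G.loopless.irrefl u)
    · exact h.2
    · exact absurd h.1 (G.loopless.irrefl u)
    · exact h.2.symm
  have hx' : G.pos x ∈ segment ℝ (G.pos v) (G.pos u) := by rwa [segment_symm]
  have fromu : G.Adj u x → G.Adj u x ∧ G.Adj v x := fun h => ⟨h, one u v huv hx hxu hxv h⟩
  have fromv : G.Adj v x → G.Adj u x ∧ G.Adj v x := fun h => ⟨one v u huv.symm hx' hxv hxu h, h⟩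
  have : Nontrivial V := ⟨x, u, hxu⟩
  obtain ⟨y, hxy⟩ := hconn.preconnected.exists_adj_of_nontrivial x
  by_cases hyu : y = u
  · exact fromu (hyu ▸ hxy.symm)
  by_cases hyv : y = v
  · exact fromv (hyv ▸ hxy.symm)
  have hi : G.Intersect u v x y :=
    G.intersect_of_mem hxu.symm (Ne.symm hyu) hxv.symm (Ne.symm hyv) hx (left_mem_segment _ _ _)
  rcases hred u v x y huv hxy hi with h | h | h | h
  · exact fromu h.1
  · exact fromv h.1
  · exact ⟨h.1.symm, h.2.symm⟩
  · have hT : G.pos x ∈ convexHull ℝ {G.pos u, G.pos v, G.pos y} :=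
      (convex_convexHull ℝ _).segment_subset (subset_convexHull _ _ (by simp))
        (subset_convexHull _ _ (by simp)) hx
    have := hcoex u v y x huv h.2.symm h.1 hT hxu hxv hxy.ne
    exact ⟨this.1, this.2.1⟩

theorem layout {G : GeometricGraph V} (hconn : G.toSimpleGraph.Connected) (hred : G.Redundancy)
    (hcoex : G.Coexistence) : PlanarCP.Layout G.toSimpleGraph G.drawing where
  inj := coord.injective.comp G.pos.injective
  red := fun hab hcd h1 h2 h3 h4 _ hm hm' => hred _ _ _ _ hab hcd
    (G.intersect_of_mem h1 h2 h3 h4 (G.drawing_mem_segment.1 hm) (G.drawing_mem_segment.1 hm'))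
  coex := fun h1 h2 h3 h4 => hcoex _ _ _ _ h1 h2 h3 (coord_mem_hull.1 h4)
  onseg := fun h1 h2 => adj_of_mem_segment hconn hred hcoex h1 (G.vertex_mem_segment.1 h2)

theorem planeSubgraph {G : GeometricGraph V} {F : Set (Sym2 V)} (hF : G.CPInvariant ∅ F)
    (hv : (G.withEdges F).NoVertexOnEdge) :
    PlanarCP.PlaneSubgraph G.toSimpleGraph (G.withEdges F).toSimpleGraph G.drawing where
  le := fun _ _ h => hF.subset ((SimpleGraph.fromEdgeSet_adj F).1 h).1
  noVertex := fun h1 h2 => hv _ _ _ h1 (G.vertex_mem_segment.1 h2)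
  plane := by
    intro a b c d hab hcd hne m hm hm'
    by_contra hcon
    refine hF.plane a b c d ((SimpleGraph.fromEdgeSet_adj F).1 hab).1
      ((SimpleGraph.fromEdgeSet_adj F).1 hcd).1 ⟨hne, coord.symm m, G.drawing_mem_segment.1 hm,
        G.drawing_mem_segment.1 hm', fun h => hcon ?_⟩
    simpa only [LinearEquiv.symm_apply_eq, drawing] using h
  cp := fun hab hcd h1 h2 h3 h4 _ hm hm' => hF.cp _ _ ((SimpleGraph.fromEdgeSet_adj F).1 hab).1 _ _ hcd
    (G.intersect_of_mem h1 h2 h3 h4 (G.drawing_mem_segment.1 hm) (G.drawing_mem_segment.1 hm'))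

/-- An edge that violates the CP-condition is killed: since redundancy holds but neither end of `uv` is
adjacent to both ends of the other edge, one end of the latter is adjacent to `u` and `v`, and its
other end to neither. -/
theorem exists_kill {G : GeometricGraph V} (hred : G.Redundancy) {u v : V} (huv : G.Adj u v)
    (h : ¬ G.CPCondition u v) : ∃ w x, PlanarCP.Kill G.toSimpleGraph G.drawing u v w x := by
  simp only [CPCondition] at h
  push Not at h
  obtain ⟨w, x, hwx, hi, h1, h2⟩ := h
  obtain ⟨-, p, hp, hp', -⟩ := id hi
  have key : ∀ w x, G.Adj w x → (G.Adj u w → ¬ G.Adj u x) → (G.Adj v w → ¬ G.Adj v x) →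
      p ∈ segment ℝ (G.pos w) (G.pos x) → G.Adj w u → G.Adj w v →
      PlanarCP.Kill G.toSimpleGraph G.drawing u v w x := by
    intro w x hwx h1 h2 hp' hwu hwv
    refine ⟨hwx, h1 hwu.symm, h2 hwv.symm, ?_, ?_, coord p, coord_mem_segment.2 hp,
      coord_mem_segment.2 hp'⟩
    · rintro rfl
      exact h2 hwv.symm huv.symm
    · rintro rfl
      exact h1 hwu.symm huv
  rcases hred u v w x huv hwx hi with h | h | h | h
  · exact absurd h.2 (h1 h.1)
  · exact absurd h.2 (h2 h.1)
  · exact ⟨w, x, key w x hwx h1 h2 hp' h.1 h.2⟩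
  · exact ⟨x, w, key x w hwx.symm (fun h h' => h1 h' h) (fun h h' => h2 h' h)
      (by rwa [segment_symm]) h.1 h.2⟩

theorem cover {G : GeometricGraph V} (hred : G.Redundancy) {F : Set (Sym2 V)} (hF : G.CPInvariant ∅ F)
    (hv : (G.withEdges F).NoVertexOnEdge) {u v : V} (huv : G.Adj u v) :
    (G.withEdges F).Adj u v ∨ (∃ w x, PlanarCP.Kill G.toSimpleGraph G.drawing u v w x) ∨
      ∃ c d, (G.withEdges F).Adj c d ∧ PlanarCP.Crosses G.drawing c d u v := by
  by_cases hc : G.CPCondition u v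
  · rcases hF.maximal u v huv hc with h | h | ⟨c, d, hcd, hi⟩
    · exact absurd h (Set.notMem_empty _)
    · exact Or.inl ((SimpleGraph.fromEdgeSet_adj F).2 ⟨h, huv.ne⟩)
    · have hadj : (G.withEdges F).Adj c d :=
        (SimpleGraph.fromEdgeSet_adj F).2 ⟨hcd, SimpleGraph.Adj.ne (hF.subset hcd)⟩
      obtain ⟨-, p, hp, hp', hend⟩ := hi
      -- the common point is no vertex, since there is no vertex inside `cd`
      have hne : ∀ t, (t = u ∨ t = v) → coord p ≠ G.drawing t := by
        intro t ht h
        have hpt : p = G.pos t := coord.injective h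
        apply hend
        constructor
        · rcases hv c d t hadj (hpt ▸ hp) with rfl | rfl
          exacts [Or.inl hpt, Or.inr hpt]
        · rcases ht with rfl | rfl
          exacts [Or.inl hpt, Or.inr hpt]
      exact Or.inr (Or.inr ⟨c, d, hadj, coord p, coord_mem_segment.2 hp, coord_mem_segment.2 hp',
        hne u (Or.inl rfl), hne v (Or.inr rfl)⟩)
  · exact Or.inr (Or.inl (exists_kill hred huv hc))

end GeometricGraph

theorem theorem1 {V : Type*} [Finite V] (G : GeometricGraph V)
    (hconn : G.toSimpleGraph.Connected) (hred : G.Redundancy) (hcoex : G.Coexistence)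
    (F : Set (Sym2 V)) (hF : G.IsCPResult F) :
    F ⊆ G.edgeSet ∧ (G.withEdges F).IsPlane ∧
      ((G.withEdges F).NoVertexOnEdge → (G.withEdges F).toSimpleGraph.Connected) := by
  have hI := hF.invariant
  refine ⟨hI.subset, ?_, fun hv => ?_⟩
  · intro a b c d hab hcd
    exact hI.plane a b c d ((SimpleGraph.fromEdgeSet_adj F).1 hab).1
      ((SimpleGraph.fromEdgeSet_adj F).1 hcd).1
  · have := hconn.nonempty
    have hmono : ∀ a b, G.Adj a b → (G.withEdges F).toSimpleGraph.connectedComponentMk a =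
        (G.withEdges F).toSimpleGraph.connectedComponentMk b := fun a b hab =>
      (GeometricGraph.planeSubgraph hI hv).col_eq (GeometricGraph.layout hconn hred hcoex)
        (fun a b h => SimpleGraph.ConnectedComponent.sound h.reachable)
        (fun u v huv => GeometricGraph.cover hred hI hv huv) hab
    refine SimpleGraph.Connected.mk fun a b => ?_
    obtain ⟨p⟩ := hconn.preconnected a b
    refine SimpleGraph.ConnectedComponent.exact ?_
    induction p with
    | nil => rfl
    | cons h _ ih => exact (hmono _ _ h).trans ih
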